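/- Let $f:\mathbb P^1_{\mathbb C}\to\mathbb P^1_{\mathbb C}$ be a rational map of degree $>1$, let $x\in\mathbb P^1_{\mathbb C}$ be a periodic point of exact period $p\ge 1$, let $Z=\{f^i(x)\mid i\ge 0\}$ be its cycle, and let $\lambda\in\mathbb C$ be its multiplier, i.e. the differential of $f^p$ on the tangent space at $x$ is multiplication by $\lambda$. We say that a point $c$ converges to $Z$ if $f^n(c)\to Z$ as $n\to\infty$ (for a fixed point, $f^n(c)\to x$). (1) If $0<|\lambda|<1$, then the immediate basin of attraction of $Z$ (the union of the connected components of $\{y\mid f^n(y)\to Z\}$ that contain a point of $Z$) contains a critical point of $f$. In particular at least one critical point converges to $Z$. (2) Suppose that $\lambda$ is a primitive $r$-th root of unity, $r\ge 1$, so that $f^{pr}$ is tangent to the identity at $x$. An attracting petal at $x$ is a non-empty connected open set $P$, contained in a neighbourhood of $x$ on which $f^{pr}$ is injective, with $f^{pr}(P)\subseteq P$, for which there is a direction $v$ at $x$ such that an orbit of $f^{pr}$ eventually enters $P$ if and only if it converges to $x$ from the direction $v$ without ever meeting $x$. Its immediate basin of attraction is the union of the connected components of $\{y\mid f^n(y)\in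 P\text{ for some }n\ge 0\}$ that meet the forward orbit $P,f(P),f^2(P),\dots$ of $P$. Then: (a) the immediate basin of attraction of every attracting petal at $x$ contains a critical point of $f$, and this critical point converges to $Z$; (b) in a local coordinate $w$ at $x$ one has $f^{pr}(w)=w+a\,w^{re+1}+O(w^{re+2})$ with $a\neq 0$ for an integer $e\ge 1$, and there are attracting petals $P_1,\dots,P_e$ at $x$ with pairwise disjoint immediate basins, such that the immediate basin of every attracting petal at $x$ is that of some $P_i$, and pairwise distinct critical points $c_1,\dots,c_e$ of $f$, each converging to $Z$, with $c_i$ in the immediate basin of $P_i$. In particular at least $e$ critical points converge to $Z$, one for each of the $e$ orbits of attracting petals. -/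

import Mathlib

open Filter Topology OnePoint

namespace RatDyn

/-- The Riemann sphere `ℙ¹(ℂ) = ℂ ∪ {∞}`. -/
abbrev Sphere : Type := OnePoint ℂ

/-- The degree of a rational map, written in lowest terms. -/
noncomputable def degree (f : RatFunc ℂ) : ℕ :=
  max f.num.natDegree f.denom.natDegree

/-- The self-map of the Riemann sphere given by the rational function `f`. (`f.num` and `f.denom`
are coprime and `f.denom` is monic; the value at `∞` is the limit of `f z` as `z → ∞`.) -/
noncomputable def sphereMap (f : RatFunc ℂ) : Sphere → Sphere
  | ∞ => if f.denom.natDegree < f.num.natDegree then ∞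
      else ((f.num.coeff f.denom.natDegree : ℂ) : Sphere)
  | (z : ℂ) => if f.denom.eval z = 0 then ∞
      else ((f.num.eval z / f.denom.eval z : ℂ) : Sphere)

/-- A holomorphic local parametrisation of the sphere near `x`, sending `0` to `x`:
`w ↦ x + w` if `x ∈ ℂ`, and `w ↦ 1 / w` if `x = ∞`. -/
noncomputable def param : Sphere → ℂ → Sphere
  | ∞ => fun w => if w = 0 then ∞ else ((w⁻¹ : ℂ) : Sphere)
  | (x : ℂ) => fun w => ((x + w : ℂ) : Sphere)

/-- The local coordinate at `x`, inverse to `param x` near `x`: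
`y ↦ y - x` if `x ∈ ℂ`, and `y ↦ 1 / y` if `x = ∞`.
(The values at `y = ∞`, respectively `y = 0`, far from `x`, are irrelevant.) -/
noncomputable def coord : Sphere → Sphere → ℂ
  | ∞, ∞ => 0
  | ∞, (y : ℂ) => y⁻¹
  | (_ : ℂ), ∞ => 0
  | (x : ℂ), (y : ℂ) => y - x

/-- The expression of `g` in the local coordinates at `x` and at `g x`; it maps `0` to `0`. -/
noncomputable def localExpr (g : Sphere → Sphere) (x : Sphere) (w : ℂ) : ℂ :=
  coord (g x) (g (param x w))

/-- The critical points of a holomorphic map: the points at which its differential vanishes. -/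
def IsCriticalPoint (g : Sphere → Sphere) (c : Sphere) : Prop :=
  deriv (localExpr g c) 0 = 0

/-- The multiplier of `g` at a point `x` of period `p`: the number `λ` such that the differential
of `g^p` on the tangent space at `x` is multiplication by `λ`. -/
noncomputable def multiplier (g : Sphere → Sphere) (p : ℕ) (x : Sphere) : ℂ :=
  deriv (localExpr g^[p] x) 0

/-- The forward orbit of `x`; this is the cycle of `x` when `x` is periodic. -/
def cycle (g : Sphere → Sphere) (x : Sphere) : Set Sphere :=
  Set.range fun i : ℕ => g^[i] x

/-- The orbit of `y` under `g` converges to the finite set `Z`. -/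
def ConvergesTo (g : Sphere → Sphere) (y : Sphere) (Z : Set Sphere) : Prop :=
  Tendsto (fun n : ℕ => g^[n] y) atTop (𝓝ˢ Z)

/-- The basin of attraction of a cycle `Z`. -/
def cycleBasin (g : Sphere → Sphere) (Z : Set Sphere) : Set Sphere :=
  {y | ConvergesTo g y Z}

/-- The immediate basin of attraction of a cycle `Z`: the union of the connected components of the
basin which contain a point of `Z`. -/
def cycleImmediateBasin (g : Sphere → Sphere) (Z : Set Sphere) : Set Sphere :=
  {y | ∃ z ∈ Z, y ∈ connectedComponentIn (cycleBasin g Z) z}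

/-- The orbit of `y` under `h` never meets `x`, but converges to `x` from the direction of the unit
vector `v` (in the local coordinate at `x`). -/
def ConvergesFrom (h : Sphere → Sphere) (x : Sphere) (v : ℂ) (y : Sphere) : Prop :=
  (∀ n : ℕ, h^[n] y ≠ x) ∧ Tendsto (fun n : ℕ => h^[n] y) atTop (𝓝 x) ∧
    Tendsto (fun n : ℕ => coord x (h^[n] y) / (‖coord x (h^[n] y)‖ : ℂ)) atTop (𝓝 v)

/-- `P` is an attracting petal at the fixed point `x` of `h` (for `h` tangent to the identity at
`x`): a non-empty connected open set, inside a neighbourhood of `x` on which `h` is injective, which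
`h` maps to itself, and which absorbs exactly those orbits that converge to `x`
from one fixed direction. -/
structure IsAttractingPetal (h : Sphere → Sphere) (x : Sphere) (P : Set Sphere) : Prop where
  isOpen : IsOpen P
  isConnected : IsConnected P
  injective : ∃ N ∈ 𝓝 x, Set.InjOn h N ∧ P ⊆ N
  mapsTo : Set.MapsTo h P P
  absorbs : ∃ v : ℂ, ‖v‖ = 1 ∧ ∀ y, (∃ n : ℕ, h^[n] y ∈ P) ↔ ConvergesFrom h x v y

/-- The basin of attraction of a petal `P` under `g`. -/
def petalBasin (g : Sphere → Sphere) (P : Set Sphere) : Set Sphere :=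
  {y | ∃ n : ℕ, g^[n] y ∈ P}

/-- The immediate basin of attraction of a petal `P` under `g`: the union of the connected
components of the basin of `P` which meet the forward orbit `P, g(P), g²(P), …` of the petal. -/
def petalImmediateBasin (g : Sphere → Sphere) (P : Set Sphere) : Set Sphere :=
  {y | ∃ k : ℕ, ∃ q ∈ P, y ∈ connectedComponentIn (petalBasin g P) (g^[k] q)}

end RatDyn

/-!
Let `h` be an iterate of `f` that fixes the point `x` of the cycle. In both cases `h` is conjugate,
on a piece of the sphere at `x` whose points converge to `x`, to an affine map `T` of the plane:
to `w ↦ λ w` on a disc, by the Koenigs coordinate, when the cycle is attracting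
(`exists_koenigs_parametrisation`), and to `w ↦ w + 1` on a sector `R + |Im w| < Re w`, by the Fatou
coordinate, inside an attracting petal when `h` is tangent to the identity
(`exists_fatou_parametrisation`). Let `ψ : D → ℙ¹` be the inverse of the coordinate, defined on the
convex disc or sector `D`, so that `h ∘ ψ = ψ ∘ T`.

The critical point comes from an attempt to continue `ψ` to the whole plane
(`exists_isCriticalPoint_mem_connectedComponentIn`). Let `U` be the component, containing `ψ(D)`,
of the set of points whose `h`-orbit enters `ψ(D)`. If `h` had no critical point in `U`, then `h`
would restrict to a covering `U → U` (`exists_isCoveringMap_connectedComponentIn`): `U` is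
relatively closed in `h⁻¹(U)`, so the restriction is proper, and a proper local homeomorphism is a
covering. Then `ψ ∘ T` lifts through `h` on the convex set `T⁻¹(D)`, and the lift extends `ψ` and is
again injective. As the sets `T⁻ⁿ(D)` exhaust the plane, this produces an injective holomorphic map
`Φ : ℂ → ℙ¹` with `h ∘ Φ = Φ ∘ T`. By Liouville's theorem `Φ` is a Möbius transformation and omits
at most one point (`exists_compl_singleton_subset_range`). Since `T` is injective, `h`, and hence
`f`, is injective outside one point, which is impossible in degree at least two
(`not_injOn_compl_singleton`). So `h` has a critical point in `U`, and by the chain rule some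
iterate of this point is a critical point of `f` (`exists_isCriticalPoint_of_iterate`); it lies in a
component along the same cycle.

For parabolic cycles one also has to describe all petals. Write `h(z) = z + a z ^ (k + 1) + ⋯`. In
the coordinate `-1 / (k a z ^ k)` the map is close to the translation by `1`
(`exists_parabolic_normal_form`), so an orbit can converge to `x` only from a direction `v` for
which `a v ^ k` is a negative real number (`ConvergesFrom.mul_pow_eq`), and each of these `k`
directions has a petal, the image of a right half-plane (`exists_isAttractingPetal`). The map `fᵖ`
sends orbits from the direction `v` to orbits from the direction `λ v` (`ConvergesFrom.map`).
Therefore `λ ^ k = 1`, which gives `k = r e`, and two petals have the same immediate basin if their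
directions differ by a power of `λ` (`petalImmediateBasin_eq_of_direction`) and disjoint ones
otherwise (`exists_direction_eq_of_mem_petalBasin`). The `e` classes of directions give the petals
`P₁, …, Pₑ`, and the critical points are distinct because the basins are disjoint.
-/

namespace RatDyn

/-! ### Charts of the Riemann sphere -/

@[simp] theorem param_coe (x w : ℂ) : param (x : Sphere) w = ((x + w : ℂ) : Sphere) := rfl

theorem param_infty (w : ℂ) :
    param ∞ w = if w = 0 then (∞ : Sphere) else ((w⁻¹ : ℂ) : Sphere) := rfl

@[simp] theorem coord_coe_coe (x y : ℂ) : coord (x : Sphere) (y : Sphere) = y - x := rfl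

@[simp] theorem coord_coe_infty (x : ℂ) : coord (x : Sphere) ∞ = 0 := rfl

@[simp] theorem coord_infty_coe (y : ℂ) : coord ∞ (y : Sphere) = y⁻¹ := rfl

@[simp] theorem coord_infty_infty : coord ∞ ∞ = 0 := rfl

@[simp] theorem param_zero (x : Sphere) : param x 0 = x := by
  induction x using OnePoint.rec with
  | infty => simp [param_infty]
  | coe x => simp

@[simp] theorem coord_param (x : Sphere) (w : ℂ) : coord x (param x w) = w := by
  induction x using OnePoint.rec with
  | infty =>
    by_cases hw : w = 0
    · simp [hw]
    · simp [param_infty, hw]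
  | coe x => simp

@[simp] theorem coord_self (x : Sphere) : coord x x = 0 := by
  simpa using coord_param x 0

/-- The involution `z ↦ 1 / z` of the sphere. -/
noncomputable def sphereInv : Sphere → Sphere
  | ∞ => ((0 : ℂ) : Sphere)
  | (z : ℂ) => param ∞ z

theorem sphereInv_involutive : Function.Involutive sphereInv := by
  intro y
  induction y using OnePoint.rec with
  | infty => simp [sphereInv]
  | coe z =>
    by_cases hz : z = 0
    · simp [sphereInv, hz]
    · simp [sphereInv, param_infty, hz]

theorem continuous_param_infty : Continuous (param ∞) := by
  rw [continuous_iff_continuousAt]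
  intro w
  by_cases hw : w = 0
  · subst hw
    rw [ContinuousAt, param_zero, ← nhdsNE_sup_pure, tendsto_sup]
    constructor
    · have h1 : Tendsto (fun w : ℂ => ((w⁻¹ : ℂ) : Sphere)) (𝓝[≠] 0) (𝓝 ∞) := by
        refine (OnePoint.tendsto_coe_infty (X := ℂ)).comp ?_
        rw [coclosedCompact_eq_cocompact, ← Metric.cobounded_eq_cocompact]
        exact tendsto_inv₀_nhdsNE_zero
      refine h1.congr' ?_
      filter_upwards [self_mem_nhdsWithin] with w hw
      exact (if_neg hw).symm
    · rw [tendsto_pure_left]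
      intro s hs
      simpa using mem_of_mem_nhds hs
  · have h1 : ContinuousAt (fun w : ℂ => ((w⁻¹ : ℂ) : Sphere)) w :=
      OnePoint.continuous_coe.continuousAt.comp (continuousAt_inv₀ hw)
    refine h1.congr ?_
    filter_upwards [isOpen_ne.mem_nhds hw] with w hw
    exact (if_neg hw).symm

theorem continuous_sphereInv : Continuous sphereInv := by
  rw [continuous_iff_continuousAt]
  intro y
  induction y using OnePoint.rec with
  | infty =>
    rw [OnePoint.continuousAt_infty']
    have h1 : Tendsto (fun w : ℂ => ((w⁻¹ : ℂ) : Sphere)) (coclosedCompact ℂ)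
        (𝓝 ((0 : ℂ) : Sphere)) := by
      refine (OnePoint.continuous_coe.tendsto _).comp ?_
      rw [coclosedCompact_eq_cocompact, ← Metric.cobounded_eq_cocompact]
      exact tendsto_inv₀_cobounded
    refine h1.congr' ?_
    have h2 : ∀ᶠ w : ℂ in coclosedCompact ℂ, w ≠ 0 := by
      rw [coclosedCompact_eq_cocompact]
      exact (isCompact_singleton (x := (0 : ℂ))).compl_mem_cocompact
    filter_upwards [h2] with w hw
    simp [sphereInv, param_infty, hw]
  | coe z =>
    rw [OnePoint.continuousAt_coe]
    exact continuous_param_infty.continuousAt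

theorem isOpenEmbedding_param (x : Sphere) : IsOpenEmbedding (param x) := by
  induction x using OnePoint.rec with
  | infty =>
    have h := (Homeomorph.mk ⟨sphereInv, sphereInv, sphereInv_involutive, sphereInv_involutive⟩
      continuous_sphereInv continuous_sphereInv).isOpenEmbedding
    exact h.comp (OnePoint.isOpenEmbedding_coe (X := ℂ))
  | coe x =>
    exact (OnePoint.isOpenEmbedding_coe (X := ℂ)).comp (Homeomorph.addLeft x).isOpenEmbedding

theorem continuous_param (x : Sphere) : Continuous (param x) :=
  (isOpenEmbedding_param x).continuous

theorem param_injective (x : Sphere) : Function.Injective (param x) :=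
  (isOpenEmbedding_param x).injective

theorem map_param_nhds (x : Sphere) (w : ℂ) : map (param x) (𝓝 w) = 𝓝 (param x w) :=
  (isOpenEmbedding_param x).map_nhds_eq w

theorem map_param_nhds_zero (x : Sphere) : map (param x) (𝓝 0) = 𝓝 x := by
  simpa using map_param_nhds x 0

theorem tendsto_param (x : Sphere) : Tendsto (param x) (𝓝 0) (𝓝 x) :=
  (map_param_nhds_zero x).le

theorem param_coord {x y : Sphere} (hy : y ∈ Set.range (param x)) : param x (coord x y) = y := by
  obtain ⟨w, rfl⟩ := hy
  simp

theorem range_param_mem_nhds (x : Sphere) : Set.range (param x) ∈ 𝓝 x := by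
  rw [← map_param_nhds_zero]
  exact range_mem_map

theorem eventually_param_coord (x : Sphere) : ∀ᶠ y in 𝓝 x, param x (coord x y) = y := by
  filter_upwards [range_param_mem_nhds x] with y hy using param_coord hy

theorem continuousAt_coord (x : Sphere) : ContinuousAt (coord x) x := by
  rw [ContinuousAt, ← map_param_nhds_zero x, tendsto_map'_iff, coord_self]
  exact tendsto_id.congr fun w => (coord_param x w).symm

theorem tendsto_coord (x : Sphere) : Tendsto (coord x) (𝓝 x) (𝓝 0) := by
  simpa using (continuousAt_coord x).tendsto

instance : LocallyConnectedSpace Sphere := by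
  refine locallyConnectedSpace_iff_subsets_isOpen_isConnected.2 fun x U hU => ?_
  rw [← map_param_nhds_zero x, mem_map] at hU
  obtain ⟨ε, hε, h⟩ := Metric.mem_nhds_iff.1 hU
  refine ⟨param x '' Metric.ball 0 ε, by simpa using h,
    (isOpenEmbedding_param x).isOpenMap _ Metric.isOpen_ball,
    ⟨0, by simpa using hε, param_zero x⟩, ?_⟩
  exact ((convex_ball (0 : ℂ) ε).isConnected (by simpa using hε)).image _
      (continuous_param x).continuousOn

/-! ### Holomorphic self-maps of the sphere -/

/-- `g` is holomorphic at `x`: it is continuous there and analytic in the local coordinates. -/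
structure HolAt (g : Sphere → Sphere) (x : Sphere) : Prop where
  continuousAt : ContinuousAt g x
  analyticAt : AnalyticAt ℂ (localExpr g x) 0

@[simp] theorem localExpr_zero (g : Sphere → Sphere) (x : Sphere) : localExpr g x 0 = 0 := by
  simp [localExpr]

theorem eventually_apply_param {g : Sphere → Sphere} {x : Sphere} (hg : ContinuousAt g x) :
    ∀ᶠ w in 𝓝 (0 : ℂ), g (param x w) = param (g x) (localExpr g x w) := by
  have h1 : Tendsto (fun w => g (param x w)) (𝓝 0) (𝓝 (g x)) :=
    hg.tendsto.comp (tendsto_param x)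
  filter_upwards [h1.eventually (eventually_param_coord (g x))] with w hw
  exact hw.symm

theorem localExpr_comp {g₁ g₂ : Sphere → Sphere} {x : Sphere} (h₁ : ContinuousAt g₁ x) :
    localExpr (g₂ ∘ g₁) x =ᶠ[𝓝 0] localExpr g₂ (g₁ x) ∘ localExpr g₁ x := by
  filter_upwards [eventually_apply_param h₁] with w hw
  show coord (g₂ (g₁ x)) (g₂ (g₁ (param x w))) =
    coord (g₂ (g₁ x)) (g₂ (param (g₁ x) (localExpr g₁ x w)))
  rw [hw]

theorem HolAt.comp {g₁ g₂ : Sphere → Sphere} {x : Sphere} (h₂ : HolAt g₂ (g₁ x))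
    (h₁ : HolAt g₁ x) : HolAt (g₂ ∘ g₁) x := by
  refine ⟨h₂.continuousAt.comp h₁.continuousAt, ?_⟩
  refine AnalyticAt.congr ?_ (localExpr_comp h₁.continuousAt).symm
  refine AnalyticAt.comp ?_ h₁.analyticAt
  simpa using h₂.analyticAt

theorem localExpr_id (x : Sphere) : localExpr id x = id := by
  ext w
  simp [localExpr]

theorem HolAt.id (x : Sphere) : HolAt id x :=
  ⟨continuousAt_id, by rw [localExpr_id]; exact analyticAt_id⟩

theorem HolAt.iterate {g : Sphere → Sphere} (hg : ∀ x, HolAt g x) (n : ℕ) (x : Sphere) :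
    HolAt g^[n] x := by
  induction n generalizing x with
  | zero => exact HolAt.id x
  | succ n ih => exact (ih (g x)).comp (hg x)

theorem deriv_localExpr_comp {g₁ g₂ : Sphere → Sphere} {x : Sphere} (h₂ : HolAt g₂ (g₁ x))
    (h₁ : HolAt g₁ x) : deriv (localExpr (g₂ ∘ g₁) x) 0 =
      deriv (localExpr g₂ (g₁ x)) 0 * deriv (localExpr g₁ x) 0 := by
  rw [(localExpr_comp h₁.continuousAt).deriv_eq, deriv_comp]
  · simp
  · simpa using h₂.analyticAt.differentiableAt
  · exact h₁.analyticAt.differentiableAt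

/-- A critical point of an iterate is carried by a lower iterate to a critical point. -/
theorem exists_isCriticalPoint_of_iterate {g : Sphere → Sphere} (hg : ∀ x, HolAt g x) {n : ℕ}
    {c : Sphere} (hc : IsCriticalPoint g^[n] c) : ∃ i, IsCriticalPoint g (g^[i] c) := by
  induction n generalizing c with
  | zero => simp [IsCriticalPoint, localExpr_id] at hc
  | succ n ih =>
    rw [IsCriticalPoint, Function.iterate_succ, deriv_localExpr_comp (.iterate hg n _) (hg c),
      mul_eq_zero] at hc
    rcases hc with hc | hc
    · obtain ⟨i, hi⟩ := ih hc
      exact ⟨i + 1, hi⟩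
    · exact ⟨0, hc⟩

theorem HolAt.eventually_injOn {g : Sphere → Sphere} {x : Sphere} (hg : HolAt g x)
    (hc : ¬ IsCriticalPoint g x) : ∃ N ∈ 𝓝 x, Set.InjOn g N := by
  have hs := hg.analyticAt.hasStrictDerivAt
  have h1 : ∀ᶠ w in 𝓝 (0 : ℂ), w ∈ (hs.hasStrictFDerivAt_equiv hc).toOpenPartialHomeomorph.source :=
    (OpenPartialHomeomorph.open_source _).mem_nhds
      (hs.hasStrictFDerivAt_equiv hc).mem_toOpenPartialHomeomorph_source
  have h2 := h1.and (eventually_apply_param hg.continuousAt)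
  refine ⟨param x '' {w | w ∈
    (hs.hasStrictFDerivAt_equiv hc).toOpenPartialHomeomorph.source ∧
    g (param x w) = param (g x) (localExpr g x w)}, ?_, ?_⟩
  · rw [← map_param_nhds_zero]
    exact image_mem_map h2
  · rintro _ ⟨w, ⟨hw1, hw2⟩, rfl⟩ _ ⟨w', ⟨hw1', hw2'⟩, rfl⟩ h
    rw [hw2, hw2'] at h
    rw [(hs.hasStrictFDerivAt_equiv hc).toOpenPartialHomeomorph.injOn hw1 hw1'
      (param_injective _ h)]

theorem HolAt.map_nhds_eq {g : Sphere → Sphere} {x : Sphere} (hg : HolAt g x)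
    (hc : ¬ IsCriticalPoint g x) : map g (𝓝 x) = 𝓝 (g x) := by
  have hs := (hg.analyticAt.hasStrictDerivAt.hasStrictFDerivAt_equiv hc).map_nhds_eq_of_equiv
  rw [localExpr_zero] at hs
  calc map g (𝓝 x) = map (g ∘ param x) (𝓝 0) := by rw [← map_map, map_param_nhds_zero]
    _ = map (param (g x) ∘ localExpr g x) (𝓝 0) :=
      Filter.map_congr (eventually_apply_param hg.continuousAt)
    _ = 𝓝 (g x) := by rw [← map_map, hs, map_param_nhds_zero]

/-! ### Rational maps of the sphere -/

/-- The point of the sphere with homogeneous coordinates `[a : b]`. -/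
noncomputable def ofHomogeneous (a b : ℂ) : Sphere := if b = 0 then ∞ else ((a / b : ℂ) : Sphere)

theorem ofHomogeneous_of_ne_zero_right {a b : ℂ} (hb : b ≠ 0) :
    ofHomogeneous a b = ((a / b : ℂ) : Sphere) := if_neg hb

theorem ofHomogeneous_of_ne_zero_left {a b : ℂ} (ha : a ≠ 0) :
    ofHomogeneous a b = param ∞ (b / a) := by
  by_cases hb : b = 0
  · simp [ofHomogeneous, hb]
  · simp [ofHomogeneous, param_infty, hb, ha]

open Polynomial in
/-- In each chart of the source, a rational map is a quotient of polynomials without common zero at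
the centre of the chart. -/
theorem exists_sphereMap_param_eq (f : RatFunc ℂ) (c : Sphere) :
    ∃ A B : ℂ[X], (A.eval 0 ≠ 0 ∨ B.eval 0 ≠ 0) ∧
      ∀ w, sphereMap f (param c w) = ofHomogeneous (A.eval w) (B.eval w) := by
  induction c using OnePoint.rec with
  | infty =>
    set N := max f.num.natDegree f.denom.natDegree with hN
    refine ⟨reflect N f.num, reflect N f.denom, ?_, fun w => ?_⟩
    · rw [← coeff_zero_eq_eval_zero, ← coeff_zero_eq_eval_zero, coeff_reflect, coeff_reflect,
        revAt_zero]
      rcases le_total f.num.natDegree f.denom.natDegree with h | h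
      · right
        rw [hN, max_eq_right h, coeff_natDegree, f.monic_denom.leadingCoeff]
        exact one_ne_zero
      · by_cases h0 : f.num = 0
        · right
          have : N = f.denom.natDegree := by rw [hN]; simp [h0]
          rw [this, coeff_natDegree, f.monic_denom.leadingCoeff]
          exact one_ne_zero
        · left
          rw [hN, max_eq_left h, coeff_natDegree]
          exact leadingCoeff_ne_zero.2 h0
    · by_cases hw : w = 0
      · subst hw
        rw [param_zero, ← coeff_zero_eq_eval_zero, ← coeff_zero_eq_eval_zero, coeff_reflect,
          coeff_reflect, revAt_zero]
        by_cases h : f.denom.natDegree < f.num.natDegree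
        · rw [hN, max_eq_left h.le, coeff_eq_zero_of_natDegree_lt h]
          simp [sphereMap, ofHomogeneous, h]
        · rw [hN, max_eq_right (not_lt.1 h),
            show f.denom.coeff f.denom.natDegree = 1 from f.monic_denom]
          simp [sphereMap, ofHomogeneous, h]
      · have key : ∀ p : ℂ[X], p.natDegree ≤ N → eval w (reflect N p) = eval w⁻¹ p * w ^ N := by
          intro p hp
          have hw' : w⁻¹ ≠ 0 := inv_ne_zero hw
          let : Invertible w⁻¹ := invertibleOfNonzero hw'
          have h := eval₂_reflect_mul_pow (RingHom.id ℂ) w⁻¹ N p hp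
          rw [invOf_eq_inv, inv_inv] at h
          simp only [eval₂_id] at h
          rw [← h, inv_pow, mul_assoc, inv_mul_cancel₀ (pow_ne_zero _ hw), mul_one]
        rw [key _ (le_max_left _ _), key _ (le_max_right _ _), param_infty, if_neg hw]
        by_cases h : eval w⁻¹ f.denom = 0
        · simp [sphereMap, ofHomogeneous, h]
        · simp only [sphereMap, ofHomogeneous, h, if_false, mul_eq_zero, pow_eq_zero_iff', hw,
            false_and, or_false]
          rw [mul_div_mul_right _ _ (pow_ne_zero _ hw)]
  | coe c =>
    refine ⟨f.num.comp (X + C c), f.denom.comp (X + C c), ?_, fun w => ?_⟩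
    · obtain ⟨u, v, huv⟩ := f.isCoprime_num_denom
      by_contra! h
      have := congrArg (eval c) huv
      simp only [eval_comp, eval_add, eval_X, eval_C, zero_add] at h
      simp [h.1, h.2] at this
    · simp [sphereMap, ofHomogeneous, add_comm]

/-- A rational map is holomorphic on the whole sphere. -/
theorem holAt_sphereMap (f : RatFunc ℂ) (x : Sphere) : HolAt (sphereMap f) x := by
  obtain ⟨A, B, h0, hAB⟩ := exists_sphereMap_param_eq f x
  have hA : AnalyticAt ℂ (fun w => A.eval w) 0 := by
    simpa using AnalyticAt.aeval_polynomial (analyticAt_id (𝕜 := ℂ) (z := (0 : ℂ))) A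
  have hB : AnalyticAt ℂ (fun w => B.eval w) 0 := by
    simpa using AnalyticAt.aeval_polynomial (analyticAt_id (𝕜 := ℂ) (z := (0 : ℂ))) B
  have hx : sphereMap f x = ofHomogeneous (A.eval 0) (B.eval 0) := by simpa using hAB 0
  suffices h : ∃ φ : ℂ → ℂ, AnalyticAt ℂ φ 0 ∧
      ∀ᶠ w in 𝓝 0, sphereMap f (param x w) = param (sphereMap f x) (φ w) by
    obtain ⟨φ, hφ, h⟩ := h
    have hφ0 : φ 0 = 0 := by
      have := h.self_of_nhds
      rw [param_zero] at this
      have := congrArg (coord (sphereMap f x)) this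
      simpa using this.symm
    refine ⟨?_, hφ.congr ?_⟩
    · rw [ContinuousAt, ← map_param_nhds_zero x, tendsto_map'_iff]
      have : Tendsto (fun w => param (sphereMap f x) (φ w)) (𝓝 0) (𝓝 (sphereMap f x)) := by
        refine (tendsto_param _).comp ?_
        simpa [hφ0] using hφ.continuousAt.tendsto
      exact this.congr' (h.mono fun w hw => hw.symm)
    · filter_upwards [h] with w hw
      rw [localExpr, hw, coord_param]
  by_cases hB0 : B.eval 0 = 0
  · have hA0 : A.eval 0 ≠ 0 := h0.resolve_right (not_not.2 hB0)
    refine ⟨fun w => B.eval w / A.eval w, hB.div hA hA0, ?_⟩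
    have : sphereMap f x = ∞ := by rw [hx, ofHomogeneous, if_pos hB0]
    rw [this]
    filter_upwards [hA.continuousAt.eventually_ne hA0] with w hw
    rw [hAB, ofHomogeneous_of_ne_zero_left hw]
  · refine ⟨fun w => A.eval w / B.eval w - A.eval 0 / B.eval 0,
      (hA.div hB hB0).sub analyticAt_const, ?_⟩
    rw [hx, ofHomogeneous_of_ne_zero_right hB0]
    filter_upwards [hB.continuousAt.eventually_ne hB0] with w hw
    rw [hAB, ofHomogeneous_of_ne_zero_right hw, param_coe, add_sub_cancel]

theorem continuous_sphereMap (f : RatFunc ℂ) : Continuous (sphereMap f) :=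
  continuous_iff_continuousAt.2 fun x => (holAt_sphereMap f x).continuousAt

open Polynomial in
theorem exists_isRoot_derivative_of_unique_root {q : ℂ[X]} (hq : 2 ≤ q.natDegree)
    (h : ∀ a b, q.IsRoot a → q.IsRoot b → a = b) :
    ∃ a, q.IsRoot a ∧ q.derivative.IsRoot a := by
  have hq0 : q ≠ 0 := by rintro rfl; simp at hq
  have hdeg : q.degree ≠ 0 := by
    intro h0
    have := natDegree_eq_zero_iff_degree_le_zero.2 h0.le
    omega
  obtain ⟨a, ha⟩ := IsAlgClosed.exists_root q hdeg
  have hrep : q.roots = Multiset.replicate q.natDegree a :=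
    Multiset.eq_replicate.2 ⟨(IsAlgClosed.splits q).natDegree_eq_card_roots.symm,
      fun b hb => h b a (isRoot_of_mem_roots hb) ha⟩
  have hmul : 1 < q.rootMultiplicity a := by
    rw [← count_roots, hrep, Multiset.count_replicate_self]
    omega
  exact ⟨a, (one_lt_rootMultiplicity_iff_isRoot hq0).1 hmul⟩

open Polynomial in
/-- A rational map of degree at least two is not injective, even outside one point: otherwise
almost every value would be taken at a multiple root, but the Wronskian of the numerator and the
denominator has only finitely many zeros. -/
theorem not_injOn_compl_singleton {f : RatFunc ℂ} (hf : 1 < degree f) (z : Sphere) :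
    ¬ Set.InjOn (sphereMap f) {z}ᶜ := by
  intro hinj
  set d := degree f with hd
  have hcop := f.isCoprime_num_denom
  have hden0 : f.denom ≠ 0 := f.denom_ne_zero
  have htop : f.num.coeff d ≠ 0 ∨ f.denom.coeff d ≠ 0 := by
    rcases le_total f.num.natDegree f.denom.natDegree with h | h
    · right
      rw [hd, degree, max_eq_right h, coeff_natDegree]
      exact leadingCoeff_ne_zero.2 hden0
    · left
      rw [hd, degree, max_eq_left h, coeff_natDegree]
      refine leadingCoeff_ne_zero.2 ?_
      intro h0
      rw [h0] at h
      simp only [natDegree_zero, nonpos_iff_eq_zero] at h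
      rw [hd, degree, h0, h] at hf
      simp at hf
  -- the values `y` for which `f.num - y f.denom` has full degree `d` and which are not taken at `z`
  set Y : Set ℂ := {y | f.num.coeff d - y * f.denom.coeff d ≠ 0 ∧ (y : Sphere) ≠ sphereMap f z}
    with hY
  have hYc : Yᶜ.Finite := by
    have h1 : {y : ℂ | f.num.coeff d - y * f.denom.coeff d = 0}.Finite := by
      refine (Set.finite_singleton (f.num.coeff d / f.denom.coeff d)).subset ?_
      intro y hy
      have hy : f.num.coeff d - y * f.denom.coeff d = 0 := hy
      have h2 : f.denom.coeff d ≠ 0 := by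
        intro h0
        rw [h0, mul_zero, sub_zero] at hy
        tauto
      rw [Set.mem_singleton_iff, eq_div_iff h2]
      exact (sub_eq_zero.1 hy).symm
    have h2 : {y : ℂ | (y : Sphere) = sphereMap f z}.Finite :=
      Set.Subsingleton.finite fun a ha b hb =>
        OnePoint.coe_injective (Eq.trans ha (Eq.symm hb))
    refine (h1.union h2).subset fun y hy => ?_
    by_contra h
    exact hy ⟨fun h' => h (Or.inl h'), fun h' => h (Or.inr h')⟩
  have hYinf : Y.Infinite := by
    have := hYc.infinite_compl
    rwa [compl_compl] at this
  have hval : ∀ y a : ℂ, (f.num - C y * f.denom).IsRoot a →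
      f.denom.eval a ≠ 0 ∧ sphereMap f (a : Sphere) = (y : Sphere) := by
    intro y a ha
    have h1 : f.num.eval a = y * f.denom.eval a := by
      simpa [IsRoot, sub_eq_zero] using ha
    have h2 : f.denom.eval a ≠ 0 := by
      intro h0
      obtain ⟨u, v, huv⟩ := hcop
      have := congrArg (eval a) huv
      simp [h1, h0] at this
    refine ⟨h2, ?_⟩
    simp [sphereMap, h2, h1]
  have hdouble : ∀ y ∈ Y, ∃ a, (f.num - C y * f.denom).IsRoot a ∧
      (f.num - C y * f.denom).derivative.IsRoot a := by
    intro y hy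
    apply exists_isRoot_derivative_of_unique_root
    · refine le_trans (show 2 ≤ d from hf) (le_natDegree_of_ne_zero ?_)
      simpa using hy.1
    · intro a b ha hb
      have h1 := (hval y a ha).2
      have h2 := (hval y b hb).2
      apply OnePoint.coe_injective (X := ℂ)
      refine hinj ?_ ?_ (h1.trans h2.symm)
      · rintro rfl; exact hy.2 h1.symm
      · rintro rfl; exact hy.2 h2.symm
  choose! a ha ha' using hdouble
  have hW : wronskian f.num f.denom ≠ 0 := by
    rw [Ne, hcop.wronskian_eq_zero_iff]
    rintro ⟨h1, h2⟩
    rw [hd, degree, derivative_eq_zero.1 h1,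
      derivative_eq_zero.1 h2] at hf
    simp at hf
  have hmaps : Set.MapsTo a Y {b | (wronskian f.num f.denom).IsRoot b} := by
    intro y hy
    have h1 : f.num.eval (a y) = y * f.denom.eval (a y) := by
      simpa [IsRoot, sub_eq_zero] using ha y hy
    have h2 : f.num.derivative.eval (a y) = y * f.denom.derivative.eval (a y) := by
      simpa [IsRoot, sub_eq_zero] using ha' y hy
    simp only [Set.mem_ofPred_eq, IsRoot, wronskian, eval_sub, eval_mul, h1, h2]
    ring
  have hainj : Set.InjOn a Y := by
    intro y hy y' hy' h
    have h1 := (hval y _ (ha y hy)).2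
    have h2 := (hval y' _ (ha y' hy')).2
    rw [h, h2] at h1
    exact (OnePoint.coe_injective h1).symm
  exact hYinf (Set.Finite.of_injOn hmaps hainj (finite_setOfPred_isRoot hW))

/-- An iterate of a rational map of degree at least two is not the identity on an open set. -/
theorem not_eventually_iterate_eq {f : RatFunc ℂ} (hf : 1 < degree f) {n : ℕ} (hn : 0 < n)
    (x : Sphere) : ¬ ∀ᶠ y in 𝓝 x, (sphereMap f)^[n] y = y := by
  intro hx
  set h := (sphereMap f)^[n] with hh
  have hol : ∀ y, HolAt h y := fun y => .iterate (holAt_sphereMap f) n y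
  have hcont : Continuous h := continuous_iff_continuousAt.2 fun y => (hol y).continuousAt
  have hclopen : IsClopen {y | ∀ᶠ z in 𝓝 y, h z = z} := by
    refine ⟨isClosed_of_closure_subset fun y hy => ?_, isOpen_setOfPred_eventually_nhds⟩
    have hfix : h y = y := by
      have hcl : IsClosed {z | h z = z} := isClosed_eq hcont continuous_id
      exact closure_minimal (fun z hz => Eventually.self_of_nhds hz) hcl hy
    have hmem : ∀ w, h (param y w) = param y w → localExpr h y w = w := by
      intro w hw
      rw [localExpr, hfix, hw, coord_param]
    have hfreq : ∃ᶠ w in 𝓝[≠] (0 : ℂ), localExpr h y w = w := by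
      rw [frequently_iff]
      intro U hU
      rw [mem_nhdsWithin] at hU
      obtain ⟨V, hV, h0V, hVU⟩ := hU
      have hVy : param y '' V ∈ 𝓝 y :=
        ((isOpenEmbedding_param y).isOpenMap V hV).mem_nhds ⟨0, h0V, param_zero y⟩
      obtain ⟨z, ⟨w, hwV, rfl⟩, hz⟩ := mem_closure_iff_nhds.1 hy _ hVy
      have hz' : ∀ᶠ w' in 𝓝 w, h (param y w') = param y w' := by
        have hz : ∀ᶠ z in 𝓝 (param y w), h z = z := hz
        rwa [← map_param_nhds, eventually_map] at hz
      obtain ⟨w', hw', h1, h2⟩ := (dense_compl_singleton (0 : ℂ)).inter_nhds_nonempty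
        (hz'.and (hV.mem_nhds hwV))
      exact ⟨w', hVU ⟨h2, hw'⟩, hmem _ h1⟩
    have hev := ((hol y).analyticAt.frequently_eq_iff_eventually_eq analyticAt_id).1 hfreq
    show ∀ᶠ z in 𝓝 y, h z = z
    rw [← map_param_nhds_zero, eventually_map]
    filter_upwards [hev, eventually_apply_param (hol y).continuousAt] with w h1 h2
    rw [h2, hfix, h1, id]
  have huniv := hclopen.eq_univ ⟨x, hx⟩
  have hinj : Function.Injective (sphereMap f) := by
    obtain ⟨m, rfl⟩ := Nat.exists_eq_succ_of_ne_zero hn.ne'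
    refine Function.Injective.of_comp (f := (sphereMap f)^[m]) ?_
    rw [← Function.iterate_succ]
    intro y z hyz
    have h1 := Eventually.self_of_nhds (huniv.ge (Set.mem_univ y))
    have h2 := Eventually.self_of_nhds (huniv.ge (Set.mem_univ z))
    exact h1.symm.trans (hyz.trans h2)
  exact not_injOn_compl_singleton hf ∞ hinj.injOn

/-! ### Coverings between components without critical points -/

theorem continuous_of_holAt {h : Sphere → Sphere} (hol : ∀ x, HolAt h x) : Continuous h :=
  continuous_iff_continuousAt.2 fun x => (hol x).continuousAt

theorem closure_connectedComponentIn_inter_subset {X : Type*} [TopologicalSpace X] {B : Set X}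
    {y : X} (hy : y ∈ B) :
    closure (connectedComponentIn B y) ∩ B ⊆ connectedComponentIn B y := by
  have h : IsPreconnected (closure (connectedComponentIn B y) ∩ B) :=
    isPreconnected_connectedComponentIn.subset_closure
      (Set.subset_inter subset_closure (connectedComponentIn_subset B y)) Set.inter_subset_left
  exact h.subset_connectedComponentIn ⟨subset_closure (mem_connectedComponentIn hy), hy⟩
    Set.inter_subset_right

/-- A holomorphic map of the sphere which maps a component of a completely invariant open set to
itself, without critical points there, is a covering of that component. -/
theorem exists_isCoveringMap_connectedComponentIn {h : Sphere → Sphere} (hol : ∀ x, HolAt h x)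
    {B : Set Sphere} (hBo : IsOpen B) (hB : ∀ y, h y ∈ B ↔ y ∈ B) {y : Sphere}
    (hy : h y ∈ connectedComponentIn B y)
    (hcrit : ∀ c ∈ connectedComponentIn B y, ¬ IsCriticalPoint h c) :
    ∃ hm : Set.MapsTo h (connectedComponentIn B y) (connectedComponentIn B y),
      IsCoveringMap (hm.restrict h (connectedComponentIn B y) (connectedComponentIn B y)) := by
  have hc := continuous_of_holAt hol
  have hyB : y ∈ B := connectedComponentIn_nonempty_iff.1 ⟨_, hy⟩
  set U := connectedComponentIn B y with hU
  have hUo : IsOpen U := hBo.connectedComponentIn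
  have hUB : U ⊆ B := connectedComponentIn_subset B y
  have hm : Set.MapsTo h U U := by
    have h1 : h '' U ⊆ connectedComponentIn B (h y) :=
      (isPreconnected_connectedComponentIn.image h hc.continuousOn).subset_connectedComponentIn
        ⟨y, mem_connectedComponentIn hyB, rfl⟩
        (by rintro _ ⟨u, hu, rfl⟩; exact (hB u).2 (hUB hu))
    rw [← connectedComponentIn_eq hy] at h1
    exact Set.mapsTo_iff_image_subset.2 h1
  -- `U` is relatively closed in `h ⁻¹' U`, which makes the restriction of `h` proper
  have hclU : ∀ c ∈ closure U, h c ∈ U → c ∈ U := fun c hc1 hc2 =>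
    closure_connectedComponentIn_inter_subset hyB ⟨hc1, (hB c).1 (hUB hc2)⟩
  refine ⟨hm, ?_⟩
  set p := hm.restrict h U U with hp
  have hpc : Continuous p := hc.continuousOn.mapsToRestrict hm
  have hpclosed : IsClosedMap p := by
    intro C hC
    obtain ⟨K, hK, rfl⟩ := isClosed_induced_iff.1 hC
    have hcomp : IsCompact (h '' (K ∩ closure U)) :=
      ((hK.inter isClosed_closure).isCompact).image hc
    have : p '' (Subtype.val ⁻¹' K) = Subtype.val ⁻¹' (h '' (K ∩ closure U)) := by
      ext ⟨v, hv⟩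
      constructor
      · rintro ⟨u, hu, huv⟩
        exact ⟨u, ⟨hu, subset_closure u.2⟩, congrArg Subtype.val huv⟩
      · rintro ⟨c, ⟨hcK, hcU⟩, hcv⟩
        have hcU' := hclU c hcU (by rw [hcv]; exact hv)
        exact ⟨⟨c, hcU'⟩, hcK, Subtype.ext hcv⟩
    rw [this]
    exact hcomp.isClosed.preimage continuous_subtype_val
  have hpopen : IsOpenMap p := by
    intro S hS
    have hS' : IsOpen (Subtype.val '' S) := hUo.isOpenMap_subtype_val S hS
    have himg : IsOpen (h '' (Subtype.val '' S)) := by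
      rw [isOpen_iff_mem_nhds]
      rintro _ ⟨_, ⟨u, hu, rfl⟩, rfl⟩
      rw [← (hol u).map_nhds_eq (hcrit u u.2)]
      exact image_mem_map (hS'.mem_nhds ⟨u, hu, rfl⟩)
    have : p '' S = Subtype.val ⁻¹' (h '' (Subtype.val '' S)) := by
      ext v
      constructor
      · rintro ⟨u, hu, huv⟩
        exact ⟨u, ⟨u, hu, rfl⟩, congrArg Subtype.val huv⟩
      · rintro ⟨_, ⟨u, hu, rfl⟩, huv⟩
        exact ⟨u, hu, Subtype.ext huv⟩
    rw [this]
    exact himg.preimage continuous_subtype_val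
  have hloc : IsLocalHomeomorph p := by
    rw [isLocalHomeomorph_iff_isOpenEmbedding_restrict]
    intro u
    obtain ⟨N, hN, hinj⟩ := (hol u).eventually_injOn (hcrit u u.2)
    obtain ⟨V, hVN, hV, huV⟩ := mem_nhds_iff.1 hN
    have hVo : IsOpen (Subtype.val ⁻¹' V : Set U) := hV.preimage continuous_subtype_val
    refine ⟨Subtype.val ⁻¹' V, hVo.mem_nhds huV, ?_⟩
    refine IsOpenEmbedding.of_continuous_injective_isOpenMap
      (hpc.comp continuous_subtype_val) ?_ (hpopen.comp hVo.isOpenMap_subtype_val)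
    intro a b hab
    have : h a.1.1 = h b.1.1 := congrArg Subtype.val hab
    exact Subtype.ext (Subtype.ext (hinj (hVN a.2) (hVN b.2) this))
  rw [isCoveringMap_iff_isCoveringMapOn_univ]
  refine hpclosed.isCoveringMapOn_of_isLocalHomeomorphOn (fun v _ => ?_) hloc.isLocalHomeomorphOn
  have hFsub : closure U ∩ h ⁻¹' {v.1} ⊆ U := fun c hc =>
    hclU c hc.1 (by rw [show h c = v.1 from hc.2]; exact v.2)
  have hFfin : (closure U ∩ h ⁻¹' {v.1}).Finite := by
    refine IsCompact.finite (isClosed_closure.inter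
      (isClosed_singleton.preimage hc)).isCompact ?_
    refine isDiscrete_iff_forall_mem_exists_isOpen.mpr fun c hcF => ?_
    obtain ⟨N, hN, hinj⟩ := (hol c).eventually_injOn (hcrit c (hFsub hcF))
    obtain ⟨V, hVN, hV, hcV⟩ := mem_nhds_iff.1 hN
    refine ⟨V, hV, Set.Subset.antisymm ?_ (Set.singleton_subset_iff.2 ⟨hcV, hcF⟩)⟩
    rintro d ⟨hdV, hdF⟩
    exact hinj (hVN hdV) (hVN hcV) (Eq.trans hdF.2 (Eq.symm hcF.2))
  refine (hFfin.preimage Subtype.val_injective.injOn).subset fun u hu => ?_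
  exact ⟨subset_closure u.2, congrArg Subtype.val hu⟩

/-! ### Holomorphic curves in the sphere -/

/-- The map `ψ` from the plane to the sphere is continuous at `w`, and complex differentiable there
in the local coordinate at `ψ w`. -/
structure HolCurveAt (ψ : ℂ → Sphere) (w : ℂ) : Prop where
  continuousAt : ContinuousAt ψ w
  differentiableAt : DifferentiableAt ℂ (fun u => coord (ψ w) (ψ u)) w

theorem HolCurveAt.congr {ψ φ : ℂ → Sphere} {w : ℂ} (hψ : HolCurveAt ψ w) (h : φ =ᶠ[𝓝 w] ψ) :
    HolCurveAt φ w := by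
  refine ⟨hψ.continuousAt.congr h.symm, hψ.differentiableAt.congr_of_eventuallyEq ?_⟩
  filter_upwards [h] with u hu
  rw [hu, h.self_of_nhds]

theorem HolCurveAt.comp {ψ : ℂ → Sphere} {T : ℂ → ℂ} {w : ℂ} (hψ : HolCurveAt ψ (T w))
    (hT : DifferentiableAt ℂ T w) : HolCurveAt (ψ ∘ T) w :=
  ⟨hψ.continuousAt.comp hT.continuousAt, hψ.differentiableAt.comp w hT⟩

/-- A continuous lift of a holomorphic curve through a holomorphic map without critical points is
holomorphic. -/
theorem HolCurveAt.of_comp {ψ : ℂ → Sphere} {h : Sphere → Sphere} {w : ℂ}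
    (hψ : ContinuousAt ψ w) (hh : HolAt h (ψ w)) (hc : ¬ IsCriticalPoint h (ψ w))
    (H : HolCurveAt (h ∘ ψ) w) : HolCurveAt ψ w := by
  refine ⟨hψ, ?_⟩
  set L := localExpr h (ψ w) with hL
  have hs := hh.analyticAt.hasStrictDerivAt
  rw [← hL] at hs
  set s := hs.localInverse L _ 0 hc with hsdef
  have hsd : DifferentiableAt ℂ s (L 0) := (hs.to_localInverse hc).hasDerivAt.differentiableAt
  have hη : Tendsto (fun u => coord (ψ w) (ψ u)) (𝓝 w) (𝓝 0) :=
    (tendsto_coord (ψ w)).comp hψ.tendsto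
  have hleft : ∀ᶠ z in 𝓝 (0 : ℂ), s (L z) = z :=
    HasStrictFDerivAt.eventually_left_inverse (hs.hasStrictFDerivAt_equiv hc)
  have hH0 : coord ((h ∘ ψ) w) ((h ∘ ψ) w) = L 0 := by
    simp [hL]
  have hcomp : DifferentiableAt ℂ (s ∘ fun u => coord ((h ∘ ψ) w) ((h ∘ ψ) u)) w :=
    DifferentiableAt.comp w (by rw [hH0]; exact hsd) H.differentiableAt
  refine hcomp.congr_of_eventuallyEq ?_
  filter_upwards [hη.eventually hleft, hψ.eventually (eventually_param_coord (ψ w))] with u h1 h2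
  rw [Function.comp_apply, Function.comp_apply, Function.comp_apply]
  rw [hL, localExpr, h2] at h1
  exact h1.symm

theorem mem_range_param_of_coord_ne_zero {x y : Sphere} (h : coord x y ≠ 0) :
    y ∈ Set.range (param x) := by
  induction x using OnePoint.rec with
  | infty =>
    induction y using OnePoint.rec with
    | infty => simp at h
    | coe y => exact ⟨y⁻¹, by simpa [param_infty] using h⟩
  | coe x =>
    induction y using OnePoint.rec with
    | infty => simp at h
    | coe y => exact ⟨y - x, by simp⟩

/-- The coordinate at `x` separates the points other than `x`: only `x` itself and the point outside
the chart share a value, the value `0`. -/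
theorem coord_injOn (x : Sphere) : Set.InjOn (coord x) {x}ᶜ := by
  intro y hy z hz h
  by_cases h0 : coord x y = 0
  · have h0' : coord x z = 0 := h ▸ h0
    clear h
    induction x using OnePoint.rec <;> induction y using OnePoint.rec <;>
      induction z using OnePoint.rec <;> simp_all [sub_eq_zero]
  · rw [← param_coord (mem_range_param_of_coord_ne_zero h0), h,
      param_coord (mem_range_param_of_coord_ne_zero (h ▸ h0))]

/-- The inverse of the coordinate at `x` is holomorphic on the whole complement of `x`, also at the
point outside the chart, where the value `0` of `coord x` gives the correct value `0⁻¹ = 0`. -/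
theorem differentiableAt_inv_coord_param {x y : Sphere} (h : y ≠ x) :
    DifferentiableAt ℂ (fun t => (coord x (param y t))⁻¹) 0 := by
  induction x using OnePoint.rec with
  | infty =>
    induction y using OnePoint.rec with
    | infty => exact absurd rfl h
    | coe y =>
      simp only [param_coe, coord_infty_coe, inv_inv]
      fun_prop
  | coe x =>
    induction y using OnePoint.rec with
    | infty =>
      have h1 : DifferentiableAt ℂ (fun t : ℂ => t / (1 - x * t)) 0 := by
        refine differentiableAt_id.div (by fun_prop) (by simp)
      refine h1.congr_of_eventuallyEq (Eventually.of_forall fun t => ?_)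
      by_cases ht : t = 0
      · simp [ht]
      · simp only [param_infty, if_neg ht, coord_coe_coe]
        rw [← inv_div]
        congr 1
        field_simp
    | coe y =>
      have : y - x ≠ 0 := by
        rw [sub_ne_zero]
        rintro rfl
        exact h rfl
      simp only [param_coe, coord_coe_coe]
      refine DifferentiableAt.inv (by fun_prop) (by simpa using this)

/-- An injective holomorphic map from the whole plane to the sphere omits at most one point: in
the coordinate which is infinite at one of its values, it is a Möbius transformation, by Liouville's
theorem. -/
theorem exists_compl_singleton_subset_range {Φ : ℂ → Sphere} (hΦ : ∀ w, HolCurveAt Φ w)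
    (hinj : Function.Injective Φ) {w₀ : ℂ}
    (hd : deriv (fun u => coord (Φ w₀) (Φ u)) w₀ ≠ 0) :
    ∃ z, {z}ᶜ ⊆ Set.range Φ := by
  set x₀ := Φ w₀ with hx₀
  set η : ℂ → ℂ := fun u => coord x₀ (Φ u) with hη
  have hη0 : η w₀ = 0 := by simp [hη, hx₀]
  have hev : ∀ w, ∀ᶠ u in 𝓝 w, param (Φ w) (coord (Φ w) (Φ u)) = Φ u := fun w =>
    (hΦ w).continuousAt.eventually (eventually_param_coord (Φ w))
  have hG : ∀ w ≠ w₀, DifferentiableAt ℂ (fun u => (η u)⁻¹) w := by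
    intro w hw
    have h1 : DifferentiableAt ℂ
        ((fun t => (coord x₀ (param (Φ w) t))⁻¹) ∘ fun u => coord (Φ w) (Φ u)) w := by
      refine DifferentiableAt.comp w ?_ (hΦ w).differentiableAt
      simpa using differentiableAt_inv_coord_param (hinj.ne hw)
    refine h1.congr_of_eventuallyEq ?_
    filter_upwards [hev w] with u hu
    simp [hη, hu]
  have hηan : AnalyticAt ℂ η w₀ := by
    rw [Complex.analyticAt_iff_eventually_differentiableAt]
    have h1 : ∀ᶠ u in 𝓝 w₀, u = w₀ ∨ η u ≠ 0 := by
      filter_upwards [hev w₀] with u hu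
      by_contra! h
      refine h.1 (hinj ?_)
      rw [← hu, show coord (Φ w₀) (Φ u) = 0 from h.2, param_zero]
    filter_upwards [h1] with u hu
    by_cases hu0 : u = w₀
    · rw [hu0]
      exact (hΦ w₀).differentiableAt
    · have := (hG u hu0).inv (inv_ne_zero (hu.resolve_left hu0))
      exact this.congr_of_eventuallyEq (Eventually.of_forall fun v => by simp)
  have hs := hηan.hasStrictDerivAt
  -- a neighbourhood of `Φ w₀` is not met by `Φ` outside a disc
  obtain ⟨ε, hε, hball⟩ : ∃ ε > 0, ∀ t : ℂ, ‖t‖ < ε → ∃ u, ‖u - w₀‖ < 1 ∧ Φ u = param x₀ t := by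
    have h1 : {u | ‖u - w₀‖ < 1 ∧ param x₀ (η u) = Φ u} ∈ 𝓝 w₀ := by
      have : ∀ᶠ u in 𝓝 w₀, ‖u - w₀‖ < 1 := by
        have := Metric.ball_mem_nhds w₀ one_pos
        filter_upwards [this] with u hu
        simpa [dist_eq_norm] using hu
      exact this.and (hev w₀)
    have h2 := image_mem_map (m := η) h1
    rw [(hs.hasStrictFDerivAt_equiv hd).map_nhds_eq_of_equiv, hη0] at h2
    obtain ⟨ε, hε, h⟩ := Metric.mem_nhds_iff.1 h2
    refine ⟨ε, hε, fun t ht => ?_⟩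
    obtain ⟨u, ⟨hu1, hu2⟩, rfl⟩ := h (by simpa using ht : t ∈ Metric.ball 0 ε)
    exact ⟨u, hu1, hu2.symm⟩
  have hGbd : ∀ u, 1 ≤ ‖u - w₀‖ → ‖(η u)⁻¹‖ ≤ ε⁻¹ := by
    intro u hu
    by_cases h0 : η u = 0
    · simp [h0, hε.le]
    · rw [norm_inv]
      refine inv_anti₀ hε ?_
      by_contra! h
      obtain ⟨u', hu', h'⟩ := hball _ h
      rw [show param x₀ (η u) = Φ u from param_coord (mem_range_param_of_coord_ne_zero h0)] at h'
      rw [hinj h'] at hu'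
      linarith
  -- `K(u) = (u - w₀) / η(u)` is entire, and its slope at `w₀` is bounded, hence constant
  set K : ℂ → ℂ := fun u => (dslope η w₀ u)⁻¹ with hK
  have hKne : ∀ u, u ≠ w₀ → K u = (u - w₀) * (η u)⁻¹ := by
    intro u hu
    simp [hK, dslope_of_ne _ hu, slope, hη0, mul_comm]
  have hK0 : K w₀ ≠ 0 := by
    simp only [hK, dslope_same]
    exact inv_ne_zero hd
  have hKd : Differentiable ℂ K := by
    intro w
    by_cases hw : w = w₀
    · subst hw
      refine DifferentiableAt.inv ?_ (by rw [dslope_same]; exact hd)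
      obtain ⟨p, hp⟩ := hηan
      exact hp.has_fpower_series_dslope_fslope.analyticAt.differentiableAt
    · have : DifferentiableAt ℂ (fun u => (u - w₀) * (η u)⁻¹) w :=
        (by fun_prop : DifferentiableAt ℂ (fun u => u - w₀) w).mul (hG w hw)
      refine this.congr_of_eventuallyEq ?_
      filter_upwards [isOpen_ne.mem_nhds hw] with u hu using hKne u hu
  have hdsl : Differentiable ℂ (dslope K w₀) := by
    rw [← differentiableOn_univ, Complex.differentiableOn_dslope univ_mem]
    exact hKd.differentiableOn
  have hbdd : Bornology.IsBounded (Set.range (dslope K w₀)) := by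
    obtain ⟨C, hC⟩ := (isCompact_closedBall w₀ 1).exists_bound_of_continuousOn
      hdsl.continuous.continuousOn
    refine isBounded_iff_forall_norm_le.2 ⟨max C (ε⁻¹ + ‖K w₀‖), ?_⟩
    rintro _ ⟨u, rfl⟩
    rcases le_total ‖u - w₀‖ 1 with h | h
    · exact (hC u (by simpa [dist_eq_norm] using h)).trans (le_max_left _ _)
    · refine le_trans ?_ (le_max_right _ _)
      have hu : u ≠ w₀ := by
        rintro rfl
        simp at h
        linarith
      have hu' : u - w₀ ≠ 0 := sub_ne_zero.2 hu
      have : dslope K w₀ u = (η u)⁻¹ - (u - w₀)⁻¹ * K w₀ := by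
        rw [dslope_of_ne _ hu, slope, hKne u hu]
        simp only [vsub_eq_sub, smul_eq_mul]
        field_simp
      rw [this]
      refine (norm_sub_le _ _).trans (add_le_add (hGbd u h) ?_)
      rw [norm_mul, norm_inv]
      exact mul_le_of_le_one_left (norm_nonneg _) (inv_le_one_of_one_le₀ h)
  obtain ⟨b, hb⟩ := hdsl.exists_const_forall_eq_of_bounded hbdd
  have hGform : ∀ u, u ≠ w₀ → (η u)⁻¹ = b + K w₀ / (u - w₀) := by
    intro u hu
    have h1 := hb u
    have hu' : u - w₀ ≠ 0 := sub_ne_zero.2 hu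
    rw [dslope_of_ne _ hu, slope, hKne u hu] at h1
    simp only [vsub_eq_sub, smul_eq_mul] at h1
    rw [← h1]
    field_simp
    ring
  -- so `1 / η = b + K(w₀) / (u - w₀)` takes every value other than `b`
  have hsurj : ∀ y, y ≠ x₀ → (coord x₀ y)⁻¹ ≠ b → y ∈ Set.range Φ := by
    intro y hy hyb
    have h1 : (coord x₀ y)⁻¹ - b ≠ 0 := sub_ne_zero.2 hyb
    have hu : w₀ + K w₀ / ((coord x₀ y)⁻¹ - b) ≠ w₀ := by
      rw [Ne, add_eq_left]
      exact div_ne_zero hK0 h1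
    refine ⟨_, coord_injOn x₀ (hinj.ne hu) hy (inv_injective ?_)⟩
    rw [show (coord x₀ (Φ _))⁻¹ = _ from hGform _ hu, add_sub_cancel_left, div_div_cancel₀ hK0]
    ring
  by_cases hz : ∃ z, z ≠ x₀ ∧ (coord x₀ z)⁻¹ = b
  · obtain ⟨z, hz, hzb⟩ := hz
    refine ⟨z, fun y hy => ?_⟩
    by_cases hyx : y = x₀
    · exact ⟨w₀, hyx.symm⟩
    · refine hsurj y hyx fun hyb => hy ?_
      exact coord_injOn x₀ hyx hz (inv_injective (hyb.trans hzb.symm))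
  · push Not at hz
    refine ⟨x₀, fun y hy => hsurj y hy (hz y hy)⟩

/-! ### Continuation of a linearising parametrisation -/

/-- The transition maps between the coordinates at `x` and at another point of its chart have
nonzero derivatives. -/
theorem exists_hasDerivAt_coord_param (x : Sphere) (t : ℂ) :
    ∃ d ≠ 0, HasDerivAt (fun s => coord (param x t) (param x s)) d t := by
  induction x using OnePoint.rec with
  | infty =>
    by_cases ht : t = 0
    · subst ht
      refine ⟨1, one_ne_zero, ?_⟩
      simpa using hasDerivAt_id' (0 : ℂ)
    · refine ⟨-(t ^ 2)⁻¹, by simpa using ht, ?_⟩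
      refine ((hasDerivAt_inv ht).sub_const t⁻¹).congr_of_eventuallyEq ?_
      filter_upwards [isOpen_ne.mem_nhds ht] with s hs
      simp [param_infty, ht, show s ≠ 0 from hs]
  | coe x =>
    refine ⟨1, one_ne_zero, ?_⟩
    simpa using (hasDerivAt_id' t).sub_const t

theorem exists_hasDerivAt_coord_param_comp (x : Sphere) {ψ : ℂ → ℂ} {w : ℂ}
    (hψ : DifferentiableAt ℂ ψ w) (hd : deriv ψ w ≠ 0) :
    ∃ d ≠ 0, HasDerivAt (fun u => coord (param x (ψ w)) (param x (ψ u))) d w := by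
  obtain ⟨d, hd0, h⟩ := exists_hasDerivAt_coord_param x (ψ w)
  exact ⟨_, mul_ne_zero hd0 hd, h.comp w hψ.hasDerivAt⟩

theorem holCurveAt_param_comp (x : Sphere) {ψ : ℂ → ℂ} {w : ℂ} (hψ : DifferentiableAt ℂ ψ w)
    (hd : deriv ψ w ≠ 0) : HolCurveAt (param x ∘ ψ) w := by
  obtain ⟨d, -, h⟩ := exists_hasDerivAt_coord_param_comp x hψ hd
  exact ⟨(continuous_param x).continuousAt.comp hψ.continuousAt, h.differentiableAt⟩

theorem isOpen_image_of_deriv_ne_zero {ψ : ℂ → ℂ} {D : Set ℂ} (hD : IsOpen D)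
    (hψ : DifferentiableOn ℂ ψ D) (hd : ∀ w ∈ D, deriv ψ w ≠ 0) : IsOpen (ψ '' D) := by
  rw [isOpen_iff_mem_nhds]
  rintro _ ⟨w, hw, rfl⟩
  have hs := (hψ.analyticAt (hD.mem_nhds hw)).hasStrictDerivAt
  rw [← (hs.hasStrictFDerivAt_equiv (hd w hw)).map_nhds_eq_of_equiv]
  exact image_mem_map (hD.mem_nhds hw)

/-- Lifting a continuous map from a convex open set through a covering of a subset. -/
theorem exists_lift_of_isCoveringMap {X : Type*} [TopologicalSpace X] {h : X → X} {U : Set X}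
    {hm : Set.MapsTo h U U} (hcov : IsCoveringMap (hm.restrict h U U)) {D : Set ℂ}
    (hDo : IsOpen D) (hD : Convex ℝ D) {ψ : ℂ → X} (hψ : ContinuousOn ψ D)
    (hψU : Set.MapsTo ψ D U) {w₀ : ℂ} (hw₀ : w₀ ∈ D) {u₀ : X} (hu₀ : u₀ ∈ U) (h₀ : h u₀ = ψ w₀) :
    ∃ φ : ℂ → X, ContinuousOn φ D ∧ Set.MapsTo φ D U ∧ φ w₀ = u₀ ∧ ∀ w ∈ D, h (φ w) = ψ w := by
  classical
  have : ContractibleSpace D := hD.contractibleSpace ⟨w₀, hw₀⟩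
  have : LocallyPathConnectedSpace D := hDo.locallyPathConnectedSpace
  obtain ⟨F, ⟨hF1, hF2⟩, -⟩ := hcov.existsUnique_continuousMap_lifts
    ⟨hψU.restrict ψ D U, hψ.mapsToRestrict hψU⟩ ⟨w₀, hw₀⟩ ⟨u₀, hu₀⟩ (Subtype.ext h₀)
  refine ⟨fun w => if hw : w ∈ D then (F ⟨w, hw⟩ : X) else u₀, ?_, ?_, ?_, ?_⟩
  · rw [continuousOn_iff_continuous_domRestrict]
    refine (continuous_subtype_val.comp F.continuous).congr fun w => ?_
    simp [Set.domRestrict]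
  · intro w hw
    simp [hw]
  · simp [hw₀, hF1]
  · intro w hw
    simpa [hw] using congrArg Subtype.val (congrFun hF2 ⟨w, hw⟩)

/-- Two lifts through a covering which agree at one point are equal. -/
theorem eqOn_of_isCoveringMap {X : Type*} [TopologicalSpace X] {h : X → X} {U : Set X}
    {hm : Set.MapsTo h U U} (hcov : IsCoveringMap (hm.restrict h U U)) {D : Set ℂ}
    (hD : Convex ℝ D) {φ ψ : ℂ → X} (hφ : ContinuousOn φ D) (hψ : ContinuousOn ψ D)
    (hφU : Set.MapsTo φ D U) (hψU : Set.MapsTo ψ D U) {w₀ : ℂ} (hw₀ : w₀ ∈ D)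
    (h₀ : φ w₀ = ψ w₀) (H : ∀ w ∈ D, h (φ w) = h (ψ w)) : Set.EqOn φ ψ D := by
  have : PreconnectedSpace D := Subtype.preconnectedSpace hD.isPreconnected
  have h1 := hcov.eq_of_comp_eq (hφ.mapsToRestrict hφU) (hψ.mapsToRestrict hψU)
    (by ext w; exact H w w.2) ⟨w₀, hw₀⟩ (Subtype.ext h₀)
  intro w hw
  exact congrArg Subtype.val (congrFun h1 ⟨w, hw⟩)

/-- Let an iterate `h` of a rational map of degree at least two be conjugate, on an open set which
`ψ` parametrises by a convex subset `D` of the plane, to an affine map `T` all of whose orbits enter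
`D`. If the component of the points attracted by `ψ(D)` had no critical point, `ψ` would extend to
an injective map of the whole plane, by lifting; then its image would omit at most one point, and
`h` would be injective. -/
theorem exists_isCriticalPoint_mem_connectedComponentIn {f : RatFunc ℂ} (hf : 1 < degree f)
    {n : ℕ} (hn : 0 < n) (x : Sphere) {μ β : ℂ} (hμ : μ ≠ 0) {D : Set ℂ} (hDo : IsOpen D)
    (hD : Convex ℝ D) (hTD : ∀ w ∈ D, μ * w + β ∈ D)
    (hTabs : ∀ w, ∃ k : ℕ, (fun w => μ * w + β)^[k] w ∈ D) {ψ : ℂ → ℂ}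
    (hψ : DifferentiableOn ℂ ψ D) (hψd : ∀ w ∈ D, deriv ψ w ≠ 0) (hinj : Set.InjOn ψ D)
    (hconj : ∀ w ∈ D, (sphereMap f)^[n] (param x (ψ w)) = param x (ψ (μ * w + β)))
    {w₀ : ℂ} (hw₀ : w₀ ∈ D) :
    ∃ c ∈ connectedComponentIn {y | ∃ k : ℕ, ((sphereMap f)^[n])^[k] y ∈ param x '' (ψ '' D)}
      (param x (ψ w₀)), IsCriticalPoint (sphereMap f)^[n] c := by
  by_contra! hcrit
  set h := (sphereMap f)^[n] with hh
  set T : ℂ → ℂ := fun w => μ * w + β with hT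
  set Ψ : ℂ → Sphere := param x ∘ ψ with hΨ
  have hol : ∀ y, HolAt h y := fun y => .iterate (holAt_sphereMap f) n y
  have hc := continuous_of_holAt hol
  have hTc : Continuous T := by fun_prop
  have hTinj : Function.Injective T := fun a b hab => mul_left_cancel₀ hμ (add_right_cancel hab)
  have hVo : IsOpen (param x '' (ψ '' D)) :=
    (isOpenEmbedding_param x).isOpenMap _ (isOpen_image_of_deriv_ne_zero hDo hψ hψd)
  set V := param x '' (ψ '' D) with hV
  have hΨV : ∀ w ∈ D, Ψ w ∈ V := fun w hw => ⟨_, ⟨w, hw, rfl⟩, rfl⟩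
  have hhV : ∀ y ∈ V, h y ∈ V := by
    rintro _ ⟨_, ⟨w, hw, rfl⟩, rfl⟩
    rw [hconj w hw]
    exact hΨV _ (hTD w hw)
  set B : Set Sphere := {y | ∃ k : ℕ, h^[k] y ∈ V} with hBdef
  have hBo : IsOpen B := by
    have : B = ⋃ k : ℕ, h^[k] ⁻¹' V := by
      ext y
      simp [hBdef]
    rw [this]
    exact isOpen_iUnion fun k => hVo.preimage (hc.iterate k)
  have hB : ∀ y, h y ∈ B ↔ y ∈ B := by
    intro y
    constructor
    · rintro ⟨k, hk⟩
      exact ⟨k + 1, hk⟩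
    · rintro ⟨k, hk⟩
      refine ⟨k, ?_⟩
      rw [← Function.iterate_succ_apply, Function.iterate_succ_apply']
      exact hhV _ hk
  have hVB : V ⊆ B := fun y hy => ⟨0, hy⟩
  have hΨc : ContinuousOn Ψ D := (continuous_param x).comp_continuousOn hψ.continuousOn
  set U := connectedComponentIn B (Ψ w₀) with hU
  have hΨU : Set.MapsTo Ψ D U := by
    have h1 : Ψ '' D ⊆ U := (hD.isPreconnected.image Ψ hΨc).subset_connectedComponentIn
      ⟨w₀, hw₀, rfl⟩ (by rintro _ ⟨w, hw, rfl⟩; exact hVB (hΨV w hw))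
    exact Set.mapsTo_iff_image_subset.2 h1
  obtain ⟨hm, hcov⟩ := exists_isCoveringMap_connectedComponentIn hol hBo hB (y := Ψ w₀)
    (by rw [show h (Ψ w₀) = Ψ (T w₀) from hconj w₀ hw₀]; exact hΨU (hTD w₀ hw₀)) hcrit
  -- the increasing convex domains `T⁻ᵏ(D)`
  set E : ℕ → Set ℂ := fun k => {w | T^[k] w ∈ D} with hE
  have hEo : ∀ k, IsOpen (E k) := fun k => hDo.preimage (hTc.iterate k)
  have hEc : ∀ k, Convex ℝ (E k) := by
    intro k
    induction k with
    | zero => exact hD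
    | succ k ih =>
      intro u hu v hv a b ha hb hab
      have h1 : T (a • u + b • v) = a • T u + b • T v := by
        have h2 : (a : ℂ) + b = 1 := by exact_mod_cast hab
        simp only [hT, Complex.real_smul]
        linear_combination (-β) * h2
      show T^[k] (T (a • u + b • v)) ∈ D
      rw [h1]
      exact ih hu hv ha hb hab
  have hEmono : ∀ k, E k ⊆ E (k + 1) := by
    intro k w hw
    show T^[k + 1] w ∈ D
    rw [Function.iterate_succ_apply']
    exact hTD _ hw
  have hDE : ∀ k, D ⊆ E k := by
    intro k
    induction k with
    | zero => exact fun w hw => hw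
    | succ k ih => exact ih.trans (hEmono k)
  -- continuation of `Ψ` to the next domain, by lifting `Ψ ∘ T`
  let P : ℕ → (ℂ → Sphere) → Prop := fun k φ => (ContinuousOn φ (E k) ∧ Set.MapsTo φ (E k) U) ∧
    (∀ w ∈ E k, h (φ w) = φ (T w)) ∧ Set.EqOn φ Ψ D ∧ Set.InjOn φ (E k) ∧
    ∀ w ∈ E k, HolCurveAt φ w
  have hstep : ∀ k φ, P k φ → ∃ φ', P (k + 1) φ' ∧ Set.EqOn φ' φ (E k) := by
    rintro k φ ⟨⟨h1, h2⟩, h3, h4, h5, h6⟩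
    have hTE : Set.MapsTo T (E (k + 1)) (E k) := fun w hw => hw
    obtain ⟨φ', g1, g2, g3, g4⟩ := exists_lift_of_isCoveringMap hcov (hEo (k + 1)) (hEc (k + 1))
      (ψ := φ ∘ T) (h1.comp hTc.continuousOn hTE) (h2.comp hTE) (hDE _ hw₀) (hΨU hw₀)
      (by
        rw [← h4 hw₀]
        exact h3 w₀ (hDE k hw₀))
    have heq : Set.EqOn φ' φ (E k) := by
      refine eqOn_of_isCoveringMap hcov (hEc k) (g1.mono (hEmono k)) h1
        (g2.mono_left (hEmono k)) h2 (hDE k hw₀) (by rw [g3, h4 hw₀]) fun w hw => ?_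
      rw [g4 w (hEmono k hw), h3 w hw]
      rfl
    refine ⟨φ', ⟨⟨g1, g2⟩, ?_, ?_, ?_, ?_⟩, heq⟩
    · intro w hw
      rw [g4 w hw, heq (hTE hw)]
      rfl
    · exact fun w hw => (heq (hDE k hw)).trans (h4 hw)
    · intro u hu v hv huv
      refine hTinj (h5 (hTE hu) (hTE hv) ?_)
      have := congrArg h huv
      rwa [g4 u hu, g4 v hv] at this
    · intro w hw
      refine HolCurveAt.of_comp (g1.continuousAt ((hEo (k + 1)).mem_nhds hw)) (hol _)
        (hcrit _ (g2 hw)) ?_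
      have : HolCurveAt (φ ∘ T) w := (h6 (T w) (hTE hw)).comp (by fun_prop)
      refine this.congr ?_
      filter_upwards [(hEo (k + 1)).mem_nhds hw] with u hu using g4 u hu
  have hP0 : P 0 Ψ := ⟨⟨hΨc, hΨU⟩, hconj, fun _ _ => rfl,
    (param_injective x).injOn.comp hinj (Set.mapsTo_univ _ _), fun w hw =>
      holCurveAt_param_comp x (hψ.differentiableAt (hDo.mem_nhds hw)) (hψd w hw)⟩
  choose! next hnext1 hnext2 using hstep
  let φ : ℕ → ℂ → Sphere := fun k => Nat.rec Ψ (fun k φ => next k φ) k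
  have hφP : ∀ k, P k (φ k) := by
    intro k
    induction k with
    | zero => exact hP0
    | succ k ih => exact hnext1 k _ ih
  have hφeq : ∀ j k, ∀ w ∈ E k, φ (k + j) w = φ k w := by
    intro j k w hw
    have hEj : ∀ j, w ∈ E (k + j) := by
      intro j
      induction j with
      | zero => exact hw
      | succ j ih => exact hEmono _ ih
    induction j with
    | zero => rfl
    | succ j ih => exact (hnext2 (k + j) _ (hφP (k + j)) (hEj j)).trans ih
  -- the continuations agree on their common domains and glue to a map of the whole plane
  choose N hN using hTabs
  set Φ : ℂ → Sphere := fun w => φ (N w) w with hΦ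
  have hΦeq : ∀ k, ∀ w ∈ E k, Φ w = φ k w := by
    intro k w hw
    show φ (N w) w = φ k w
    rw [← hφeq k (N w) w (hN w), ← hφeq (N w) k w hw, add_comm]
  have hEmono' : ∀ j k, E k ⊆ E (k + j) := by
    intro j k
    induction j with
    | zero => exact Set.Subset.rfl
    | succ j ih => exact ih.trans (hEmono _)
  have hΦev : ∀ w, Φ =ᶠ[𝓝 w] φ (N w) := fun w => by
    filter_upwards [(hEo (N w)).mem_nhds (hN w)] with u hu using hΦeq _ u hu
  have hΦhol : ∀ w, HolCurveAt Φ w := fun w =>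
    ((hφP (N w)).2.2.2.2 w (hN w)).congr (hΦev w)
  have hΦinj : Function.Injective Φ := by
    intro u v huv
    have hu : u ∈ E (N u + N v) := hEmono' (N v) (N u) (hN u)
    have hv : v ∈ E (N u + N v) := by
      rw [add_comm]
      exact hEmono' (N u) (N v) (hN v)
    rw [hΦeq _ u hu, hΦeq _ v hv] at huv
    exact (hφP _).2.2.2.1 hu hv huv
  have hΦconj : ∀ w, h (Φ w) = Φ (T w) := by
    intro w
    have h1 : T w ∈ E (N w) := by
      show T^[N w] (T w) ∈ D
      rw [← Function.iterate_succ_apply]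
      exact hEmono _ (hN w)
    rw [hΦeq _ _ h1]
    exact (hφP (N w)).2.1 w (hN w)
  have hΦD : Φ =ᶠ[𝓝 w₀] Ψ := by
    filter_upwards [hDo.mem_nhds hw₀] with u hu using hΦeq 0 u hu
  obtain ⟨d, hd0, hd⟩ := exists_hasDerivAt_coord_param_comp x
    (hψ.differentiableAt (hDo.mem_nhds hw₀)) (hψd w₀ hw₀)
  obtain ⟨z, hz⟩ := exists_compl_singleton_subset_range hΦhol hΦinj (w₀ := w₀) (by
    have : (fun u => coord (Φ w₀) (Φ u)) =ᶠ[𝓝 w₀] fun u => coord (Ψ w₀) (Ψ u) := by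
      filter_upwards [hΦD] with u hu
      rw [hu, hΦD.self_of_nhds]
    rw [this.deriv_eq]
    rw [show deriv (fun u => coord (Ψ w₀) (Ψ u)) w₀ = d from hd.deriv]
    exact hd0)
  refine not_injOn_compl_singleton hf z ?_
  intro a ha b hb hab
  obtain ⟨u, rfl⟩ := hz ha
  obtain ⟨v, rfl⟩ := hz hb
  obtain ⟨m, rfl⟩ := Nat.exists_eq_succ_of_ne_zero hn.ne'
  have h1 : h (Φ u) = h (Φ v) := congrArg (sphereMap f)^[m] hab
  rw [hΦconj, hΦconj] at h1
  rw [hTinj (hΦinj h1)]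

/-! ### Linearisation at an attracting fixed point -/

/-- The Koenigs coordinate: the limit of `Fⁿ / λⁿ` is tangent to the identity at `0` and conjugates
`F` to multiplication by `λ`. -/
theorem exists_koenigs_coordinate {F : ℂ → ℂ} (hF : AnalyticAt ℂ F 0) (hF0 : F 0 = 0)
    (h0 : 0 < ‖deriv F 0‖) (h1 : ‖deriv F 0‖ < 1) :
    ∃ δ > 0, ∃ α : ℂ → ℂ, DifferentiableOn ℂ α (Metric.ball 0 δ) ∧ α 0 = 0 ∧ deriv α 0 = 1 ∧
      ∀ z ∈ Metric.ball (0 : ℂ) δ, F z ∈ Metric.ball (0 : ℂ) δ ∧ α (F z) = deriv F 0 * α z := by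
  set l := deriv F 0 with hl
  have hl0 : l ≠ 0 := norm_pos_iff.1 h0
  -- a rate with `|λ| < ρ` and `ρ² < |λ|`, so that the quadratic errors `ρ²ⁿ` are small against `λⁿ`
  obtain ⟨ρ, hρ1, hρ2⟩ := exists_between (show ‖l‖ < √‖l‖ from Real.lt_sqrt_of_sq_lt (by nlinarith))
  have hρ0 : 0 < ρ := h0.trans hρ1
  have hρsq : ρ ^ 2 < ‖l‖ := (Real.lt_sqrt hρ0.le).1 hρ2
  have hρ3 : ρ < 1 := by nlinarith
  set q := dslope F 0 with hq
  have hqan : AnalyticAt ℂ q 0 := by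
    obtain ⟨p, hp⟩ := hF
    exact hp.has_fpower_series_dslope_fslope.analyticAt
  have hq0 : q 0 = l := dslope_same F 0
  have hFq : ∀ z, F z = z * q z := by
    intro z
    have := sub_smul_dslope F 0 z
    simp only [sub_zero, hF0, smul_eq_mul] at this
    exact this.symm
  obtain ⟨C, hC, hCq⟩ := hqan.differentiableAt.isBigO_sub.exists_pos
  have hCq := hCq.bound
  have hqρ : ∀ᶠ z in 𝓝 (0 : ℂ), ‖q z‖ < ρ :=
    hqan.continuousAt.norm.eventually_lt continuousAt_const (by rw [hq0]; exact hρ1)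
  obtain ⟨δ, hδ, hball⟩ := Metric.eventually_nhds_iff_ball.1
    (hCq.and (hqρ.and hF.eventually_analyticAt))
  have hmaps : ∀ z ∈ Metric.ball (0 : ℂ) δ, ‖F z‖ ≤ ρ * ‖z‖ := by
    intro z hz
    rw [hFq, norm_mul, mul_comm]
    exact mul_le_mul_of_nonneg_right (hball z hz).2.1.le (norm_nonneg _)
  have hmem : ∀ z ∈ Metric.ball (0 : ℂ) δ, F z ∈ Metric.ball (0 : ℂ) δ := by
    intro z hz
    have h2 := hmaps z hz
    rw [mem_ball_zero_iff] at hz ⊢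
    nlinarith [norm_nonneg z]
  have hiter : ∀ n, ∀ z ∈ Metric.ball (0 : ℂ) δ,
      F^[n] z ∈ Metric.ball (0 : ℂ) δ ∧ ‖F^[n] z‖ ≤ ρ ^ n * ‖z‖ := by
    intro n z hz
    induction n with
    | zero => simpa using hz
    | succ n ih =>
      rw [Function.iterate_succ_apply']
      refine ⟨hmem _ ih.1, (hmaps _ ih.1).trans ?_⟩
      rw [pow_succ' ρ n, mul_assoc]
      exact mul_le_mul_of_nonneg_left ih.2 hρ0.le
  have hFd : DifferentiableOn ℂ F (Metric.ball 0 δ) := fun z hz =>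
    (hball z hz).2.2.differentiableAt.differentiableWithinAt
  have hiterd : ∀ n, DifferentiableOn ℂ F^[n] (Metric.ball 0 δ) := by
    intro n
    induction n with
    | zero => exact differentiableOn_id
    | succ n ih =>
      rw [Function.iterate_succ']
      exact hFd.comp ih fun z hz => (hiter n z hz).1
  -- the successive differences of the sequence `Fⁿ / λⁿ`
  set d : ℕ → ℂ → ℂ := fun n z => F^[n + 1] z / l ^ (n + 1) - F^[n] z / l ^ n with hd
  set t := ρ ^ 2 / ‖l‖ with ht
  have ht0 : 0 ≤ t := by positivity
  have ht1 : t < 1 := (div_lt_one h0).2 hρsq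
  have hdbound : ∀ n, ∀ z ∈ Metric.ball (0 : ℂ) δ, ‖d n z‖ ≤ C / ‖l‖ * t ^ n * ‖z‖ ^ 2 := by
    intro n z hz
    obtain ⟨h2, h3⟩ := hiter n z hz
    have h4 : d n z = F^[n] z * (q (F^[n] z) - q 0) / l ^ (n + 1) := by
      simp only [hd, hq0]
      rw [Function.iterate_succ_apply', hFq (F^[n] z)]
      field_simp
      ring
    have h5 := (hball _ h2).1
    rw [sub_zero] at h5
    rw [h4, norm_div, norm_mul, norm_pow]
    calc ‖F^[n] z‖ * ‖q (F^[n] z) - q 0‖ / ‖l‖ ^ (n + 1)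
        ≤ (ρ ^ n * ‖z‖) * (C * (ρ ^ n * ‖z‖)) / ‖l‖ ^ (n + 1) := by
          gcongr
          exact h5.trans (by gcongr)
      _ = C / ‖l‖ * t ^ n * ‖z‖ ^ 2 := by
          rw [ht, div_pow, pow_succ]
          field_simp
          ring
  have hsum : Summable fun n => C / ‖l‖ * t ^ n * δ ^ 2 :=
    ((summable_geometric_of_lt_one ht0 ht1).mul_left _).mul_right _
  have hdbound' : ∀ n, ∀ z ∈ Metric.ball (0 : ℂ) δ, ‖d n z‖ ≤ C / ‖l‖ * t ^ n * δ ^ 2 := by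
    intro n z hz
    refine (hdbound n z hz).trans ?_
    have : ‖z‖ ≤ δ := (mem_ball_zero_iff.1 hz).le
    gcongr
  set α : ℂ → ℂ := fun z => z + ∑' n, d n z with hα
  have hdsum : ∀ z ∈ Metric.ball (0 : ℂ) δ, Summable fun n => d n z := fun z hz =>
    Summable.of_norm_bounded hsum fun n => hdbound' n z hz
  have hαd : DifferentiableOn ℂ α (Metric.ball 0 δ) := by
    refine differentiableOn_id.add
      (Complex.differentiableOn_tsum_of_summable_norm hsum (fun n => ?_) Metric.isOpen_ball
        fun n z hz => hdbound' n z hz)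
    exact ((hiterd (n + 1)).div_const _).sub ((hiterd n).div_const _)
  have hαlim : ∀ z ∈ Metric.ball (0 : ℂ) δ,
      Tendsto (fun n => F^[n] z / l ^ n) atTop (𝓝 (α z)) := by
    intro z hz
    have h2 := ((hdsum z hz).hasSum.tendsto_sum_nat).const_add z
    refine h2.congr fun n => ?_
    rw [Finset.sum_range_sub (fun n => F^[n] z / l ^ n)]
    simp
  have hαquad : ∀ z ∈ Metric.ball (0 : ℂ) δ, ‖α z - z‖ ≤ C / ‖l‖ * (1 - t)⁻¹ * ‖z‖ ^ 2 := by
    intro z hz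
    have h2 : α z - z = ∑' n, d n z := by simp [hα]
    rw [h2]
    have h3 : HasSum (fun n => C / ‖l‖ * t ^ n * ‖z‖ ^ 2) (C / ‖l‖ * (1 - t)⁻¹ * ‖z‖ ^ 2) :=
      ((hasSum_geometric_of_lt_one ht0 ht1).mul_left _).mul_right _
    exact tsum_of_norm_bounded h3 fun n => hdbound n z hz
  have hα0 : α 0 = 0 := by
    have := hαquad 0 (Metric.mem_ball_self hδ)
    simpa using this
  refine ⟨δ, hδ, α, hαd, hα0, ?_, fun z hz => ⟨hmem z hz, ?_⟩⟩
  · have : HasDerivAt (fun z => α z - z) 0 0 := by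
      rw [hasDerivAt_iff_isLittleO]
      simp only [hα0, sub_zero, smul_zero]
      have hO : (fun z => α z - z) =O[𝓝 0] fun z : ℂ => z ^ 2 := by
        refine Asymptotics.IsBigO.of_bound (C / ‖l‖ * (1 - t)⁻¹) ?_
        filter_upwards [Metric.ball_mem_nhds (0 : ℂ) hδ] with z hz
        simpa using hαquad z hz
      exact hO.trans_isLittleO (Asymptotics.isLittleO_pow_id one_lt_two)
    have h2 : HasDerivAt α (0 + 1) 0 := (this.add (hasDerivAt_id' (0 : ℂ))).congr_of_eventuallyEq
      (Eventually.of_forall fun z => by simp)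
    simpa using h2.deriv
  · have h2 : Tendsto (fun n => l * (F^[n + 1] z / l ^ (n + 1))) atTop (𝓝 (l * α z)) :=
      ((hαlim z hz).comp (tendsto_add_atTop_nat 1)).const_mul l
    refine tendsto_nhds_unique (hαlim (F z) (hmem z hz)) (h2.congr fun n => ?_)
    rw [Function.iterate_succ_apply, pow_succ]
    field_simp

/-- The inverse of the Koenigs coordinate, on a disc. -/
theorem exists_koenigs_parametrisation {F : ℂ → ℂ} (hF : AnalyticAt ℂ F 0) (hF0 : F 0 = 0)
    (h0 : 0 < ‖deriv F 0‖) (h1 : ‖deriv F 0‖ < 1) {N : Set ℂ} (hN : N ∈ 𝓝 0) :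
    ∃ ε > 0, ∃ ψ : ℂ → ℂ, DifferentiableOn ℂ ψ (Metric.ball 0 ε) ∧
      (∀ w ∈ Metric.ball (0 : ℂ) ε, deriv ψ w ≠ 0) ∧ Set.InjOn ψ (Metric.ball 0 ε) ∧ ψ 0 = 0 ∧
      Set.MapsTo ψ (Metric.ball 0 ε) N ∧
      ∀ w ∈ Metric.ball (0 : ℂ) ε, F (ψ w) = ψ (deriv F 0 * w) := by
  obtain ⟨δ, hδ, α, hαd, hα0, hα1, hαF⟩ := exists_koenigs_coordinate hF hF0 h0 h1
  have hballδ := Metric.ball_mem_nhds (0 : ℂ) hδ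
  have hαan : AnalyticAt ℂ α 0 := hαd.analyticAt hballδ
  have hs : HasStrictDerivAt α 1 0 := hα1 ▸ hαan.hasStrictDerivAt
  set e := (hs.hasStrictFDerivAt_equiv one_ne_zero).toOpenPartialHomeomorph with he
  have hecoe : ∀ z, e z = α z := fun z => rfl
  have h0e : (0 : ℂ) ∈ e.source :=
    (hs.hasStrictFDerivAt_equiv one_ne_zero).mem_toOpenPartialHomeomorph_source
  have h0t : (0 : ℂ) ∈ e.target := by
    have := e.map_source h0e
    rwa [hecoe, hα0] at this
  have hψ0 : e.symm 0 = 0 := by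
    have := e.left_inv h0e
    rwa [hecoe, hα0] at this
  have hψc : ContinuousAt e.symm 0 := e.continuousAt_symm h0t
  have hψt : Tendsto e.symm (𝓝 0) (𝓝 0) := by simpa [hψ0] using hψc.tendsto
  have hderiv : ∀ᶠ z in 𝓝 (0 : ℂ), AnalyticAt ℂ α z ∧ deriv α z ≠ 0 :=
    hαan.eventually_analyticAt.and (hαan.deriv.continuousAt.eventually_ne (by rw [hα1]; simp))
  have hFt : Tendsto F (𝓝 0) (𝓝 0) := by simpa [hF0] using hF.continuousAt.tendsto
  have hev : ∀ᶠ w in 𝓝 (0 : ℂ), w ∈ e.target ∧ e.symm w ∈ N ∧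
      (AnalyticAt ℂ α (e.symm w) ∧ deriv α (e.symm w) ≠ 0) ∧
      e.symm w ∈ Metric.ball (0 : ℂ) δ ∧ F (e.symm w) ∈ e.source :=
    Filter.Eventually.and (e.open_target.mem_nhds h0t) <| (hψt.eventually hN).and <|
      (hψt.eventually hderiv).and <| (hψt.eventually hballδ).and <|
      (hFt.comp hψt).eventually (e.open_source.mem_nhds h0e)
  obtain ⟨ε, hε, hball⟩ := Metric.eventually_nhds_iff_ball.1 hev
  have hder : ∀ w ∈ Metric.ball (0 : ℂ) ε, HasDerivAt e.symm (deriv α (e.symm w))⁻¹ w := by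
    intro w hw
    obtain ⟨h2, -, h3, -, -⟩ := hball w hw
    exact e.hasDerivAt_symm h2 h3.2 h3.1.differentiableAt.hasDerivAt
  refine ⟨ε, hε, e.symm, fun w hw => (hder w hw).differentiableAt.differentiableWithinAt,
    fun w hw => ?_, ?_, hψ0, fun w hw => (hball w hw).2.1, fun w hw => ?_⟩
  · rw [(hder w hw).deriv]
    exact inv_ne_zero (hball w hw).2.2.1.2
  · exact e.symm.injOn.mono fun w hw => (hball w hw).1
  · obtain ⟨h2, -, -, h4, h5⟩ := hball w hw
    have h6 := (hαF _ h4).2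
    rw [← hecoe, ← hecoe, e.right_inv h2] at h6
    rw [← h6, e.left_inv h5]

/-! ### Attracting cycles -/

theorem mem_connectedComponentIn_iterate {X : Type*} [TopologicalSpace X] {g : X → X}
    (hg : Continuous g) {B : Set X} (hB : Set.MapsTo g B B) {c y : X}
    (hc : c ∈ connectedComponentIn B y) (i : ℕ) :
    g^[i] c ∈ connectedComponentIn B (g^[i] y) := by
  have hy : y ∈ B := connectedComponentIn_nonempty_iff.1 ⟨c, hc⟩
  refine (isPreconnected_connectedComponentIn.image g^[i]
    (hg.iterate i).continuousOn).subset_connectedComponentIn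
    ⟨y, mem_connectedComponentIn hy, rfl⟩ ?_ ⟨c, hc, rfl⟩
  rintro _ ⟨u, hu, rfl⟩
  exact hB.iterate i (connectedComponentIn_subset B y hu)

theorem convergesTo_iterate_iff {g : Sphere → Sphere} {y : Sphere} {Z : Set Sphere} (i : ℕ) :
    ConvergesTo g (g^[i] y) Z ↔ ConvergesTo g y Z := by
  unfold ConvergesTo
  rw [← tendsto_add_atTop_iff_nat (f := fun n => g^[n] y) i]
  simp only [Function.iterate_add_apply]

/-- An orbit of `g` whose subsequence along the multiples of `m` converges to `x` converges to the
cycle of `x`. -/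
theorem convergesTo_cycle_of_tendsto {g : Sphere → Sphere} (hg : Continuous g) {m : ℕ}
    (hm : 0 < m) {x y : Sphere} (h : Tendsto (fun k => (g^[m])^[k] y) atTop (𝓝 x)) :
    ConvergesTo g y (cycle g x) := by
  intro V hV
  have h1 : ∀ i, ∀ᶠ k in atTop, g^[i] ((g^[m])^[k] y) ∈ V := by
    intro i
    have h2 : V ∈ 𝓝 (g^[i] x) := by
      rw [mem_nhdsSet_iff_forall] at hV
      exact hV _ ⟨i, rfl⟩
    exact (((hg.iterate i).tendsto x).comp h).eventually h2
  have h3 : ∀ᶠ k in atTop, ∀ i ∈ Finset.range m, g^[i] ((g^[m])^[k] y) ∈ V :=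
    (Filter.eventually_all_finset _).2 fun i _ => h1 i
  rw [mem_map]
  filter_upwards [(Nat.tendsto_div_const_atTop hm.ne').eventually h3] with n hn
  have h4 := hn (n % m) (Finset.mem_range.2 (Nat.mod_lt n hm))
  rw [← Function.iterate_mul, ← Function.iterate_add_apply, Nat.mod_add_div] at h4
  exact h4

theorem eventually_apply_param_of_fixed {h : Sphere → Sphere} {x : Sphere} (hh : HolAt h x)
    (hx : h x = x) : ∀ᶠ w in 𝓝 (0 : ℂ), h (param x w) = param x (localExpr h x w) := by
  have := eventually_apply_param hh.continuousAt
  rwa [hx] at this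

/-- An attracting cycle which is not super-attracting has a critical point in its immediate basin:
the inverse of the Koenigs coordinate cannot be continued to the whole plane. -/
theorem exists_isCriticalPoint_mem_cycleImmediateBasin {f : RatFunc ℂ} (hf : 1 < degree f)
    {x : Sphere} {p : ℕ} (hp : 0 < p) (hx : (sphereMap f)^[p] x = x)
    (h0 : 0 < ‖multiplier (sphereMap f) p x‖) (h1 : ‖multiplier (sphereMap f) p x‖ < 1) :
    ∃ c, IsCriticalPoint (sphereMap f) c ∧
      c ∈ cycleImmediateBasin (sphereMap f) (cycle (sphereMap f) x) ∧
      ConvergesTo (sphereMap f) c (cycle (sphereMap f) x) := by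
  set g := sphereMap f with hg
  set h := g^[p] with hh
  have hgc : Continuous g := continuous_sphereMap f
  have hol : HolAt h x := .iterate (holAt_sphereMap f) p x
  set F := localExpr h x with hF
  have hl : multiplier g p x = deriv F 0 := rfl
  rw [hl] at h0 h1
  obtain ⟨ε, hε, ψ, hψ, hψd, hinj, hψ0, hψN, hψF⟩ := exists_koenigs_parametrisation hol.analyticAt
    (localExpr_zero h x) h0 h1 (eventually_apply_param_of_fixed hol hx)
  set l := deriv F 0 with hldef
  have hmem0 : (0 : ℂ) ∈ Metric.ball (0 : ℂ) ε := Metric.mem_ball_self hε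
  have hTit : ∀ (k : ℕ) (w : ℂ), (fun w => l * w + 0)^[k] w = l ^ k * w := by
    intro k w
    induction k with
    | zero => simp
    | succ k ih =>
      rw [Function.iterate_succ_apply', ih, pow_succ]
      ring
  have hTlim : ∀ w : ℂ, Tendsto (fun k : ℕ => l ^ k * w) atTop (𝓝 0) := fun w => by
    simpa using (tendsto_pow_atTop_nhds_zero_of_norm_lt_one h1).mul_const w
  have hTD : ∀ w ∈ Metric.ball (0 : ℂ) ε, l * w + 0 ∈ Metric.ball (0 : ℂ) ε := by
    intro w hw
    rw [mem_ball_zero_iff] at hw ⊢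
    rw [add_zero, norm_mul]
    nlinarith [norm_nonneg w]
  have hconj : ∀ w ∈ Metric.ball (0 : ℂ) ε, h (param x (ψ w)) = param x (ψ (l * w + 0)) := by
    intro w hw
    rw [add_zero, ← hψF w hw]
    exact hψN hw
  obtain ⟨c, hcB, hc⟩ := exists_isCriticalPoint_mem_connectedComponentIn hf hp x
    (norm_pos_iff.1 h0) Metric.isOpen_ball (convex_ball 0 ε) hTD
    (fun w => by
      obtain ⟨k, hk⟩ := ((hTlim w).eventually (Metric.ball_mem_nhds 0 hε)).exists
      exact ⟨k, by rw [hTit]; exact hk⟩) hψ hψd hinj hconj hmem0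
  rw [hψ0, param_zero] at hcB
  have hconv : ∀ y, (∃ k : ℕ, h^[k] y ∈ param x '' (ψ '' Metric.ball 0 ε)) →
      ConvergesTo g y (cycle g x) := by
    rintro y ⟨k, _, ⟨w, hw, rfl⟩, hk⟩
    rw [← convergesTo_iterate_iff (p * k), Function.iterate_mul, ← hh, ← hk]
    refine convergesTo_cycle_of_tendsto hgc hp ?_
    have hit : ∀ j : ℕ, l ^ j * w ∈ Metric.ball (0 : ℂ) ε ∧
        h^[j] (param x (ψ w)) = param x (ψ (l ^ j * w)) := by
      intro j
      induction j with
      | zero => simpa using hw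
      | succ j ih =>
        rw [Function.iterate_succ_apply', ih.2, hconj _ ih.1]
        have := hTD _ ih.1
        rw [show l ^ (j + 1) * w = l * (l ^ j * w) + 0 by ring]
        exact ⟨this, rfl⟩
    have hlim : Tendsto (fun j : ℕ => param x (ψ (l ^ j * w))) atTop (𝓝 (param x (ψ 0))) :=
      (((continuous_param x).tendsto _).comp
        (hψ.continuousOn.continuousAt (Metric.ball_mem_nhds 0 hε)).tendsto).comp (hTlim w)
    rw [hψ0, param_zero] at hlim
    exact hlim.congr fun j => (hit j).2.symm
  have hmaps : Set.MapsTo g (cycleBasin g (cycle g x)) (cycleBasin g (cycle g x)) :=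
    fun y hy => (convergesTo_iterate_iff 1).2 hy
  have hcB' := connectedComponentIn_mono x (show {y | ∃ k : ℕ, h^[k] y ∈
    param x '' (ψ '' Metric.ball 0 ε)} ⊆ cycleBasin g (cycle g x) from hconv) hcB
  obtain ⟨i, hi⟩ := exists_isCriticalPoint_of_iterate (holAt_sphereMap f) hc
  refine ⟨g^[i] c, hi, ⟨g^[i] x, ⟨i, rfl⟩, ?_⟩, ?_⟩
  · exact mem_connectedComponentIn_iterate hgc hmaps hcB' i
  · rw [convergesTo_iterate_iff]
    exact connectedComponentIn_subset _ _ hcB'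

/-! ### Fatou coordinates -/

/-- The errors along an orbit whose real part grows by at least `1 / 2` at each step are
summable. -/
theorem summable_fatou_error {C R s : ℝ} (hR : 1 ≤ R) (hs : 0 < s) :
    Summable fun n : ℕ => C * (R + n / 2) ^ (-(1 + s)) := by
  refine Summable.mul_left _ ?_
  have h1 : Summable fun n : ℕ => 2 ^ (1 + s) * ((n + 1 : ℕ) : ℝ) ^ (-(1 + s)) :=
    ((summable_nat_add_iff 1).2 (Real.summable_nat_rpow.2 (by linarith))).mul_left _
  refine Summable.of_nonneg_of_le (fun n => by positivity) (fun n => ?_) h1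
  have h2 : ((n + 1 : ℕ) : ℝ) / 2 ≤ R + n / 2 := by
    push_cast
    linarith
  calc (R + n / 2) ^ (-(1 + s)) ≤ (((n + 1 : ℕ) : ℝ) / 2) ^ (-(1 + s)) :=
        Real.rpow_le_rpow_of_nonpos (by positivity) h2 (by linarith)
    _ = 2 ^ (1 + s) * ((n + 1 : ℕ) : ℝ) ^ (-(1 + s)) := by
        rw [Real.div_rpow (by positivity) (by norm_num), Real.rpow_neg (by norm_num : (0:ℝ) ≤ 2),
          div_inv_eq_mul, mul_comm]

/-- The Fatou coordinate of a map `F` close to the translation by `1` on a right half-plane: the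
limit `β` of `Fⁿ(w) - Fⁿ(w₀) + w₀` conjugates `F` to this translation, and differs from the identity
by a Lipschitz map of small constant. -/
theorem exists_fatou_coordinate {F : ℂ → ℂ} {R C s : ℝ} (hR : 1 ≤ R) (hC : 0 ≤ C) (hs : 0 < s)
    (hF : ∀ w : ℂ, R < w.re → DifferentiableAt ℂ F w)
    (hε : ∀ w : ℂ, R < w.re → ‖F w - w - 1‖ ≤ 1 / 2)
    (hε' : ∀ w : ℂ, R < w.re → ‖deriv F w - 1‖ ≤ C * w.re ^ (-(1 + s)))
    (hlim : ∀ δ > 0, ∃ R', ∀ w : ℂ, R' < w.re → ‖F w - w - 1‖ ≤ δ) :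
    ∃ R₀ ≥ R, ∃ β : ℂ → ℂ, (∀ w : ℂ, R₀ < w.re → DifferentiableAt ℂ β w) ∧
      β (R₀ + 1 : ℝ) = (R₀ + 1 : ℝ) ∧
      (∀ w w' : ℂ, R₀ < w.re → R₀ < w'.re → ‖β w - w - (β w' - w')‖ ≤ 1 / 8 * ‖w - w'‖) ∧
      ∀ w : ℂ, R₀ < w.re → R₀ < (F w).re ∧ β (F w) = β w + 1 := by
  have hsum := summable_fatou_error (C := C) hR hs
  -- the half-plane is chosen so that the error terms have a small sum
  obtain ⟨N, hN⟩ : ∃ N : ℕ, ∑' n : ℕ, C * (R + (n + N : ℕ) / 2) ^ (-(1 + s)) < 1 / 16 :=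
    ((tendsto_sum_nat_add fun n : ℕ => C * (R + n / 2) ^ (-(1 + s))).eventually
      (gt_mem_nhds (by norm_num))).exists
  set v : ℕ → ℝ := fun n => C * (R + (n + N : ℕ) / 2) ^ (-(1 + s)) with hv
  have hv0 : ∀ n, 0 ≤ v n := fun n => by positivity
  have hvsum : Summable v := (summable_nat_add_iff N).2 hsum
  have hvpart : ∀ n, ∑ i ∈ Finset.range n, v i ≤ 1 / 16 := fun n =>
    (hvsum.sum_le_tsum _ fun i _ => hv0 i).trans hN.le
  set R₀ : ℝ := R + N / 2 with hR₀
  have hRR₀ : R ≤ R₀ := by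
    have : (0 : ℝ) ≤ N := N.cast_nonneg
    linarith
  have hre : ∀ w : ℂ, R < w.re → w.re + 1 / 2 ≤ (F w).re := by
    intro w hw
    have h1 := (Complex.abs_re_le_norm _).trans (hε w hw)
    simp only [Complex.sub_re, Complex.one_re] at h1
    linarith [(abs_le.1 h1).1]
  have hiter : ∀ n : ℕ, ∀ w : ℂ, R₀ < w.re → R₀ + n / 2 < (F^[n] w).re := by
    intro n w hw
    induction n with
    | zero => simpa using hw
    | succ n ih =>
      rw [Function.iterate_succ_apply']
      have hn : (0 : ℝ) ≤ n := n.cast_nonneg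
      have := hre (F^[n] w) (by linarith)
      push_cast
      linarith
  have hiterR : ∀ n : ℕ, ∀ w : ℂ, R₀ < w.re → R < (F^[n] w).re := by
    intro n w hw
    have := hiter n w hw
    have hn : (0 : ℝ) ≤ n := n.cast_nonneg
    linarith
  have hiterd : ∀ n : ℕ, ∀ w : ℂ, R₀ < w.re → DifferentiableAt ℂ F^[n] w := by
    intro n w hw
    induction n with
    | zero => exact differentiableAt_id
    | succ n ih =>
      rw [Function.iterate_succ']
      exact (hF _ (hiterR n w hw)).comp w ih
  have hlip : ∀ n : ℕ, ∀ z z' : ℂ, R₀ + n / 2 < z.re → R₀ + n / 2 < z'.re →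
      ‖F z - F z' - (z - z')‖ ≤ v n * ‖z - z'‖ := by
    intro n z z' hz hz'
    have hn : (0 : ℝ) ≤ n := n.cast_nonneg
    have hNn : (0 : ℝ) ≤ N := N.cast_nonneg
    have h1 := Convex.norm_image_sub_le_of_norm_deriv_le (𝕜 := ℂ) (f := fun w => F w - w)
      (s := {w : ℂ | R₀ + n / 2 < w.re}) (C := v n) (x := z') (y := z) (fun w hw => ?_)
      (fun w hw => ?_) (convex_halfSpace_re_gt _) hz' hz
    · have h2 : F z - F z' - (z - z') = F z - z - (F z' - z') := by ring
      rw [h2]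
      exact h1
    · have hw : R₀ + n / 2 < w.re := hw
      exact (hF w (by linarith)).sub differentiableAt_id
    · have hw : R₀ + n / 2 < w.re := hw
      have h2 : deriv (fun w => F w - w) w = deriv F w - 1 := by
        have := ((hF w (by linarith)).hasDerivAt.sub (hasDerivAt_id' w)).deriv
        exact this
      rw [h2]
      refine (hε' w (by linarith)).trans (mul_le_mul_of_nonneg_left ?_ hC)
      refine Real.rpow_le_rpow_of_nonpos (by positivity) ?_ (by linarith)
      push_cast
      linarith
  have hmain : ∀ (w w' : ℂ), R₀ < w.re → R₀ < w'.re → ∀ n : ℕ,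
      ‖F^[n] w - F^[n] w' - (w - w')‖ ≤ 2 * (∑ i ∈ Finset.range n, v i) * ‖w - w'‖ ∧
      ‖F^[n + 1] w - F^[n + 1] w' - (F^[n] w - F^[n] w')‖ ≤ 2 * v n * ‖w - w'‖ := by
    intro w w' hw hw' n
    have hstep : ∀ n : ℕ,
        ‖F^[n] w - F^[n] w' - (w - w')‖ ≤ 2 * (∑ i ∈ Finset.range n, v i) * ‖w - w'‖ →
        ‖F^[n + 1] w - F^[n + 1] w' - (F^[n] w - F^[n] w')‖ ≤ 2 * v n * ‖w - w'‖ := by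
      intro n hn
      rw [Function.iterate_succ_apply', Function.iterate_succ_apply']
      refine (hlip n _ _ (hiter n w hw) (hiter n w' hw')).trans ?_
      have h1 : ‖F^[n] w - F^[n] w'‖ ≤ 2 * ‖w - w'‖ := by
        have h2 := norm_add_le (F^[n] w - F^[n] w' - (w - w')) (w - w')
        rw [sub_add_cancel] at h2
        have h3 := mul_le_mul_of_nonneg_right (hvpart n) (norm_nonneg (w - w'))
        linarith [norm_nonneg (w - w')]
      have h2 := mul_le_mul_of_nonneg_left h1 (hv0 n)
      linarith
    have hfst : ‖F^[n] w - F^[n] w' - (w - w')‖ ≤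
        2 * (∑ i ∈ Finset.range n, v i) * ‖w - w'‖ := by
      induction n with
      | zero => simp
      | succ n ih =>
        have h1 := hstep n ih
        have h2 := norm_add_le (F^[n + 1] w - F^[n + 1] w' - (F^[n] w - F^[n] w'))
          (F^[n] w - F^[n] w' - (w - w'))
        rw [sub_add_sub_cancel] at h2
        rw [Finset.sum_range_succ]
        linarith
    exact ⟨hfst, hstep n hfst⟩
  set w₀ : ℂ := ((R₀ + 1 : ℝ) : ℂ) with hw₀
  have hw₀re : R₀ < w₀.re := by
    rw [hw₀, Complex.ofReal_re]
    linarith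
  set d : ℕ → ℂ → ℂ := fun n w => F^[n + 1] w - F^[n + 1] w₀ - (F^[n] w - F^[n] w₀) with hd
  have hdsum : ∀ w : ℂ, R₀ < w.re → Summable fun n => d n w := fun w hw =>
    Summable.of_norm_bounded ((hvsum.mul_left 2).mul_right ‖w - w₀‖) fun n =>
      (hmain w w₀ hw hw₀re n).2
  set β : ℂ → ℂ := fun w => w + ∑' n, d n w with hβ
  have hβlim : ∀ w : ℂ, R₀ < w.re →
      Tendsto (fun n => F^[n] w - F^[n] w₀ + w₀) atTop (𝓝 (β w)) := by
    intro w hw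
    refine (((hdsum w hw).hasSum.tendsto_sum_nat).const_add w).congr fun n => ?_
    rw [Finset.sum_range_sub (fun n => F^[n] w - F^[n] w₀)]
    simp only [Function.iterate_zero, id]
    ring
  refine ⟨R₀, hRR₀, β, fun w hw => ?_, ?_, fun w w' hw hw' => ?_, fun w hw => ⟨?_, ?_⟩⟩
  · have hopen : IsOpen ({z : ℂ | R₀ < z.re} ∩ Metric.ball w₀ (‖w - w₀‖ + 1)) :=
      (isOpen_lt continuous_const Complex.continuous_re).inter Metric.isOpen_ball
    have h1 : DifferentiableOn ℂ (fun w => ∑' n, d n w)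
        ({z : ℂ | R₀ < z.re} ∩ Metric.ball w₀ (‖w - w₀‖ + 1)) := by
      refine Complex.differentiableOn_tsum_of_summable_norm
        ((hvsum.mul_left 2).mul_right (‖w - w₀‖ + 1)) (fun n z hz => ?_) hopen fun n z hz => ?_
      · have h2 := hiterd (n + 1) z hz.1
        have h3 := hiterd n z hz.1
        exact ((h2.sub_const _).sub (h3.sub_const _)).differentiableWithinAt
      · refine (hmain z w₀ hz.1 hw₀re n).2.trans ?_
        have h2 : ‖z - w₀‖ < ‖w - w₀‖ + 1 := by simpa [dist_eq_norm] using hz.2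
        have := hv0 n
        gcongr
    refine differentiableAt_id.add (h1.differentiableAt (hopen.mem_nhds ⟨hw, ?_⟩))
    rw [Metric.mem_ball, dist_eq_norm]
    linarith
  · show w₀ + ∑' n, d n w₀ = w₀
    have h0 : ∀ n, d n w₀ = 0 := fun n => by simp only [hd, sub_self]
    simp only [h0, tsum_zero, add_zero]
  · have h1 := ((hβlim w hw).sub_const w).sub ((hβlim w' hw').sub_const w')
    refine le_of_tendsto h1.norm (Eventually.of_forall fun n => ?_)
    have h2 := (hmain w w' hw hw' n).1
    have h3 : F^[n] w - F^[n] w₀ + w₀ - w - (F^[n] w' - F^[n] w₀ + w₀ - w') =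
        F^[n] w - F^[n] w' - (w - w') := by ring
    rw [h3]
    have h4 := mul_le_mul_of_nonneg_right (hvpart n) (norm_nonneg (w - w'))
    linarith
  · linarith [hre w (by linarith)]
  · have hFw : R₀ < (F w).re := by linarith [hre w (by linarith)]
    -- the orbit of the base point advances by `1` in the limit, which gives `β ∘ F = β + 1`
    have h1 : Tendsto (fun n => F^[n + 1] w₀ - F^[n] w₀) atTop (𝓝 1) := by
      rw [Metric.tendsto_atTop]
      intro δ hδ
      obtain ⟨R', hR'⟩ := hlim (δ / 2) (by linarith)
      obtain ⟨n₀, hn₀⟩ := exists_nat_gt (2 * (R' - R₀))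
      refine ⟨n₀, fun n hn => ?_⟩
      have h2 := hiter n w₀ hw₀re
      have h3 : (n₀ : ℝ) ≤ n := by exact_mod_cast hn
      have h4 := hR' (F^[n] w₀) (by linarith)
      rw [dist_eq_norm, Function.iterate_succ_apply']
      linarith
    have h2 := (((hβlim w hw).comp (tendsto_add_atTop_nat 1)).add h1)
    refine tendsto_nhds_unique (hβlim (F w) hFw) (h2.congr fun n => ?_)
    simp only [Function.comp_apply]
    rw [Function.iterate_succ_apply F n w]
    ring

/-- The inverse of the Fatou coordinate, on a sector. -/
theorem exists_fatou_parametrisation {F : ℂ → ℂ} {R C s : ℝ} (hR : 1 ≤ R) (hC : 0 ≤ C)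
    (hs : 0 < s) (hF : ∀ w : ℂ, R < w.re → DifferentiableAt ℂ F w)
    (hε : ∀ w : ℂ, R < w.re → ‖F w - w - 1‖ ≤ 1 / 2)
    (hε' : ∀ w : ℂ, R < w.re → ‖deriv F w - 1‖ ≤ C * w.re ^ (-(1 + s)))
    (hlim : ∀ δ > 0, ∃ R', ∀ w : ℂ, R' < w.re → ‖F w - w - 1‖ ≤ δ) :
    ∃ (R' : ℝ) (ψ : ℂ → ℂ), DifferentiableOn ℂ ψ {w | R' + |w.im| < w.re} ∧
      (∀ w : ℂ, R' + |w.im| < w.re → deriv ψ w ≠ 0) ∧ Set.InjOn ψ {w | R' + |w.im| < w.re} ∧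
      ∀ w : ℂ, R' + |w.im| < w.re → R < (ψ w).re ∧ F (ψ w) = ψ (w + 1) := by
  obtain ⟨R₀, hRR₀, β, hβd, hβ0, hβlip, hβF⟩ := exists_fatou_coordinate hR hC hs hF hε hε' hlim
  set w₀ : ℂ := ((R₀ + 1 : ℝ) : ℂ) with hw₀
  have hw₀re : R₀ < w₀.re := by
    rw [hw₀, Complex.ofReal_re]
    linarith
  have hexp : ∀ w w' : ℂ, R₀ < w.re → R₀ < w'.re → ‖w - w'‖ ≤ 2 * ‖β w - β w'‖ := by
    intro w w' hw hw'
    have h1 := hβlip w w' hw hw'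
    have h2 := norm_sub_le (β w - β w') (β w - w - (β w' - w'))
    have h3 : β w - β w' - (β w - w - (β w' - w')) = w - w' := by ring
    rw [h3] at h2
    linarith [norm_nonneg (w - w')]
  have hβinj : ∀ w w' : ℂ, R₀ < w.re → R₀ < w'.re → β w = β w' → w = w' := by
    intro w w' hw hw' h
    have := hexp w w' hw hw'
    rw [h, sub_self, norm_zero, mul_zero] at this
    exact sub_eq_zero.1 (norm_le_zero_iff.1 this)
  -- solving `β w = y` amounts to finding a fixed point of the contraction `w ↦ w - β w + y`
  have hsurj : ∀ y : ℂ, R₀ + 1 + |y.im| < y.re → ∃ w : ℂ, R₀ < w.re ∧ β w = y := by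
    intro y hy
    set r := (y.re - R₀) / 2 with hr
    have hr0 : 0 < r := by
      have := abs_nonneg y.im
      rw [hr]
      linarith
    have hball : ∀ w ∈ Metric.closedBall y r, R₀ < w.re := by
      intro w hw
      rw [Metric.mem_closedBall, dist_eq_norm] at hw
      have h1 := (Complex.abs_re_le_norm _).trans hw
      rw [Complex.sub_re] at h1
      have h2 := (abs_le.1 h1).1
      have : r < y.re - R₀ := by
        rw [hr]
        linarith
      linarith
    have hyw₀ : ‖y - w₀‖ ≤ 4 * r := by
      have h1 := Complex.norm_le_abs_re_add_abs_im (y - w₀)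
      rw [Complex.sub_re, Complex.sub_im, hw₀, Complex.ofReal_re, Complex.ofReal_im, sub_zero,
        abs_of_nonneg (a := y.re - (R₀ + 1)) (by linarith [abs_nonneg y.im])] at h1
      rw [hr]
      linarith
    have hmaps : Set.MapsTo (fun w => w - β w + y) (Metric.closedBall y r)
        (Metric.closedBall y r) := by
      intro w hw
      have h1 := hβlip w w₀ (hball w hw) hw₀re
      rw [Metric.mem_closedBall, dist_eq_norm] at hw ⊢
      rw [hβ0, sub_self, sub_zero] at h1
      have h2 : w - β w + y - y = -(β w - w) := by ring
      have h3 := norm_add_le (w - y) (y - w₀)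
      rw [sub_add_sub_cancel] at h3
      rw [h2, norm_neg]
      linarith
    have hcontr : ContractingWith (1 / 8) (hmaps.restrict _ _ _) := by
      refine ⟨by rw [← NNReal.coe_lt_coe]; norm_num, LipschitzWith.of_dist_le_mul fun a b => ?_⟩
      have h1 := hβlip a b (hball a a.2) (hball b b.2)
      rw [Subtype.dist_eq, Subtype.dist_eq, dist_eq_norm, dist_eq_norm]
      simp only [Set.MapsTo.val_restrict_apply]
      rw [← norm_neg]
      refine le_trans (le_of_eq ?_) (h1.trans (le_of_eq ?_))
      · congr 1
        ring
      · simp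
    obtain ⟨w, hw, hfix, -⟩ := hcontr.exists_fixedPoint' (Metric.isClosed_closedBall.isComplete)
      hmaps (Metric.mem_closedBall_self hr0.le) (edist_ne_top _ _)
    refine ⟨w, hball w hw, ?_⟩
    have : w - β w + y = w := hfix
    linear_combination -this
  choose! ψ hψre hβψ using hsurj
  set D : Set ℂ := {w | R₀ + 1 + |w.im| < w.re} with hD
  have hDo : IsOpen D := isOpen_lt (by fun_prop) Complex.continuous_re
  have hψc : ContinuousOn ψ D := by
    have h1 : LipschitzOnWith 2 ψ D := LipschitzOnWith.of_dist_le_mul fun a ha b hb => by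
      have := hexp _ _ (hψre a ha) (hψre b hb)
      rw [hβψ a ha, hβψ b hb] at this
      rw [dist_eq_norm, dist_eq_norm]
      exact this
    exact h1.continuousOn
  have hder : ∀ w ∈ D, ∃ b : ℂ, b ≠ 0 ∧ HasDerivAt ψ b⁻¹ w := by
    intro w hw
    have h1 := (hβd _ (hψre w hw)).hasDerivAt
    have hb : deriv β (ψ w) ≠ 0 := by
      intro h0
      have h2 : ‖deriv β (ψ w) - 1‖ ≤ 1 / 8 := by
        refine (h1.sub (hasDerivAt_id' (ψ w))).le_of_lip' (by norm_num) ?_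
        have : ∀ᶠ z in 𝓝 (ψ w), R₀ < z.re :=
          (isOpen_lt continuous_const Complex.continuous_re).mem_nhds (hψre w hw)
        filter_upwards [this] with z hz
        exact hβlip z (ψ w) hz (hψre w hw)
      rw [h0] at h2
      norm_num at h2
    refine ⟨_, hb, HasDerivAt.of_local_left_inverse (hψc.continuousAt (hDo.mem_nhds hw)) h1 hb ?_⟩
    filter_upwards [hDo.mem_nhds hw] with z hz using hβψ z hz
  refine ⟨R₀ + 1, ψ, fun w hw => ?_, fun w hw => ?_, fun a ha b hb hab => ?_, fun w hw => ?_⟩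
  · obtain ⟨b, -, h⟩ := hder w hw
    exact h.differentiableAt.differentiableWithinAt
  · obtain ⟨b, hb, h⟩ := hder w hw
    rw [h.deriv]
    exact inv_ne_zero hb
  · rw [← hβψ a ha, ← hβψ b hb, hab]
  · have hw1 : R₀ + 1 + |(w + 1).im| < (w + 1).re := by
      simp only [Complex.add_im, Complex.one_im, add_zero, Complex.add_re, Complex.one_re]
      linarith
    refine ⟨hRR₀.trans_lt (hψre w hw), hβinj _ _ (hβF _ (hψre w hw)).1 (hψre _ hw1) ?_⟩
    rw [(hβF _ (hψre w hw)).2, hβψ w hw, hβψ _ hw1]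

/-! ### Normal form at a parabolic fixed point -/

/-- If `H(z) = z + a z ^ (k + 1) + ⋯`, then `H(z) = z exp ℓ(z)`, and `W(z) = -1 / (k a z ^ k)`
satisfies `W(H(z)) = W(z) exp (-k ℓ(z)) = W(z) + 1 + E(z)` with `E` holomorphic, `E(0) = 0`. -/
theorem exists_parabolic_normal_form {H : ℂ → ℂ} (hH : AnalyticAt ℂ H 0) {k : ℕ} (hk : 0 < k)
    (hord : analyticOrderAt (fun w => H w - w) 0 = ((k + 1 : ℕ) : ℕ∞)) :
    ∃ a : ℂ, a ≠ 0 ∧ ∃ ℓ E : ℂ → ℂ, AnalyticAt ℂ ℓ 0 ∧ AnalyticAt ℂ E 0 ∧ ℓ 0 = 0 ∧ E 0 = 0 ∧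
      ∀ᶠ z in 𝓝 0, H z = z * Complex.exp (ℓ z) ∧
        Complex.exp (-(k * ℓ z)) = 1 - (1 + E z) * (k * a * z ^ k) := by
  obtain ⟨u, hu, hu0, hHu⟩ := (hH.sub analyticAt_id).analyticOrderAt_eq_natCast.1 hord
  have hk0 : (k : ℂ) ≠ 0 := Nat.cast_ne_zero.2 hk.ne'
  set t : ℂ → ℂ := fun z => z ^ k * u z with ht
  have htan : AnalyticAt ℂ t 0 := (analyticAt_id.pow k).mul hu
  have ht0 : t 0 = 0 := by simp [ht, hk.ne']
  have h1t : (1 : ℂ) + t 0 ∈ Complex.slitPlane := by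
    rw [ht0, add_zero]
    exact Complex.one_mem_slitPlane
  set g : ℂ → ℂ := fun s => ((1 + s) ^ k)⁻¹ with hg
  have hgd : HasDerivAt g (-k) 0 := by
    have h1 : HasDerivAt (fun s : ℂ => (1 + s) ^ k) (k * (1 + 0) ^ (k - 1) * 1) 0 :=
      ((hasDerivAt_id' (0 : ℂ)).const_add 1).pow k
    have h2 : HasDerivAt g _ 0 := h1.inv (by simp)
    exact h2.congr_deriv (by simp)
  have hgan : AnalyticAt ℂ g 0 := by
    refine AnalyticAt.inv ((analyticAt_const.add analyticAt_id).pow k) (by simp)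
  have hDan : AnalyticAt ℂ (dslope g 0) (t 0) := by
    rw [ht0]
    obtain ⟨p, hp⟩ := hgan
    exact hp.has_fpower_series_dslope_fslope.analyticAt
  have hgD : ∀ s, g s = 1 + s * dslope g 0 s := by
    intro s
    have := sub_smul_dslope g 0 s
    simp only [sub_zero, smul_eq_mul] at this
    rw [this]
    simp [hg]
  refine ⟨u 0, hu0, fun z => Complex.log (1 + t z),
    fun z => -(u z * dslope g 0 (t z)) / (k * u 0) - 1,
    (analyticAt_const.add htan).clog h1t, ?_, by simp [ht0], ?_, ?_⟩
  · exact ((hu.mul (AnalyticAt.comp (g := dslope g 0) hDan htan)).neg.div_const).sub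
      analyticAt_const
  · simp only [ht0, dslope_same, hgd.deriv]
    field_simp
    ring
  · have h2 : ∀ᶠ z in 𝓝 (0 : ℂ), 1 + t z ≠ 0 :=
      (continuousAt_const.add htan.continuousAt).eventually_ne (Complex.slitPlane_ne_zero h1t)
    filter_upwards [hHu, h2] with z h3 h4
    constructor
    · rw [Complex.exp_log h4]
      simp only [sub_zero, smul_eq_mul, Pi.sub_apply, id] at h3
      rw [show H z = z + z ^ (k + 1) * u z by rw [← h3]; ring, ht]
      ring
    · have h5 : Complex.exp (-(k * Complex.log (1 + t z))) = g (t z) := by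
        rw [Complex.exp_neg, Complex.exp_nat_mul, Complex.exp_log h4]
      rw [h5, hgD]
      simp only [ht]
      field_simp
      ring

/-- A sequence whose increments tend to `1` grows like `n`, by Cesàro. -/
theorem tendsto_div_nat_of_tendsto_sub {u : ℕ → ℂ}
    (hu : Tendsto (fun n => u (n + 1) - u n) atTop (𝓝 1)) :
    Tendsto (fun n : ℕ => u n / n) atTop (𝓝 1) := by
  have h1 := hu.cesaro_smul
  have h2 : Tendsto (fun n : ℕ => u 0 / n) atTop (𝓝 0) :=
    tendsto_const_div_atTop_nhds_zero_nat (u 0)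
  have h3 := h1.add h2
  rw [add_zero] at h3
  refine h3.congr fun n => ?_
  rw [Finset.sum_range_sub]
  simp only [Complex.real_smul]
  push_cast
  ring

/-- An orbit can only converge to a parabolic fixed point from an attracting direction, a direction
`v` for which `a v ^ k` is a negative real number. -/
theorem mul_pow_eq_neg_norm_of_tendsto {H : ℂ → ℂ} {k : ℕ} (hk : 0 < k) {a : ℂ} (ha : a ≠ 0)
    {ℓ E : ℂ → ℂ} (hE : AnalyticAt ℂ E 0) (hE0 : E 0 = 0)
    (hnf : ∀ᶠ z in 𝓝 0, H z = z * Complex.exp (ℓ z) ∧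
        Complex.exp (-(k * ℓ z)) = 1 - (1 + E z) * (k * a * z ^ k))
    {z : ℕ → ℂ} (hz : Tendsto z atTop (𝓝 0)) (hz0 : ∀ᶠ n in atTop, z n ≠ 0)
    (hzH : ∀ᶠ n in atTop, z (n + 1) = H (z n)) {v : ℂ}
    (hv : Tendsto (fun n => z n / (‖z n‖ : ℂ)) atTop (𝓝 v)) :
    ‖v‖ = 1 ∧ a * v ^ k = -(‖a‖ : ℂ) := by
  have hk0 : (k : ℂ) ≠ 0 := Nat.cast_ne_zero.2 hk.ne'
  have hv1 : ‖v‖ = 1 := by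
    refine tendsto_nhds_unique hv.norm (tendsto_const_nhds.congr' ?_)
    filter_upwards [hz0] with n hn
    have : ‖z n‖ ≠ 0 := norm_ne_zero_iff.2 hn
    simp [this]
  refine ⟨hv1, ?_⟩
  have hv0 : v ≠ 0 := by
    rintro rfl
    simp at hv1
  set W : ℕ → ℂ := fun n => -(k * a * z n ^ k)⁻¹ with hW
  have hWstep : Tendsto (fun n => W (n + 1) - W n) atTop (𝓝 1) := by
    have h1 : Tendsto (fun n => 1 + E (z n)) atTop (𝓝 1) := by
      have := (hE.continuousAt.tendsto.comp hz).const_add 1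
      rwa [hE0, add_zero] at this
    refine h1.congr' ?_
    filter_upwards [hz0, hzH, hz.eventually hnf] with n h2 h3 h4
    simp only [hW]
    rw [h3, h4.1, mul_pow, ← Complex.exp_nat_mul, ← mul_assoc, mul_inv, ← Complex.exp_neg, h4.2]
    have : (k : ℂ) * a * z n ^ k ≠ 0 := mul_ne_zero (mul_ne_zero hk0 ha) (pow_ne_zero _ h2)
    field_simp
    ring
  have hWdiv := tendsto_div_nat_of_tendsto_sub hWstep
  have h1 : Tendsto (fun n => W n / (‖W n‖ : ℂ)) atTop (𝓝 1) := by
    have h2 : Tendsto (fun n : ℕ => W n / n / (‖W n / n‖ : ℂ)) atTop (𝓝 (1 / (‖(1 : ℂ)‖ : ℂ))) :=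
      hWdiv.div ((Complex.continuous_ofReal.tendsto _).comp hWdiv.norm) (by simp)
    simp only [norm_one, Complex.ofReal_one, div_one] at h2
    refine h2.congr' ?_
    filter_upwards [eventually_gt_atTop 0] with n hn
    have hn' : (n : ℂ) ≠ 0 := Nat.cast_ne_zero.2 hn.ne'
    rw [norm_div, Complex.norm_natCast]
    push_cast
    rw [div_div_div_cancel_right₀ hn']
  have h2 : Tendsto (fun n => W n / (‖W n‖ : ℂ)) atTop (𝓝 (-((‖a‖ : ℂ) / (a * v ^ k)))) := by
    have h3 : Tendsto (fun n => -((‖a‖ : ℂ) / (a * (z n / (‖z n‖ : ℂ)) ^ k))) atTop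
        (𝓝 (-((‖a‖ : ℂ) / (a * v ^ k)))) :=
      (tendsto_const_nhds.div ((hv.pow k).const_mul a) (mul_ne_zero ha (pow_ne_zero _ hv0))).neg
    refine h3.congr' ?_
    filter_upwards [hz0] with n hn
    have h4 : (‖z n‖ : ℂ) ≠ 0 := Complex.ofReal_ne_zero.2 (norm_ne_zero_iff.2 hn)
    have h5 : (‖a‖ : ℂ) ≠ 0 := Complex.ofReal_ne_zero.2 (norm_ne_zero_iff.2 ha)
    simp only [hW, norm_neg, norm_inv, norm_mul, norm_pow, Complex.norm_natCast]
    push_cast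
    rw [div_pow]
    field_simp
  have h3 := tendsto_nhds_unique h1 h2
  have h4 : a * v ^ k ≠ 0 := mul_ne_zero ha (pow_ne_zero _ hv0)
  field_simp at h3
  rw [h3]

/-! ### The sectors at a parabolic fixed point -/

/-- The inverse of `z ↦ -1 / (k a z ^ k)` on the sector around the attracting direction `v`,
defined on the slit plane. -/
noncomputable def sectorParam (k : ℕ) (a v w : ℂ) : ℂ :=
  v * ((k * ‖a‖) ^ (-(1 / k : ℝ)) : ℝ) * Complex.exp (-(Complex.log w / k))

section Sector

variable {k : ℕ} {a v : ℂ}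

theorem sectorScale_pos (hk : 0 < k) (ha : a ≠ 0) : 0 < (k * ‖a‖ : ℝ) ^ (-(1 / k : ℝ)) := by
  have : 0 < ‖a‖ := norm_pos_iff.2 ha
  positivity

theorem sectorParam_ne_zero (hk : 0 < k) (ha : a ≠ 0) (hv : ‖v‖ = 1) (w : ℂ) :
    sectorParam k a v w ≠ 0 := by
  refine mul_ne_zero (mul_ne_zero ?_ ?_) (Complex.exp_ne_zero _)
  · rintro rfl
    simp at hv
  · exact Complex.ofReal_ne_zero.2 (sectorScale_pos hk ha).ne'

theorem mul_sectorParam_pow (hk : 0 < k) (ha : a ≠ 0) (hva : a * v ^ k = -(‖a‖ : ℂ)) {w : ℂ}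
    (hw : w ≠ 0) : k * a * sectorParam k a v w ^ k = -w⁻¹ := by
  have hk0 : (k : ℂ) ≠ 0 := Nat.cast_ne_zero.2 hk.ne'
  have ha0 : 0 < ‖a‖ := norm_pos_iff.2 ha
  have h1 : ((k * ‖a‖ : ℝ) ^ (-(1 / k : ℝ))) ^ k = (k * ‖a‖)⁻¹ := by
    rw [← Real.rpow_natCast, ← Real.rpow_mul (by positivity)]
    have : -(1 / k : ℝ) * k = -1 := by
      have : (k : ℝ) ≠ 0 := Nat.cast_ne_zero.2 hk.ne'
      field_simp
    rw [this, Real.rpow_neg_one]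
  have h2 : Complex.exp (-(Complex.log w / k)) ^ k = w⁻¹ := by
    rw [← Complex.exp_nat_mul, mul_neg, mul_div_cancel₀ _ hk0, Complex.exp_neg, Complex.exp_log hw]
  rw [sectorParam, mul_pow, mul_pow, h2, ← Complex.ofReal_pow, h1]
  have ha' : (‖a‖ : ℂ) ≠ 0 := Complex.ofReal_ne_zero.2 ha0.ne'
  push_cast
  calc (k : ℂ) * a * (v ^ k * (k * (‖a‖ : ℂ))⁻¹ * w⁻¹)
      = (a * v ^ k) * (k * (k * (‖a‖ : ℂ))⁻¹) * w⁻¹ := by ring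
    _ = -w⁻¹ := by
      rw [hva]
      field_simp

theorem norm_sectorParam (hk : 0 < k) (ha : a ≠ 0) (hv : ‖v‖ = 1) {w : ℂ} (hw : w ≠ 0) :
    ‖sectorParam k a v w‖ = (k * ‖a‖ : ℝ) ^ (-(1 / k : ℝ)) * ‖w‖ ^ (-(1 / k : ℝ)) := by
  rw [sectorParam, norm_mul, norm_mul, hv, one_mul, Complex.norm_real, Real.norm_eq_abs,
    abs_of_pos (sectorScale_pos hk ha), Complex.norm_exp, Real.rpow_def_of_pos (norm_pos_iff.2 hw)]
  congr 2
  rw [Complex.neg_re, Complex.div_natCast_re, Complex.log_re]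
  ring

theorem hasDerivAt_sectorParam {w : ℂ} (hw : w ∈ Complex.slitPlane) :
    HasDerivAt (sectorParam k a v) (-(sectorParam k a v w / (k * w))) w := by
  have h1 := (((Complex.hasDerivAt_log hw).div_const (k : ℂ)).neg.cexp).const_mul
    (v * ((k * ‖a‖) ^ (-(1 / k : ℝ)) : ℝ))
  refine h1.congr_deriv ?_
  simp only [sectorParam]
  rw [div_mul_eq_div_div, div_eq_mul_inv _ w, div_eq_mul_inv _ (k : ℂ), div_eq_mul_inv _ (k : ℂ)]
  simp only [Pi.neg_apply]
  rw [div_eq_mul_inv _ (k : ℂ)]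
  ring

theorem sectorParam_injOn (hk : 0 < k) (ha : a ≠ 0) (hva : a * v ^ k = -(‖a‖ : ℂ)) :
    Set.InjOn (sectorParam k a v) {0}ᶜ := by
  intro w hw w' hw' h
  have h1 := mul_sectorParam_pow hk ha hva hw
  rw [h, mul_sectorParam_pow hk ha hva hw'] at h1
  exact (inv_injective (neg_injective h1)).symm

theorem tendsto_norm_sectorParam (hk : 0 < k) :
    Tendsto (fun r : ℝ => (k * ‖a‖ : ℝ) ^ (-(1 / k : ℝ)) * r ^ (-(1 / k : ℝ))) atTop (𝓝 0) := by
  have : (0 : ℝ) < 1 / k := by positivity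
  simpa using (tendsto_rpow_neg_atTop this).const_mul ((k * ‖a‖ : ℝ) ^ (-(1 / k : ℝ)))

theorem ne_zero_of_lt_re {R : ℝ} (hR : 0 ≤ R) {w : ℂ} (hw : R < w.re) : w ≠ 0 := by
  rintro rfl
  simp only [Complex.zero_re] at hw
  linarith

/-- The images of the half-planes `R < Re w` shrink to `0`. -/
theorem exists_sectorParam_mem (hk : 0 < k) (ha : a ≠ 0) (hv : ‖v‖ = 1) {N : Set ℂ}
    (hN : N ∈ 𝓝 0) : ∃ R ≥ 1, ∀ w : ℂ, R < w.re → sectorParam k a v w ∈ N := by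
  obtain ⟨δ, hδ, hball⟩ := Metric.mem_nhds_iff.1 hN
  obtain ⟨R, hR⟩ := eventually_atTop.1
    ((tendsto_norm_sectorParam (a := a) hk).eventually (gt_mem_nhds hδ))
  refine ⟨max R 1, le_max_right _ _, fun w hw => hball ?_⟩
  rw [mem_ball_zero_iff, norm_sectorParam hk ha hv
    (ne_zero_of_lt_re (zero_le_one.trans (le_max_right R 1)) hw)]
  exact hR _ ((le_max_left _ _).trans (hw.le.trans (Complex.re_le_norm w)))

theorem norm_sectorParam_le (hk : 0 < k) (ha : a ≠ 0) (hv : ‖v‖ = 1) {w : ℂ} (hw : 0 < w.re) :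
    ‖sectorParam k a v w‖ ≤ (k * ‖a‖ : ℝ) ^ (-(1 / k : ℝ)) * w.re ^ (-(1 / k : ℝ)) := by
  rw [norm_sectorParam hk ha hv (ne_zero_of_lt_re le_rfl hw)]
  refine mul_le_mul_of_nonneg_left ?_ (sectorScale_pos hk ha).le
  refine Real.rpow_le_rpow_of_nonpos hw (Complex.re_le_norm w) ?_
  rw [neg_nonpos]
  positivity

/-- In the coordinate of a sector, a parabolic map is a perturbation of the translation by `1`. -/
theorem exists_sector_dynamics (hk : 0 < k) (ha : a ≠ 0) (hv : ‖v‖ = 1)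
    (hva : a * v ^ k = -(‖a‖ : ℂ)) {H ℓ E : ℂ → ℂ} (hℓ : AnalyticAt ℂ ℓ 0)
    (hE : AnalyticAt ℂ E 0) (hℓ0 : ℓ 0 = 0) (hE0 : E 0 = 0)
    (hnf : ∀ᶠ z in 𝓝 0, H z = z * Complex.exp (ℓ z) ∧
        Complex.exp (-(k * ℓ z)) = 1 - (1 + E z) * (k * a * z ^ k))
    {N : Set ℂ} (hN : N ∈ 𝓝 0) :
    ∃ R ≥ 1, ∃ C ≥ 0, ∃ F : ℂ → ℂ,
      (∀ w : ℂ, R < w.re → sectorParam k a v w ∈ N ∧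
        H (sectorParam k a v w) = sectorParam k a v (F w) ∧ DifferentiableAt ℂ F w ∧
        ‖F w - w - 1‖ ≤ 1 / 2 ∧ ‖deriv F w - 1‖ ≤ C * w.re ^ (-(1 + 1 / k : ℝ))) ∧
      ∀ δ > 0, ∃ R', ∀ w : ℂ, R' < w.re → ‖F w - w - 1‖ ≤ δ := by
  have hk0 : (k : ℂ) ≠ 0 := Nat.cast_ne_zero.2 hk.ne'
  set S := sectorParam k a v with hS
  set F : ℂ → ℂ := fun w => w + 1 + E (S w) with hF
  have hEt : Tendsto E (𝓝 0) (𝓝 0) := by simpa [hE0] using hE.continuousAt.tendsto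
  have hkℓt : Tendsto (fun z => ‖(k : ℂ) * ℓ z‖) (𝓝 0) (𝓝 0) := by
    have := (hℓ.continuousAt.tendsto.const_mul (k : ℂ)).norm
    simpa [hℓ0] using this
  set M := ‖deriv E 0‖ + 1 with hM
  have hE' : ∀ᶠ z in 𝓝 (0 : ℂ), ‖deriv E z‖ < M :=
    hE.deriv.continuousAt.norm.eventually_lt continuousAt_const (by linarith)
  have hEhalf : ∀ᶠ z in 𝓝 (0 : ℂ), ‖E z‖ ≤ 1 / 2 := by
    have := hEt.norm
    rw [norm_zero] at this
    exact this.eventually (ge_mem_nhds (by norm_num))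
  have hkℓ : ∀ᶠ z in 𝓝 (0 : ℂ), ‖(k : ℂ) * ℓ z‖ < 1 := hkℓt.eventually (gt_mem_nhds one_pos)
  obtain ⟨R, hR, hRw⟩ := exists_sectorParam_mem hk ha hv
    (hnf.and <| hE'.and <| hEhalf.and <| hkℓ.and <| hE.eventually_analyticAt.and hN)
  have hFsub : ∀ w, F w - w - 1 = E (S w) := fun w => by
    simp only [hF]
    ring
  set ρ := (k * ‖a‖ : ℝ) ^ (-(1 / k : ℝ)) with hρ
  have hρ0 : 0 < ρ := sectorScale_pos hk ha
  refine ⟨R, hR, M * ρ, by positivity, F, fun w hw => ?_, fun δ hδ => ?_⟩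
  · obtain ⟨⟨h1, h2⟩, h3, h4, h5, h6, h7⟩ := hRw w hw
    have hw0 : 0 < w.re := by linarith
    have hwne : w ≠ 0 := ne_zero_of_lt_re le_rfl hw0
    have hwslit : w ∈ Complex.slitPlane := Or.inl hw0
    have hder : HasDerivAt F (1 + deriv E (S w) * -(S w / (k * w))) w := by
      have h8 := HasDerivAt.comp w h6.differentiableAt.hasDerivAt
        (hasDerivAt_sectorParam (k := k) (a := a) (v := v) hwslit)
      exact ((hasDerivAt_id' w).add_const 1).add h8
    refine ⟨h7, ?_, hder.differentiableAt, by rw [hFsub]; exact h4, ?_⟩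
    · -- `log (F w) = log w - k ℓ (S w)`, because the right-hand side has a small imaginary part
      have hFexp : F w = Complex.exp (Complex.log w - k * ℓ (S w)) := by
        rw [sub_eq_add_neg, Complex.exp_add, Complex.exp_log hwne, h2,
          mul_sectorParam_pow hk ha hva hwne]
        simp only [hF]
        field_simp
        ring
      have him : |(k * ℓ (S w)).im| < 1 := (Complex.abs_im_le_norm _).trans_lt h5
      have harg : |(Complex.log w).im| < Real.pi / 2 := by
        rw [Complex.log_im]
        exact Complex.abs_arg_lt_pi_div_two_iff.2 (Or.inl hw0)
      have hpi := Real.pi_gt_three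
      rw [abs_lt] at him harg
      have hlog : Complex.log (F w) = Complex.log w - k * ℓ (S w) := by
        rw [hFexp, Complex.log_exp]
        · rw [Complex.sub_im]
          linarith
        · rw [Complex.sub_im]
          linarith
      have hdiv : -((Complex.log w - k * ℓ (S w)) / k) = -(Complex.log w / k) + ℓ (S w) := by
        field_simp
        ring
      rw [h1]
      show _ = sectorParam k a v (F w)
      rw [sectorParam.eq_1 k a v (F w), hlog, hdiv, Complex.exp_add, ← mul_assoc]
      rfl
    · rw [hder.deriv, add_sub_cancel_left, norm_mul, norm_neg, norm_div, norm_mul,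
        Complex.norm_natCast]
      have h8 := norm_sectorParam_le hk ha hv hw0
      have hk1 : (1 : ℝ) ≤ k := by exact_mod_cast hk
      have h9 : w.re ≤ k * ‖w‖ := by
        have := Complex.re_le_norm w
        nlinarith [norm_nonneg w]
      calc ‖deriv E (S w)‖ * (‖S w‖ / (k * ‖w‖))
          ≤ M * (ρ * w.re ^ (-(1 / k : ℝ)) / w.re) := by gcongr
        _ = M * ρ * w.re ^ (-(1 + 1 / k : ℝ)) := by
          rw [neg_add, Real.rpow_add hw0, Real.rpow_neg_one]
          ring
  · have : {z : ℂ | ‖E z‖ ≤ δ} ∈ 𝓝 0 := by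
      have := hEt.norm
      rw [norm_zero] at this
      exact this.eventually (ge_mem_nhds hδ)
    obtain ⟨R', -, hR'⟩ := exists_sectorParam_mem hk ha hv this
    exact ⟨R', fun w hw => by rw [hFsub]; exact hR' w hw⟩

theorem tendsto_sectorParam_nhds_zero (hk : 0 < k) (ha : a ≠ 0) (hv : ‖v‖ = 1) {w : ℕ → ℂ}
    (hw : Tendsto (fun n => (w n).re) atTop atTop) :
    Tendsto (fun n => sectorParam k a v (w n)) atTop (𝓝 0) := by
  intro N hN
  obtain ⟨R, -, hR⟩ := exists_sectorParam_mem hk ha hv hN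
  exact (hw.eventually_gt_atTop R).mono fun n hn => hR _ hn

/-- If `w n / n → 1`, then `sectorParam k a v (w n)` tends to `0` from the direction `v`. -/
theorem tendsto_sectorParam_direction (hk : 0 < k) (ha : a ≠ 0) (hv : ‖v‖ = 1) {w : ℕ → ℂ}
    (hw : Tendsto (fun n : ℕ => w n / n) atTop (𝓝 1)) :
    Tendsto (fun n => sectorParam k a v (w n) / (‖sectorParam k a v (w n)‖ : ℂ)) atTop (𝓝 v) := by
  have hk0 : (k : ℂ) ≠ 0 := Nat.cast_ne_zero.2 hk.ne'
  have harg : Tendsto (fun n => (w n).arg) atTop (𝓝 0) := by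
    have h1 := (Complex.continuousAt_arg Complex.one_mem_slitPlane).tendsto.comp hw
    rw [Complex.arg_one] at h1
    refine h1.congr' ?_
    filter_upwards [eventually_gt_atTop 0] with n hn
    have h2 : w n / n = ((n : ℝ)⁻¹ : ℝ) * w n := by
      push_cast
      ring
    rw [Function.comp_apply, h2, Complex.arg_real_mul _ (by positivity)]
  have h1 : Tendsto (fun n => v * Complex.exp (-((w n).arg * Complex.I / k))) atTop (𝓝 v) := by
    have h2 : Continuous fun θ : ℝ => v * Complex.exp (-(θ * Complex.I / k)) := by fun_prop
    have := (h2.tendsto 0).comp harg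
    simpa [Function.comp_def] using this
  refine h1.congr fun n => ?_
  set ρ := (k * ‖a‖ : ℝ) ^ (-(1 / k : ℝ)) with hρ
  have hρ0 : 0 < ρ := sectorScale_pos hk ha
  have hsplit : sectorParam k a v (w n) = (ρ * Real.exp (-(Real.log ‖w n‖ / k)) : ℝ) *
      (v * Complex.exp (-((w n).arg * Complex.I / k))) := by
    have h3 : Complex.log (w n) = (Real.log ‖w n‖ : ℂ) + (w n).arg * Complex.I := rfl
    rw [sectorParam, ← hρ, h3, add_div, neg_add, Complex.exp_add]
    push_cast
    ring
  have hnorm : ‖v * Complex.exp (-((w n).arg * Complex.I / k))‖ = 1 := by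
    rw [norm_mul, hv, one_mul, Complex.norm_exp]
    simp [Complex.div_natCast_re]
  have hpos : 0 < ρ * Real.exp (-(Real.log ‖w n‖ / k)) := by positivity
  rw [hsplit, norm_mul, hnorm, Complex.norm_real, Real.norm_eq_abs, abs_of_pos hpos, mul_one,
    mul_div_cancel_left₀ _ (Complex.ofReal_ne_zero.2 hpos.ne')]

/-- A sequence which tends to `0` from the direction `v` is eventually in every sector around
`v`. -/
theorem eventually_mem_sector (hk : 0 < k) (ha : a ≠ 0) (hv : ‖v‖ = 1) {z : ℕ → ℂ}
    (hz : Tendsto z atTop (𝓝 0)) (hz0 : ∀ᶠ n in atTop, z n ≠ 0)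
    (hzv : Tendsto (fun n => z n / (‖z n‖ : ℂ)) atTop (𝓝 v)) (R : ℝ) :
    ∀ᶠ n in atTop, ∃ w : ℂ, R < w.re ∧ sectorParam k a v w = z n := by
  have hk0 : (k : ℂ) ≠ 0 := Nat.cast_ne_zero.2 hk.ne'
  have hkpos : (0 : ℝ) < k := by exact_mod_cast hk
  have hv0 : v ≠ 0 := by
    rintro rfl
    simp at hv
  set ρ := (k * ‖a‖ : ℝ) ^ (-(1 / k : ℝ)) with hρ
  have hρ0 : 0 < ρ := sectorScale_pos hk ha
  have hρ0' : (ρ : ℂ) ≠ 0 := Complex.ofReal_ne_zero.2 hρ0.ne'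
  set u : ℕ → ℂ := fun n => z n / (v * ρ) with hu
  have hu0 : ∀ᶠ n in atTop, u n ≠ 0 := by
    filter_upwards [hz0] with n hn
    exact div_ne_zero hn (mul_ne_zero hv0 hρ0')
  have hut : Tendsto u atTop (𝓝[≠] 0) := by
    refine tendsto_nhdsWithin_iff.2 ⟨?_, hu0⟩
    simpa using hz.div_const (v * ρ)
  have harg : Tendsto (fun n => (u n).arg) atTop (𝓝 0) := by
    have h1 : Tendsto (fun n => z n / (‖z n‖ : ℂ) / v) atTop (𝓝 1) := by
      have := hzv.div_const v
      rwa [div_self hv0] at this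
    have h2 := (Complex.continuousAt_arg Complex.one_mem_slitPlane).tendsto.comp h1
    rw [Complex.arg_one] at h2
    refine h2.congr' ?_
    filter_upwards [hz0] with n hn
    have h3 : 0 < ‖z n‖ := norm_pos_iff.2 hn
    have h4 : u n = ((‖z n‖ / ρ : ℝ) : ℂ) * (z n / (‖z n‖ : ℂ) / v) := by
      have : (‖z n‖ : ℂ) ≠ 0 := Complex.ofReal_ne_zero.2 h3.ne'
      simp only [hu]
      push_cast
      field_simp
    rw [Function.comp_apply, h4, Complex.arg_real_mul _ (by positivity)]
  have hkarg : ∀ᶠ n in atTop, |(k : ℝ) * (u n).arg| < 1 := by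
    have h1 := (harg.const_mul (k : ℝ)).abs
    rw [mul_zero, abs_zero] at h1
    exact h1.eventually (gt_mem_nhds one_pos)
  have hlog : Tendsto (fun n => Real.exp (-(k * Real.log ‖u n‖)) / 2) atTop atTop := by
    refine Tendsto.atTop_div_const two_pos (Real.tendsto_exp_atTop.comp ?_)
    refine tendsto_neg_atBot_atTop.comp (Tendsto.const_mul_atBot hkpos ?_)
    exact Real.tendsto_log_nhdsGT_zero.comp (tendsto_norm_nhdsNE_zero.comp hut)
  filter_upwards [hkarg, hlog.eventually_gt_atTop R, hu0] with n h1 h2 h3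
  have hlogim : (-(k * Complex.log (u n))).im = -(k * (u n).arg) := by
    rw [Complex.neg_im, ← Complex.ofReal_natCast, Complex.im_ofReal_mul, Complex.log_im]
  have hpi := Real.pi_gt_three
  refine ⟨Complex.exp (-(k * Complex.log (u n))), ?_, ?_⟩
  · rw [Complex.exp_re, hlogim, Complex.neg_re, ← Complex.ofReal_natCast, Complex.re_ofReal_mul,
      Complex.log_re]
    refine h2.trans_le ?_
    have hcos : (1 : ℝ) / 2 ≤ Real.cos (-(k * (u n).arg)) := by
      rw [Real.cos_neg, ← Real.cos_abs, ← Real.cos_pi_div_three]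
      refine Real.cos_le_cos_of_nonneg_of_le_pi (abs_nonneg _) (by linarith) (by linarith)
    have := mul_le_mul_of_nonneg_left hcos (Real.exp_pos (-(k * Real.log ‖u n‖))).le
    linarith
  · rw [abs_lt] at h1
    have : Complex.log (Complex.exp (-(k * Complex.log (u n)))) = -(k * Complex.log (u n)) := by
      rw [Complex.log_exp]
      · rw [hlogim]
        linarith
      · rw [hlogim]
        linarith
    rw [sectorParam, this, neg_div, neg_neg, mul_div_cancel_left₀ _ hk0, Complex.exp_log h3, ← hρ]
    simp only [hu]
    field_simp

end Sector

/-! ### Attracting petals -/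

theorem iterate_fixed_apply {h : Sphere → Sphere} {x : Sphere} (hx : h x = x) (n : ℕ) :
    h^[n] x = x := Function.iterate_fixed hx n

theorem tendsto_coord_orbit {h : Sphere → Sphere} {x y : Sphere}
    (hy : Tendsto (fun n => h^[n] y) atTop (𝓝 x)) :
    Tendsto (fun n => coord x (h^[n] y)) atTop (𝓝 0) :=
  (tendsto_coord x).comp hy

theorem eventually_param_coord_orbit {h : Sphere → Sphere} {x y : Sphere}
    (hy : Tendsto (fun n => h^[n] y) atTop (𝓝 x)) :
    ∀ᶠ n in atTop, param x (coord x (h^[n] y)) = h^[n] y :=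
  hy.eventually (eventually_param_coord x)

theorem eventually_coord_orbit_ne_zero {h : Sphere → Sphere} {x y : Sphere}
    (hy : Tendsto (fun n => h^[n] y) atTop (𝓝 x)) (hne : ∀ n, h^[n] y ≠ x) :
    ∀ᶠ n in atTop, coord x (h^[n] y) ≠ 0 := by
  filter_upwards [eventually_param_coord_orbit hy] with n hn h0
  rw [h0, param_zero] at hn
  exact hne n hn.symm

theorem eventually_coord_orbit_succ {h : Sphere → Sphere} {x y : Sphere} (hx : h x = x)
    (hy : Tendsto (fun n => h^[n] y) atTop (𝓝 x)) :
    ∀ᶠ n in atTop, coord x (h^[n + 1] y) = localExpr h x (coord x (h^[n] y)) := by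
  filter_upwards [eventually_param_coord_orbit hy] with n hn
  rw [localExpr, hn, hx, Function.iterate_succ_apply']

/-- An orbit which converges to a parabolic fixed point does so from an attracting direction. -/
theorem ConvergesFrom.mul_pow_eq {h : Sphere → Sphere} {x : Sphere} (hx : h x = x) {k : ℕ}
    (hk : 0 < k) {a : ℂ} (ha : a ≠ 0) {ℓ E : ℂ → ℂ} (hE : AnalyticAt ℂ E 0) (hE0 : E 0 = 0)
    (hnf : ∀ᶠ z in 𝓝 0, localExpr h x z = z * Complex.exp (ℓ z) ∧
        Complex.exp (-(k * ℓ z)) = 1 - (1 + E z) * (k * a * z ^ k)) {v : ℂ} {y : Sphere}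
    (hy : ConvergesFrom h x v y) : ‖v‖ = 1 ∧ a * v ^ k = -(‖a‖ : ℂ) :=
  mul_pow_eq_neg_norm_of_tendsto hk ha hE hE0 hnf (tendsto_coord_orbit hy.2.1)
    (eventually_coord_orbit_ne_zero hy.2.1 hy.1) (eventually_coord_orbit_succ hx hy.2.1) hy.2.2

/-- Every attracting direction `v` has an attracting petal: a sector around `v`. The inverse of
its Fatou coordinate continues to the whole plane unless there is a critical point in the
component of the petal. -/
theorem exists_isAttractingPetal {f : RatFunc ℂ} (hf : 1 < degree f) {n : ℕ} (hn : 0 < n)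
    {x : Sphere} (hx : (sphereMap f)^[n] x = x) {k : ℕ} (hk : 0 < k) {a : ℂ} (ha : a ≠ 0)
    {ℓ E : ℂ → ℂ} (hℓ : AnalyticAt ℂ ℓ 0) (hE : AnalyticAt ℂ E 0) (hℓ0 : ℓ 0 = 0) (hE0 : E 0 = 0)
    (hnf : ∀ᶠ z in 𝓝 0, localExpr (sphereMap f)^[n] x z = z * Complex.exp (ℓ z) ∧
        Complex.exp (-(k * ℓ z)) = 1 - (1 + E z) * (k * a * z ^ k))
    (hd : deriv (localExpr (sphereMap f)^[n] x) 0 ≠ 0) {v : ℂ} (hv : ‖v‖ = 1)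
    (hva : a * v ^ k = -(‖a‖ : ℂ)) :
    ∃ P, IsAttractingPetal (sphereMap f)^[n] x P ∧
      (∀ y, (∃ j : ℕ, ((sphereMap f)^[n])^[j] y ∈ P) ↔ ConvergesFrom (sphereMap f)^[n] x v y) ∧
      ∃ q ∈ P, ∃ c ∈ connectedComponentIn {y | ∃ j : ℕ, ((sphereMap f)^[n])^[j] y ∈ P} q,
        IsCriticalPoint (sphereMap f)^[n] c := by
  have hk0 : (k : ℂ) ≠ 0 := Nat.cast_ne_zero.2 hk.ne'
  set h := (sphereMap f)^[n] with hh
  have hol : HolAt h x := .iterate (holAt_sphereMap f) n x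
  obtain ⟨N', hN', hinj⟩ := hol.eventually_injOn hd
  obtain ⟨R, hR, C, hC, F, hdyn, hlim⟩ := exists_sector_dynamics hk ha hv hva hℓ hE hℓ0 hE0 hnf
    ((eventually_apply_param_of_fixed hol hx).and ((tendsto_param x).eventually hN'))
  set S := sectorParam k a v with hS
  have hR0 : 0 ≤ R := zero_le_one.trans hR
  have hSne : ∀ w, S w ≠ 0 := sectorParam_ne_zero hk ha hv
  have hSder : ∀ w : ℂ, R < w.re → HasDerivAt S (-(S w / (k * w))) w := fun w hw =>
    hasDerivAt_sectorParam (Or.inl (hR0.trans_lt hw))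
  have hSder0 : ∀ w : ℂ, R < w.re → -(S w / (k * w)) ≠ 0 := fun w hw =>
    neg_ne_zero.2 (div_ne_zero (hSne w) (mul_ne_zero hk0 (ne_zero_of_lt_re hR0 hw)))
  have hFre : ∀ w : ℂ, R < w.re → w.re + 1 / 2 ≤ (F w).re := by
    intro w hw
    have h1 := (Complex.abs_re_le_norm _).trans (hdyn w hw).2.2.2.1
    simp only [Complex.sub_re, Complex.one_re] at h1
    linarith [(abs_le.1 h1).1]
  have hFR : ∀ w : ℂ, R < w.re → R < (F w).re := fun w hw => by linarith [hFre w hw]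
  have hstep : ∀ w : ℂ, R < w.re → h (param x (S w)) = param x (S (F w)) := by
    intro w hw
    rw [← (hdyn w hw).2.1]
    exact (hdyn w hw).1.1
  have hiter : ∀ w : ℂ, R < w.re → ∀ j : ℕ, w.re + j / 2 ≤ (F^[j] w).re ∧
      h^[j] (param x (S w)) = param x (S (F^[j] w)) := by
    intro w hw j
    induction j with
    | zero => simp
    | succ j ih =>
      have hj : (0 : ℝ) ≤ j := j.cast_nonneg
      have h1 : R < (F^[j] w).re := by linarith [ih.1]
      rw [Function.iterate_succ_apply', Function.iterate_succ_apply', ih.2, hstep _ h1]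
      refine ⟨?_, rfl⟩
      have := hFre _ h1
      push_cast
      linarith [ih.1]
  have hFtop : ∀ w : ℂ, R < w.re → Tendsto (fun j => (F^[j] w).re) atTop atTop := by
    intro w hw
    refine tendsto_atTop_mono (fun j => (hiter w hw j).1) ?_
    exact tendsto_atTop_add_const_left _ _
      (tendsto_natCast_atTop_atTop.atTop_div_const two_pos)
  have hFdiv : ∀ w : ℂ, R < w.re → Tendsto (fun j : ℕ => F^[j] w / j) atTop (𝓝 1) := by
    intro w hw
    refine tendsto_div_nat_of_tendsto_sub ?_
    rw [Metric.tendsto_atTop]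
    intro δ hδ
    obtain ⟨R', hR'⟩ := hlim (δ / 2) (by linarith)
    obtain ⟨j₀, hj₀⟩ := eventually_atTop.1 ((hFtop w hw).eventually_gt_atTop R')
    refine ⟨j₀, fun j hj => ?_⟩
    have := hR' _ (hj₀ j hj)
    rw [dist_eq_norm, Function.iterate_succ_apply']
    linarith
  set P : Set Sphere := param x '' (S '' {w : ℂ | R < w.re}) with hP
  have habs : ∀ y, (∃ j : ℕ, h^[j] y ∈ P) ↔ ConvergesFrom h x v y := by
    intro y
    constructor
    · rintro ⟨j, _, ⟨w, hw, rfl⟩, hj⟩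
      have horb : ∀ m, h^[m + j] y = param x (S (F^[m] w)) := by
        intro m
        rw [Function.iterate_add_apply, ← hj]
        exact (hiter w hw m).2
      refine ⟨fun i hi => ?_, ?_, ?_⟩
      · have h1 := horb i
        rw [add_comm, Function.iterate_add_apply, hi, iterate_fixed_apply hx] at h1
        have h2 := congrArg (coord x) h1
        rw [coord_self, coord_param] at h2
        exact hSne _ h2.symm
      · rw [← tendsto_add_atTop_iff_nat j]
        simp only [horb]
        exact (tendsto_param x).comp (tendsto_sectorParam_nhds_zero hk ha hv (hFtop w hw))
      · rw [← tendsto_add_atTop_iff_nat j]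
        simp only [horb, coord_param]
        exact tendsto_sectorParam_direction hk ha hv (hFdiv w hw)
    · intro hy
      have h1 := eventually_mem_sector hk ha hv (tendsto_coord_orbit hy.2.1)
        (eventually_coord_orbit_ne_zero hy.2.1 hy.1) hy.2.2 R
      obtain ⟨j, ⟨w, hw, hwz⟩, hj⟩ := (h1.and (eventually_param_coord_orbit hy.2.1)).exists
      exact ⟨j, coord x (h^[j] y), ⟨w, hw, hwz⟩, hj⟩
  have hconv : Convex ℝ {w : ℂ | R < w.re} := convex_halfSpace_re_gt R
  have hSc : ContinuousOn S {w : ℂ | R < w.re} := fun w hw =>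
    (hSder w hw).continuousAt.continuousWithinAt
  have hSd : DifferentiableOn ℂ S {w : ℂ | R < w.re} := fun w hw =>
    (hSder w hw).differentiableAt.differentiableWithinAt
  have hSopen : IsOpen (S '' {w : ℂ | R < w.re}) :=
    isOpen_image_of_deriv_ne_zero (isOpen_lt continuous_const Complex.continuous_re) hSd
      fun w hw => by rw [(hSder w hw).deriv]; exact hSder0 w hw
  refine ⟨P, ⟨(isOpenEmbedding_param x).isOpenMap _ hSopen, ?_, ⟨N', hN', hinj, ?_⟩, ?_,
    v, hv, habs⟩, habs, ?_⟩
  · refine (IsConnected.image ⟨⟨((R + 1 : ℝ) : ℂ), ?_⟩, hconv.isPreconnected⟩ S hSc).image _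
      (continuous_param x).continuousOn
    simp
  · rintro _ ⟨_, ⟨w, hw, rfl⟩, rfl⟩
    exact (hdyn w hw).1.2
  · rintro _ ⟨_, ⟨w, hw, rfl⟩, rfl⟩
    rw [hstep w hw]
    exact ⟨_, ⟨F w, hFR w hw, rfl⟩, rfl⟩
  obtain ⟨R', ψ, hψd, hψd0, hψinj, hψF⟩ := exists_fatou_parametrisation (s := 1 / k) hR hC
    (by positivity) (fun w hw => (hdyn w hw).2.2.1) (fun w hw => (hdyn w hw).2.2.2.1)
    (fun w hw => (hdyn w hw).2.2.2.2) hlim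
  set D : Set ℂ := {w | R' + |w.im| < w.re} with hD
  have hDo : IsOpen D := isOpen_lt (by fun_prop) Complex.continuous_re
  have hDconv : Convex ℝ D := by
    have h1 : Convex ℝ {w : ℂ | R' < w.re - w.im} :=
      convex_halfSpace_gt ⟨fun u w => by simp; ring, fun c w => by simp; ring⟩ R'
    have h2 : Convex ℝ {w : ℂ | R' < w.re + w.im} :=
      convex_halfSpace_gt ⟨fun u w => by simp; ring, fun c w => by simp; ring⟩ R'
    convert h1.inter h2 using 1
    ext w
    simp only [hD, Set.mem_ofPred_eq, Set.mem_inter_iff]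
    rw [← lt_sub_iff_add_lt', abs_lt]
    constructor
    · rintro ⟨h3, h4⟩
      constructor <;> linarith
    · rintro ⟨h3, h4⟩
      constructor <;> linarith
  have hcomp : ∀ w ∈ D, HasDerivAt (S ∘ ψ) (-(S (ψ w) / (k * ψ w)) * deriv ψ w) w := fun w hw =>
    (hSder _ (hψF w hw).1).comp w (hψd.differentiableAt (hDo.mem_nhds hw)).hasDerivAt
  have hTit : ∀ (j : ℕ) (w : ℂ), (fun w => (1 : ℂ) * w + 1)^[j] w = w + j := by
    intro j w
    induction j with
    | zero => simp
    | succ j ih =>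
      rw [Function.iterate_succ_apply', ih]
      push_cast
      ring
  have hw₀ : ((R' + 1 : ℝ) : ℂ) ∈ D := by
    rw [hD, Set.mem_ofPred_eq, Complex.ofReal_im, Complex.ofReal_re, abs_zero]
    linarith
  obtain ⟨c, hc, hcrit⟩ := exists_isCriticalPoint_mem_connectedComponentIn hf hn x
    (μ := 1) (β := 1) one_ne_zero hDo hDconv
    (fun w hw => by
      have hw : R' + |w.im| < w.re := hw
      simp only [hD, Set.mem_ofPred_eq, one_mul, Complex.add_im, Complex.one_im, add_zero,
        Complex.add_re, Complex.one_re]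
      linarith)
    (fun w => by
      obtain ⟨j, hj⟩ := exists_nat_gt (R' + |w.im| - w.re)
      refine ⟨j, ?_⟩
      rw [hTit]
      simp only [hD, Set.mem_ofPred_eq, Complex.add_im, Complex.natCast_im, add_zero,
        Complex.add_re, Complex.natCast_re]
      linarith)
    (ψ := S ∘ ψ) (fun w hw => (hcomp w hw).differentiableAt.differentiableWithinAt)
    (fun w hw => by
      rw [(hcomp w hw).deriv]
      exact mul_ne_zero (hSder0 _ (hψF w hw).1) (hψd0 w hw))
    (fun u hu w hw huw => hψinj hu hw (sectorParam_injOn hk ha hva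
      (ne_zero_of_lt_re hR0 (hψF u hu).1) (ne_zero_of_lt_re hR0 (hψF w hw).1) huw))
    (fun w hw => by
      rw [one_mul, Function.comp_apply, Function.comp_apply, ← (hψF w hw).2]
      exact hstep _ (hψF w hw).1) hw₀
  refine ⟨param x ((S ∘ ψ) ((R' + 1 : ℝ) : ℂ)), ⟨_, ⟨_, (hψF _ hw₀).1, rfl⟩, rfl⟩, c, ?_, hcrit⟩
  refine connectedComponentIn_mono _ ?_ hc
  rintro y ⟨j, _, ⟨w, hw, rfl⟩, hj⟩
  exact ⟨j, _, ⟨_, (hψF w hw).1, rfl⟩, hj⟩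

/-! ### Immediate basins of petals -/

theorem deriv_localExpr_iterate {G : Sphere → Sphere} {x : Sphere} (hG : HolAt G x)
    (hx : G x = x) (r : ℕ) :
    deriv (localExpr G^[r] x) 0 = deriv (localExpr G x) 0 ^ r ∧ HolAt G^[r] x := by
  induction r with
  | zero => exact ⟨by rw [Function.iterate_zero, localExpr_id]; simp, HolAt.id x⟩
  | succ r ih =>
    have h1 : HolAt G^[r] (G x) := by
      rw [hx]
      exact ih.2
    rw [Function.iterate_succ, deriv_localExpr_comp h1 hG, hx, ih.1, pow_succ]
    exact ⟨rfl, h1.comp hG⟩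

/-- A map which commutes with `h` and has multiplier `μ` at `x`, of modulus one, carries the
direction `v` to the direction `μ v`. -/
theorem ConvergesFrom.map {h G : Sphere → Sphere} {x : Sphere} (hG : HolAt G x) (hGx : G x = x)
    (hx : h x = x) (hcomm : Function.Commute G h) (hμ : ‖deriv (localExpr G x) 0‖ = 1)
    {v : ℂ} {y : Sphere} (hy : ConvergesFrom h x v y) :
    ConvergesFrom h x (deriv (localExpr G x) 0 * v) (G y) := by
  obtain ⟨hne, hlim, hdir⟩ := hy
  set μ := deriv (localExpr G x) 0 with hμdef
  have hμ0 : μ ≠ 0 := norm_ne_zero_iff.1 (by rw [hμ]; exact one_ne_zero)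
  have horb : ∀ n, h^[n] (G y) = G (h^[n] y) := fun n => (hcomm.iterate_right n y).symm
  set z : ℕ → ℂ := fun n => coord x (h^[n] y) with hz
  have hz0 := eventually_coord_orbit_ne_zero hlim hne
  have hzt : Tendsto z atTop (𝓝[≠] 0) :=
    tendsto_nhdsWithin_iff.2 ⟨tendsto_coord_orbit hlim, hz0⟩
  have hcoord : ∀ᶠ n in atTop, coord x (G (h^[n] y)) = localExpr G x (z n) := by
    filter_upwards [eventually_param_coord_orbit hlim] with n hn
    rw [localExpr, hn, hGx]
  have hder : HasDerivAt (localExpr G x) μ 0 := hG.analyticAt.differentiableAt.hasDerivAt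
  have hquot : Tendsto (fun n => localExpr G x (z n) / z n) atTop (𝓝 μ) := by
    have h1 := (hasDerivAt_iff_tendsto_slope_zero.1 hder).comp hzt
    refine h1.congr fun n => ?_
    simp only [Function.comp_apply, zero_add, localExpr_zero, sub_zero, smul_eq_mul]
    rw [div_eq_inv_mul]
  have hne' : ∀ᶠ n in atTop, localExpr G x (z n) ≠ 0 := by
    filter_upwards [hquot.eventually_ne hμ0] with n hn h0
    rw [h0, zero_div] at hn
    exact hn rfl
  refine ⟨fun n hn => ?_, ?_, ?_⟩
  · obtain ⟨m, h1, h2, hm⟩ := (hcoord.and (hne'.and (eventually_ge_atTop n))).exists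
    refine h2 ?_
    obtain ⟨j, rfl⟩ := Nat.exists_eq_add_of_le' hm
    rw [← h1, ← horb, Function.iterate_add_apply, hn, iterate_fixed_apply hx, coord_self]
  · simp only [horb]
    have := hG.continuousAt.tendsto.comp hlim
    rwa [hGx] at this
  · simp only [horb]
    have h1 := (hquot.div ((Complex.continuous_ofReal.tendsto _).comp hquot.norm)
      (by rw [hμ]; simp)).mul hdir
    rw [hμ, Complex.ofReal_one, div_one] at h1
    refine h1.congr' ?_
    filter_upwards [hcoord, hz0, hne'] with n h2 h3 h6
    have h4 : (‖z n‖ : ℂ) ≠ 0 := Complex.ofReal_ne_zero.2 (norm_ne_zero_iff.2 h3)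
    have h5 : z n ≠ 0 := h3
    have h7 : (‖localExpr G x (z n)‖ : ℂ) ≠ 0 := Complex.ofReal_ne_zero.2 (norm_ne_zero_iff.2 h6)
    rw [h2]
    change localExpr G x (z n) / z n / ((‖localExpr G x (z n) / z n‖ : ℝ) : ℂ) *
      (z n / (‖z n‖ : ℂ)) = _
    rw [norm_div, Complex.ofReal_div]
    field_simp

theorem ConvergesFrom.iterate_map {h G : Sphere → Sphere} {x : Sphere} (hG : HolAt G x)
    (hGx : G x = x) (hx : h x = x) (hcomm : Function.Commute G h)
    (hμ : ‖deriv (localExpr G x) 0‖ = 1) {v : ℂ} {y : Sphere} (hy : ConvergesFrom h x v y)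
    (s : ℕ) : ConvergesFrom h x (deriv (localExpr G x) 0 ^ s * v) (G^[s] y) := by
  induction s with
  | zero => simpa using hy
  | succ s ih =>
    rw [Function.iterate_succ_apply', pow_succ', mul_assoc]
    exact ih.map hG hGx hx hcomm hμ

section PetalBasin

variable {g : Sphere → Sphere} {m : ℕ} {Q Q' : Set Sphere}

theorem subset_petalBasin : Q ⊆ petalBasin g Q := fun _ hq => ⟨0, hq⟩

theorem mapsTo_petalBasin (hm : 0 < m) (hQ : Set.MapsTo g^[m] Q Q) :
    Set.MapsTo g (petalBasin g Q) (petalBasin g Q) := by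
  rintro y ⟨n, hn⟩
  obtain ⟨j, rfl⟩ := Nat.exists_eq_succ_of_ne_zero hm.ne'
  refine ⟨n + j, ?_⟩
  rw [← Function.iterate_succ_apply, show (n + j).succ = j.succ + n by omega,
    Function.iterate_add_apply]
  exact hQ hn

theorem mem_petalBasin_of_iterate {y : Sphere} (n : ℕ) (h : g^[n] y ∈ petalBasin g Q) :
    y ∈ petalBasin g Q := by
  obtain ⟨j, hj⟩ := h
  exact ⟨j + n, by rwa [Function.iterate_add_apply]⟩

theorem petalImmediateBasin_subset_petalBasin :
    petalImmediateBasin g Q ⊆ petalBasin g Q := by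
  rintro y ⟨k, q, -, hy⟩
  exact connectedComponentIn_subset _ _ hy

/-- If an orbit starting in the petal `Q` meets the petal `Q'`, then the components along the orbit
of `Q'` occur along the orbit of `Q`. -/
theorem petalImmediateBasin_subset (hg : Continuous g) (hm : 0 < m)
    (hQ' : Set.MapsTo g^[m] Q' Q') (hconn : IsPreconnected Q')
    (hbasin : petalBasin g Q = petalBasin g Q') {q : Sphere} (hq : q ∈ Q) {i : ℕ}
    (hi : g^[i] q ∈ Q') : petalImmediateBasin g Q' ⊆ petalImmediateBasin g Q := by
  rintro y ⟨k, q', hq', hy⟩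
  refine ⟨k + i, q, hq, ?_⟩
  have hsub : g^[k] '' Q' ⊆ petalBasin g Q' := by
    rintro _ ⟨u, hu, rfl⟩
    exact (mapsTo_petalBasin hm hQ').iterate k (subset_petalBasin hu)
  have h1 : g^[k] (g^[i] q) ∈ connectedComponentIn (petalBasin g Q') (g^[k] q') :=
    (hconn.image _ (hg.iterate k).continuousOn).subset_connectedComponentIn ⟨q', hq', rfl⟩ hsub
      ⟨_, hi, rfl⟩
  rw [hbasin, Function.iterate_add_apply, ← connectedComponentIn_eq h1]
  exact hy

end PetalBasin

/-! ### Parabolic cycles -/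

section Parabolic

variable {f : RatFunc ℂ} {x : Sphere} {p r : ℕ} {Q Q' : Set Sphere} {v v' : ℂ}

theorem iterate_mul_fixed {g : Sphere → Sphere} (hx : g^[p] x = x) : g^[p * r] x = x := by
  rw [Function.iterate_mul]
  exact iterate_fixed_apply hx r

/-- The iterate `gᵖ` multiplies the directions at `x` by the multiplier. -/
theorem convergesFrom_iterate (hx : (sphereMap f)^[p] x = x)
    (hμ : ‖multiplier (sphereMap f) p x‖ = 1) {y : Sphere}
    (hy : ConvergesFrom (sphereMap f)^[p * r] x v y) (s : ℕ) :
    ConvergesFrom (sphereMap f)^[p * r] x (multiplier (sphereMap f) p x ^ s * v)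
      ((sphereMap f)^[p * s] y) := by
  rw [Function.iterate_mul (sphereMap f) p s]
  exact ConvergesFrom.iterate_map (HolAt.iterate (holAt_sphereMap f) p x) hx
    (iterate_mul_fixed hx)
    (Function.Commute.iterate_iterate_self (sphereMap f) p (p * r)) hμ hy s

/-- The orbit of a point of a petal `Q` enters each petal whose direction is that of `Q` times a
power of the multiplier. -/
theorem exists_iterate_mem_of_direction (hx : (sphereMap f)^[p] x = x)
    (hμ : ‖multiplier (sphereMap f) p x‖ = 1)
    (hQ : ∀ y, (∃ j : ℕ, ((sphereMap f)^[p * r])^[j] y ∈ Q) ↔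
      ConvergesFrom (sphereMap f)^[p * r] x v y)
    (hQ' : ∀ y, (∃ j : ℕ, ((sphereMap f)^[p * r])^[j] y ∈ Q') ↔
      ConvergesFrom (sphereMap f)^[p * r] x v' y)
    {s : ℕ} (hs : v' = multiplier (sphereMap f) p x ^ s * v) {q : Sphere} (hq : q ∈ Q) :
    ∃ i : ℕ, (sphereMap f)^[i] q ∈ Q' := by
  have h1 := convergesFrom_iterate hx hμ ((hQ q).1 ⟨0, hq⟩) s
  rw [← hs] at h1
  obtain ⟨j, hj⟩ := (hQ' _).2 h1
  refine ⟨p * r * j + p * s, ?_⟩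
  rw [Function.iterate_add_apply, Function.iterate_mul (sphereMap f) (p * r)]
  exact hj

/-- To differ by a power of a root of unity `μ` is a symmetric relation. -/
theorem eq_pow_mul_symm {μ : ℂ} (hr : 0 < r) (hμ : μ ^ r = 1) {s : ℕ} (h : v' = μ ^ s * v) :
    v = μ ^ (s * (r - 1)) * v' := by
  rw [h, ← mul_assoc, ← pow_add]
  have : s * (r - 1) + s = r * s := by
    obtain ⟨j, rfl⟩ := Nat.exists_eq_succ_of_ne_zero hr.ne'
    simp only [Nat.succ_eq_add_one, Nat.add_sub_cancel]
    ring
  rw [this, pow_mul, hμ, one_pow, one_mul]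

/-- Petals whose directions differ by a power of the multiplier have the same immediate basin. -/
theorem petalImmediateBasin_eq_of_direction (hp : 0 < p) (hr : 0 < r)
    (hx : (sphereMap f)^[p] x = x) (hμ : multiplier (sphereMap f) p x ^ r = 1)
    (hPQ : IsAttractingPetal (sphereMap f)^[p * r] x Q)
    (hPQ' : IsAttractingPetal (sphereMap f)^[p * r] x Q')
    (hQ : ∀ y, (∃ j : ℕ, ((sphereMap f)^[p * r])^[j] y ∈ Q) ↔
      ConvergesFrom (sphereMap f)^[p * r] x v y)
    (hQ' : ∀ y, (∃ j : ℕ, ((sphereMap f)^[p * r])^[j] y ∈ Q') ↔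
      ConvergesFrom (sphereMap f)^[p * r] x v' y)
    {s : ℕ} (hs : v' = multiplier (sphereMap f) p x ^ s * v) :
    petalImmediateBasin (sphereMap f) Q = petalImmediateBasin (sphereMap f) Q' := by
  have hμ1 : ‖multiplier (sphereMap f) p x‖ = 1 := Complex.norm_eq_one_of_pow_eq_one hμ hr.ne'
  have hs' := eq_pow_mul_symm hr hμ hs
  have hm : 0 < p * r := Nat.mul_pos hp hr
  have hc := continuous_sphereMap f
  have hbasin : petalBasin (sphereMap f) Q = petalBasin (sphereMap f) Q' := by
    refine Set.Subset.antisymm ?_ ?_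
    · rintro y ⟨n, hn⟩
      exact mem_petalBasin_of_iterate n (exists_iterate_mem_of_direction hx hμ1 hQ hQ' hs hn)
    · rintro y ⟨n, hn⟩
      exact mem_petalBasin_of_iterate n (exists_iterate_mem_of_direction hx hμ1 hQ' hQ hs' hn)
  obtain ⟨q, hq⟩ := hPQ.isConnected.nonempty
  obtain ⟨q', hq'⟩ := hPQ'.isConnected.nonempty
  obtain ⟨i, hi⟩ := exists_iterate_mem_of_direction hx hμ1 hQ hQ' hs hq
  obtain ⟨i', hi'⟩ := exists_iterate_mem_of_direction hx hμ1 hQ' hQ hs' hq'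
  exact Set.Subset.antisymm
    (petalImmediateBasin_subset hc hm hPQ.mapsTo hPQ.isConnected.isPreconnected hbasin.symm hq' hi')
    (petalImmediateBasin_subset hc hm hPQ'.mapsTo hPQ'.isConnected.isPreconnected hbasin hq hi)

/-- If the basins of two petals meet, their directions differ by a power of the multiplier. -/
theorem exists_direction_eq_of_mem_petalBasin (hr : 0 < r)
    (hx : Function.minimalPeriod (sphereMap f) x = p)
    (hμ : multiplier (sphereMap f) p x ^ r = 1)
    (hQ : ∀ y, (∃ j : ℕ, ((sphereMap f)^[p * r])^[j] y ∈ Q) ↔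
      ConvergesFrom (sphereMap f)^[p * r] x v y)
    (hQ' : ∀ y, (∃ j : ℕ, ((sphereMap f)^[p * r])^[j] y ∈ Q') ↔
      ConvergesFrom (sphereMap f)^[p * r] x v' y)
    {y : Sphere} (hy : y ∈ petalBasin (sphereMap f) Q) (hy' : y ∈ petalBasin (sphereMap f) Q') :
    ∃ s : ℕ, v' = multiplier (sphereMap f) p x ^ s * v := by
  have hxp : (sphereMap f)^[p] x = x := by
    rw [← hx]
    exact Function.iterate_minimalPeriod
  have hμ1 : ‖multiplier (sphereMap f) p x‖ = 1 := Complex.norm_eq_one_of_pow_eq_one hμ hr.ne'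
  have hc := continuous_sphereMap f
  -- orbits through `y` and `f ^ d (y)` that both tend to `x` force `f ^ d` to fix `x`, so that
  -- `d` is a multiple of the period
  have key : ∀ (v v' : ℂ) (y : Sphere) (d : ℕ), ConvergesFrom (sphereMap f)^[p * r] x v y →
      ConvergesFrom (sphereMap f)^[p * r] x v' ((sphereMap f)^[d] y) →
      ∃ s : ℕ, v' = multiplier (sphereMap f) p x ^ s * v := by
    intro v v' y d h1 h2
    have h3 : (sphereMap f)^[d] x = x := by
      refine tendsto_nhds_unique (((hc.iterate d).tendsto x).comp h1.2.1) (h2.2.1.congr fun n => ?_)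
      exact ((Function.Commute.iterate_iterate_self (sphereMap f) d (p * r)).iterate_right n y).symm
    obtain ⟨s, rfl⟩ : p ∣ d := by
      rw [← hx]
      exact Function.IsPeriodicPt.minimalPeriod_dvd h3
    exact ⟨s, tendsto_nhds_unique h2.2.2 (convergesFrom_iterate hxp hμ1 h1 s).2.2⟩
  obtain ⟨n, hn⟩ := hy
  obtain ⟨n', hn'⟩ := hy'
  have h1 := (hQ _).1 ⟨0, hn⟩
  have h2 := (hQ' _).1 ⟨0, hn'⟩
  rcases le_total n n' with h | h
  · obtain ⟨d, rfl⟩ := Nat.exists_eq_add_of_le' h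
    rw [Function.iterate_add_apply] at h2
    exact key _ _ _ d h1 h2
  · obtain ⟨d, rfl⟩ := Nat.exists_eq_add_of_le' h
    rw [Function.iterate_add_apply] at h1
    obtain ⟨s, hs⟩ := key _ _ _ d h2 h1
    exact ⟨_, eq_pow_mul_symm hr hμ hs⟩

/-- A critical point of `fᵐ` in the component of a petal gives one of `f` in the immediate
basin. -/
theorem exists_isCriticalPoint_mem_petalImmediateBasin {m : ℕ} (hm : 0 < m)
    (hP : IsAttractingPetal (sphereMap f)^[m] x Q) {q c : Sphere} (hq : q ∈ Q)
    (hc : c ∈ connectedComponentIn {y | ∃ j : ℕ, ((sphereMap f)^[m])^[j] y ∈ Q} q)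
    (hcrit : IsCriticalPoint (sphereMap f)^[m] c) :
    ∃ c, IsCriticalPoint (sphereMap f) c ∧ c ∈ petalImmediateBasin (sphereMap f) Q ∧
      ConvergesTo (sphereMap f) c (cycle (sphereMap f) x) := by
  have hcont := continuous_sphereMap f
  obtain ⟨i, hi⟩ := exists_isCriticalPoint_of_iterate (holAt_sphereMap f) hcrit
  obtain ⟨v, -, hv⟩ := hP.absorbs
  have hcB : c ∈ {y | ∃ j : ℕ, ((sphereMap f)^[m])^[j] y ∈ Q} :=
    connectedComponentIn_subset _ _ hc
  refine ⟨_, hi, ⟨i, q, hq, ?_⟩, ?_⟩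
  · refine mem_connectedComponentIn_iterate hcont (mapsTo_petalBasin hm hP.mapsTo) ?_ i
    refine connectedComponentIn_mono _ ?_ hc
    rintro y ⟨j, hj⟩
    exact ⟨m * j, by rwa [Function.iterate_mul]⟩
  · rw [convergesTo_iterate_iff]
    exact convergesTo_cycle_of_tendsto hcont hm
      ((hv c).1 hcB).2.1

/-- An iterate tangent to the identity at a fixed point is `w + a w ^ (k + 1) + ⋯` there, with
`a ≠ 0` and `k ≥ 1`, as it is not the identity near the point. -/
theorem exists_analyticOrderAt_eq (hf : 1 < degree f) {m : ℕ} (hm : 0 < m)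
    (hx : (sphereMap f)^[m] x = x) (hd : deriv (localExpr (sphereMap f)^[m] x) 0 = 1) :
    ∃ k : ℕ, 0 < k ∧ analyticOrderAt (fun w => localExpr (sphereMap f)^[m] x w - w) 0 =
      ((k + 1 : ℕ) : ℕ∞) := by
  set h := (sphereMap f)^[m] with hh
  have hol : HolAt h x := .iterate (holAt_sphereMap f) m x
  set φ : ℂ → ℂ := fun w => localExpr h x w - w with hφ
  have han : AnalyticAt ℂ φ 0 := hol.analyticAt.sub analyticAt_id
  have htop : analyticOrderAt φ 0 ≠ ⊤ := by
    rw [Ne, analyticOrderAt_eq_top]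
    intro h0
    refine not_eventually_iterate_eq hf hm x ?_
    rw [← map_param_nhds_zero, eventually_map]
    filter_upwards [h0, eventually_apply_param_of_fixed hol hx] with w h1 h2
    rw [← hh, h2, sub_eq_zero.1 h1]
  obtain ⟨j, hj⟩ := ENat.ne_top_iff_exists.1 htop
  have hj0 : j ≠ 0 := by
    rintro rfl
    have := han.analyticOrderAt_eq_zero.1 hj.symm
    simp [hφ] at this
  have hj1 : j ≠ 1 := by
    rintro rfl
    obtain ⟨u, hu, hu0, hφu⟩ := han.analyticOrderAt_eq_natCast.1 hj.symm
    have h1 : HasDerivAt φ (1 - 1) 0 := by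
      have := hol.analyticAt.differentiableAt.hasDerivAt
      rw [hd] at this
      exact this.sub (hasDerivAt_id' 0)
    have h2 : HasDerivAt (fun w : ℂ => w * u w) (1 * u 0 + 0 * deriv u 0) 0 :=
      (hasDerivAt_id' (0 : ℂ)).mul hu.differentiableAt.hasDerivAt
    have h3 : φ =ᶠ[𝓝 0] fun w => w * u w := by
      filter_upwards [hφu] with w hw
      simpa using hw
    have h4 := (h2.congr_of_eventuallyEq h3).unique h1
    apply hu0
    simpa using h4
  refine ⟨j - 1, by omega, ?_⟩
  rw [← hj, Nat.sub_add_cancel (by omega)]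

/-- The Leau-Fatou flower theorem, with a critical point in each immediate basin. -/
theorem parabolic_cycle (hf : 1 < degree f) (hp : 0 < p)
    (hx : Function.minimalPeriod (sphereMap f) x = p) (hr : 0 < r)
    (hprim : IsPrimitiveRoot (multiplier (sphereMap f) p x) r) :
    (∀ Q, IsAttractingPetal (sphereMap f)^[p * r] x Q →
      ∃ c, IsCriticalPoint (sphereMap f) c ∧ c ∈ petalImmediateBasin (sphereMap f) Q ∧
        ConvergesTo (sphereMap f) c (cycle (sphereMap f) x)) ∧
    ∃ e : ℕ, 0 < e ∧
      analyticOrderAt (fun w : ℂ => localExpr (sphereMap f)^[p * r] x w - w) 0 =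
        ((r * e + 1 : ℕ) : ℕ∞) ∧
      ∃ (P : Fin e → Set Sphere) (c : Fin e → Sphere),
        (∀ i, IsAttractingPetal (sphereMap f)^[p * r] x (P i)) ∧
        (∀ i j, i ≠ j → Disjoint (petalImmediateBasin (sphereMap f) (P i))
          (petalImmediateBasin (sphereMap f) (P j))) ∧
        (∀ Q, IsAttractingPetal (sphereMap f)^[p * r] x Q →
          ∃ i, petalImmediateBasin (sphereMap f) Q = petalImmediateBasin (sphereMap f) (P i)) ∧
        Function.Injective c ∧
        ∀ i, IsCriticalPoint (sphereMap f) (c i) ∧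
          c i ∈ petalImmediateBasin (sphereMap f) (P i) ∧
          ConvergesTo (sphereMap f) (c i) (cycle (sphereMap f) x) := by
  have hxp : (sphereMap f)^[p] x = x := by
    rw [← hx]
    exact Function.iterate_minimalPeriod
  have hm : 0 < p * r := Nat.mul_pos hp hr
  have hxm : (sphereMap f)^[p * r] x = x := iterate_mul_fixed hxp
  set μ := multiplier (sphereMap f) p x with hμdef
  have hμr : μ ^ r = 1 := hprim.pow_eq_one
  have hμ1 : ‖μ‖ = 1 := Complex.norm_eq_one_of_pow_eq_one hμr hr.ne'
  have hd : deriv (localExpr (sphereMap f)^[p * r] x) 0 = 1 := by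
    rw [Function.iterate_mul, (deriv_localExpr_iterate
      (HolAt.iterate (holAt_sphereMap f) p x) hxp r).1]
    exact hμr
  obtain ⟨k, hk, hord⟩ := exists_analyticOrderAt_eq hf hm hxm hd
  obtain ⟨a, ha, ℓ, E, hℓ, hE, hℓ0, hE0, hnf⟩ := exists_parabolic_normal_form
    (HolAt.iterate (holAt_sphereMap f) (p * r) x).analyticAt hk hord
  have hdir : ∀ {v : ℂ} {y : Sphere}, ConvergesFrom (sphereMap f)^[p * r] x v y →
      ‖v‖ = 1 ∧ a * v ^ k = -(‖a‖ : ℂ) := fun hy => hy.mul_pow_eq hxm hk ha hE hE0 hnf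
  have hpetal : ∀ {v : ℂ}, ‖v‖ = 1 → a * v ^ k = -(‖a‖ : ℂ) → _ := fun hv hva =>
    exists_isAttractingPetal hf hm hxm hk ha hℓ hE hℓ0 hE0 hnf (by rw [hd]; exact one_ne_zero)
      hv hva
  have hcritical : ∀ Q, IsAttractingPetal (sphereMap f)^[p * r] x Q →
      ∃ c, IsCriticalPoint (sphereMap f) c ∧ c ∈ petalImmediateBasin (sphereMap f) Q ∧
        ConvergesTo (sphereMap f) c (cycle (sphereMap f) x) := by
    intro Q hQ
    obtain ⟨v, hv, hvQ⟩ := hQ.absorbs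
    obtain ⟨q, hq⟩ := hQ.isConnected.nonempty
    obtain ⟨P, hP, hPabs, q', hq', c, hc, hcrit⟩ := hpetal hv (hdir ((hvQ q).1 ⟨0, hq⟩)).2
    have := petalImmediateBasin_eq_of_direction hp hr hxp hμr hQ hP hvQ hPabs (s := 0) (by simp)
    rw [this]
    exact exists_isCriticalPoint_mem_petalImmediateBasin hm hP hq' hc hcrit
  refine ⟨hcritical, ?_⟩
  -- the attracting directions are `v₀ ζ ^ j`, for a primitive root of unity `ζ` of order `k`
  have ha' : (‖a‖ : ℂ) ≠ 0 := Complex.ofReal_ne_zero.2 (norm_ne_zero_iff.2 ha)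
  obtain ⟨v₀, hv₀k⟩ := IsAlgClosed.exists_pow_nat_eq (-(‖a‖ : ℂ) / a) hk
  have hv₀a : a * v₀ ^ k = -(‖a‖ : ℂ) := by
    rw [hv₀k]
    field_simp
  have hv₀ : ‖v₀‖ = 1 := by
    have h1 : ‖v₀‖ ^ k = 1 := by
      rw [← norm_pow, hv₀k, norm_div, norm_neg, Complex.norm_real, norm_norm,
        div_self (norm_ne_zero_iff.2 ha)]
    exact (pow_eq_one_iff_of_nonneg (norm_nonneg _) hk.ne').1 h1
  have hv₀0 : v₀ ≠ 0 := norm_ne_zero_iff.1 (by rw [hv₀]; exact one_ne_zero)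
  -- the multiplier permutes the attracting directions, so that `r` divides their number
  obtain ⟨e, rfl⟩ : r ∣ k := by
    obtain ⟨P, hP, hPabs, q, hq, -⟩ := hpetal hv₀ hv₀a
    have h1 := convergesFrom_iterate hxp hμ1 ((hPabs q).1 ⟨0, hq⟩) 1
    have h2 := (hdir h1).2
    rw [pow_one, mul_pow, mul_left_comm, hv₀a] at h2
    refine hprim.dvd_of_pow_eq_one k ?_
    exact mul_right_cancel₀ (neg_ne_zero.2 ha') (h2.trans (one_mul _).symm)
  have he : 0 < e := Nat.pos_of_ne_zero (by rintro rfl; simp at hk)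
  have hζ := Complex.isPrimitiveRoot_exp (r * e) hk.ne'
  set ζ := Complex.exp (2 * Real.pi * Complex.I / ((r * e : ℕ) : ℂ)) with hζdef
  have hζ1 : ‖ζ‖ = 1 := Complex.norm_eq_one_of_pow_eq_one hζ.pow_eq_one hk.ne'
  have hvj : ∀ j : ℕ, ‖v₀ * ζ ^ j‖ = 1 ∧ a * (v₀ * ζ ^ j) ^ (r * e) = -(‖a‖ : ℂ) := by
    intro j
    refine ⟨by rw [norm_mul, norm_pow, hv₀, hζ1, one_pow, one_mul], ?_⟩
    rw [mul_pow, ← mul_assoc, hv₀a, ← pow_mul, mul_comm j, pow_mul, hζ.pow_eq_one, one_pow, mul_one]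
  choose P hP hPabs q hq c₀ hc₀ hcrit using fun j : ℕ => hpetal (hvj j).1 (hvj j).2
  choose c hc using fun j : ℕ => hcritical (P j) (hP j)
  have hdisj : ∀ i j : Fin e, i ≠ j → Disjoint (petalImmediateBasin (sphereMap f) (P i))
      (petalImmediateBasin (sphereMap f) (P j)) := by
    intro i j hij
    rw [Set.disjoint_left]
    intro y hyi hyj
    obtain ⟨s, hs⟩ := exists_direction_eq_of_mem_petalBasin hr hx hμr (hPabs i) (hPabs j)
      (petalImmediateBasin_subset_petalBasin hyi) (petalImmediateBasin_subset_petalBasin hyj)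
    have h1 : ζ ^ (j : ℕ) = μ ^ s * ζ ^ (i : ℕ) :=
      mul_left_cancel₀ hv₀0 (hs.trans (by ring))
    have h2 : ζ ^ (j * r : ℕ) = ζ ^ (i * r : ℕ) := by
      rw [pow_mul, pow_mul, h1, mul_pow, ← pow_mul, mul_comm s, pow_mul, hμr, one_pow, one_mul]
    have hlt : ∀ l : Fin e, (l : ℕ) * r < r * e := fun l => by
      rw [mul_comm]
      exact Nat.mul_lt_mul_of_pos_left l.2 hr
    have h3 := hζ.pow_inj (hlt j) (hlt i) h2
    exact hij (Fin.ext (Nat.eq_of_mul_eq_mul_right hr h3).symm)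
  refine ⟨e, he, hord, fun i => P i, fun i => c i, fun i => hP i, hdisj, ?_, ?_, fun i => hc i⟩
  · intro Q hQ
    obtain ⟨v, -, hvQ⟩ := hQ.absorbs
    obtain ⟨y, hy⟩ := hQ.isConnected.nonempty
    have hva := (hdir ((hvQ y).1 ⟨0, hy⟩)).2
    have h1 : (v / v₀) ^ (r * e) = 1 := by
      rw [div_pow, div_eq_one_iff_eq (pow_ne_zero _ hv₀0)]
      exact mul_left_cancel₀ ha (hva.trans hv₀a.symm)
    have : NeZero (r * e) := ⟨hk.ne'⟩
    obtain ⟨j, -, hj⟩ := hζ.eq_pow_of_pow_eq_one h1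
    have h2 : (ζ ^ (e * (j / e))) ^ r = 1 := by
      rw [← pow_mul, mul_comm, ← mul_assoc, pow_mul, hζ.pow_eq_one, one_pow]
    have : NeZero r := ⟨hr.ne'⟩
    obtain ⟨s, -, hs⟩ := hprim.eq_pow_of_pow_eq_one h2
    -- `ζ ^ j = ζ ^ (j % e) (ζ ^ e) ^ (j / e)`, and `ζ ^ e` is a power of the multiplier
    refine ⟨⟨j % e, Nat.mod_lt j he⟩, ?_⟩
    refine (petalImmediateBasin_eq_of_direction hp hr hxp hμr (hP (j % e)) hQ (hPabs (j % e)) hvQ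
      (s := s) ?_).symm
    rw [← hμdef, hs, mul_left_comm, ← pow_add, Nat.div_add_mod, hj, mul_div_cancel₀ _ hv₀0]
  · intro i j hij
    by_contra hne
    have h1 := (hc i).2.1
    have hij : c i = c j := hij
    rw [hij] at h1
    exact Set.disjoint_left.1 (hdisj i j hne) h1 (hc j).2.1

end Parabolic

end RatDyn

theorem mainTheorem10 (f : RatFunc ℂ) (hf : 1 < RatDyn.degree f)
    (x : RatDyn.Sphere) (p : ℕ) (hp : 0 < p)
    (hx : Function.minimalPeriod (RatDyn.sphereMap f) x = p) :
    -- attracting, not super-attracting, cycles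
    ((0 < ‖RatDyn.multiplier (RatDyn.sphereMap f) p x‖ ∧
        ‖RatDyn.multiplier (RatDyn.sphereMap f) p x‖ < 1) →
      ∃ c, RatDyn.IsCriticalPoint (RatDyn.sphereMap f) c ∧
        c ∈ RatDyn.cycleImmediateBasin (RatDyn.sphereMap f)
          (RatDyn.cycle (RatDyn.sphereMap f) x) ∧
        RatDyn.ConvergesTo (RatDyn.sphereMap f) c (RatDyn.cycle (RatDyn.sphereMap f) x)) ∧
    -- parabolic cycles, with multiplier a primitive `r`-th root of unity
    (∀ r : ℕ, 0 < r → IsPrimitiveRoot (RatDyn.multiplier (RatDyn.sphereMap f) p x) r →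
      (∀ Q, RatDyn.IsAttractingPetal (RatDyn.sphereMap f)^[p * r] x Q →
        ∃ c, RatDyn.IsCriticalPoint (RatDyn.sphereMap f) c ∧
          c ∈ RatDyn.petalImmediateBasin (RatDyn.sphereMap f) Q ∧
          RatDyn.ConvergesTo (RatDyn.sphereMap f) c (RatDyn.cycle (RatDyn.sphereMap f) x)) ∧
      ∃ e : ℕ, 0 < e ∧
        analyticOrderAt
          (fun w : ℂ => RatDyn.localExpr (RatDyn.sphereMap f)^[p * r] x w - w) 0
            = ((r * e + 1 : ℕ) : ℕ∞) ∧
        ∃ (P : Fin e → Set RatDyn.Sphere) (c : Fin e → RatDyn.Sphere),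
          (∀ i, RatDyn.IsAttractingPetal (RatDyn.sphereMap f)^[p * r] x (P i)) ∧
          (∀ i j, i ≠ j → Disjoint (RatDyn.petalImmediateBasin (RatDyn.sphereMap f) (P i))
            (RatDyn.petalImmediateBasin (RatDyn.sphereMap f) (P j))) ∧
          (∀ Q, RatDyn.IsAttractingPetal (RatDyn.sphereMap f)^[p * r] x Q →
            ∃ i, RatDyn.petalImmediateBasin (RatDyn.sphereMap f) Q =
              RatDyn.petalImmediateBasin (RatDyn.sphereMap f) (P i)) ∧
          Function.Injective c ∧
          ∀ i, RatDyn.IsCriticalPoint (RatDyn.sphereMap f) (c i) ∧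
            c i ∈ RatDyn.petalImmediateBasin (RatDyn.sphereMap f) (P i) ∧
            RatDyn.ConvergesTo (RatDyn.sphereMap f) (c i)
              (RatDyn.cycle (RatDyn.sphereMap f) x)) := by
  refine ⟨fun h => RatDyn.exists_isCriticalPoint_mem_cycleImmediateBasin hf hp ?_ h.1 h.2,
    fun r hr hprim => RatDyn.parabolic_cycle hf hp hx hr hprim⟩
  rw [← hx]
  exact Function.iterate_minimalPeriod
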